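/- Let $n,p\ge 0$ and let $D=\mathbb{C}[x_1,\dots,x_n,t_1,\dots,t_p]\langle\partial_{x_1},\dots,\partial_{x_n},\partial_{t_1},\dots,\partial_{t_p}\rangle$ be the Weyl algebra. Let $F_d(D)$ (resp. $V_k(D)$) be the span of the monomials $x^{\alpha}t^{\nu}\partial_x^{\beta}\partial_t^{\mu}$ with $|\beta|+|\mu|\le d$ (resp. $|\mu|-|\nu|\le k$), and $F_{d,k}(D)=F_d(D)\cap V_k(D)$ for $d,k\in\mathbb{Z}$. For $\mathbf n,\mathbf m\in\mathbb{Z}^r$ let $D^r[\mathbf n][\mathbf m]$ be $D^r$ with the bifiltration $\bigoplus_i F_{d-n_i,k-m_i}(D)$. Let $M$ be a left $D$-module with a good bifiltration $(F_{d,k}(M))_{d,k\in\mathbb{Z}}$, i.e. one that is increasing, compatible with that of $D$, and such that $M$ is isomorphic as a bifiltered module to a quotient $D^r[\mathbf n][\mathbf m]/N$ with the quotient bifiltration. Assume that $M$ is nicely bifiltered: for all $d,k$, $$\Big(\bigcup_{d'}F_{d',k}(M)\Big)\cap\Big(\bigcup_{k'}F_{d,k'}(M)\Big)=F_{d,k}(M).$$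 The $K$-polynomial $K_{F,V}(M;T_1,T_2)\in\mathbb{Z}[T_1^{\pm1},T_2^{\pm1}]$ is $\sum_i(-1)^i\sum_l T_1^{n^{(i)}_l}T_2^{m^{(i)}_l}$ for any finite bifiltered free resolution $0\to D^{r_\delta}[\mathbf n^{(\delta)}][\mathbf m^{(\delta)}]\to\cdots\to D^{r_0}[\mathbf n^{(0)}][\mathbf m^{(0)}]\to M\to0$, i.e. an exact sequence that is also exact on the pieces $F_{d,k}$ for all $d,k$. The $K$-polynomial $K(\mathcal M;T_1,T_2)$ of a bigraded module $\mathcal M$ over a bigraded ring is defined in the same way by finite bigraded free resolutions. Let $$\mathrm{bigr}(M)=\bigoplus_{d,k}\frac{F_{d,k}(M)}{F_{d-1,k}(M)+F_{d,k-1}(M)},$$ a bigraded module over $\mathrm{bigr}(D)$. For real $a,b>0$ and $L=aF+bV$ put $L_r(M)=\sum_{ad+bk\le r}F_{d,k}(M)$ and $L_{<r}(M)=\sum_{ad+bk<r}F_{d,k}(M)$ for $r\in\mathbb{R}$, and $\mathrm{gr}^L(M)=\bigoplus_r L_r(M)/L_{<r}(M)$, a module over $\mathrm{gr}^L(D)$.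 Then $K_{F,V}(M;T_1,T_2)$ and $K(\mathrm{bigr}(M);T_1,T_2)$ are well defined (resolutions exist and all of them give the same Laurent polynomial), and there is $\epsilon_0>0$ such that for every $0<\epsilon<\epsilon_0$ and for both $L=V+\epsilon F$ and $L=F+\epsilon V$: the images of the $F_{d,k}(D)$, resp. of the $F_{d,k}(M)$, in $\mathrm{gr}^L_{ad+bk}$ (where $L=aF+bV$) are the pieces of a bigrading of the ring $\mathrm{gr}^L(D)$, resp. make $\mathrm{gr}^L(M)$ a bigraded $\mathrm{gr}^L(D)$-module, whose $K$-polynomial is well defined, and $$K_{F,V}(M;T_1,T_2)=K(\mathrm{bigr}(M);T_1,T_2)=K(\mathrm{gr}^L(M);T_1,T_2).$$ -/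

import Mathlib

set_option linter.unusedSectionVars false

namespace BifilteredD

open DirectSum

/-! ### The Weyl algebra -/

section Weyl

/-- The algebra of polynomial differential operators: the subalgebra of `End_ℂ(ℂ[x])` generated
by the multiplications by the variables and by the partial derivatives. -/
noncomputable def weylSubalgebra (σ : Type) :
    Subalgebra ℂ (Module.End ℂ (MvPolynomial σ ℂ)) :=
  Algebra.adjoin ℂ
    (Set.range (fun i : σ => LinearMap.mulLeft ℂ (MvPolynomial.X i : MvPolynomial σ ℂ)) ∪
      Set.range (fun i : σ => (MvPolynomial.pderiv i : Derivation ℂ (MvPolynomial σ ℂ)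
        (MvPolynomial σ ℂ)).toLinearMap))

/-- The Weyl algebra `ℂ[x_i : i ∈ σ]⟨∂_i : i ∈ σ⟩`, realised as the algebra of polynomial
differential operators. -/
def Weyl (σ : Type) : Type := weylSubalgebra σ

noncomputable instance (σ : Type) : Ring (Weyl σ) := inferInstanceAs (Ring (weylSubalgebra σ))

noncomputable instance (σ : Type) : Algebra ℂ (Weyl σ) :=
  inferInstanceAs (Algebra ℂ (weylSubalgebra σ))

/-- The action of the Weyl algebra on polynomials. -/
noncomputable def Weyl.toEnd (σ : Type) : Weyl σ →ₐ[ℂ] Module.End ℂ (MvPolynomial σ ℂ) :=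
  (weylSubalgebra σ).val

theorem Weyl.toEnd_injective (σ : Type) : Function.Injective (Weyl.toEnd σ) :=
  Subtype.val_injective

/-- The variable `x_i` in the Weyl algebra. -/
noncomputable def Weyl.x {σ : Type} (i : σ) : Weyl σ :=
  (⟨LinearMap.mulLeft ℂ (MvPolynomial.X i), Algebra.subset_adjoin (Or.inl ⟨i, rfl⟩)⟩ :
    weylSubalgebra σ)

/-- The derivation `∂_i` in the Weyl algebra. -/
noncomputable def Weyl.del {σ : Type} (i : σ) : Weyl σ :=
  (⟨(MvPolynomial.pderiv i : Derivation ℂ (MvPolynomial σ ℂ) (MvPolynomial σ ℂ)).toLinearMap,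
    Algebra.subset_adjoin (Or.inr ⟨i, rfl⟩)⟩ : weylSubalgebra σ)

theorem Weyl.x_apply {σ : Type} (i : σ) (f : MvPolynomial σ ℂ) :
    Weyl.toEnd σ (Weyl.x i) f = MvPolynomial.X i * f := rfl

theorem Weyl.del_apply {σ : Type} (i : σ) (f : MvPolynomial σ ℂ) :
    Weyl.toEnd σ (Weyl.del i) f = MvPolynomial.pderiv i f := rfl

theorem Weyl.commute_x {σ : Type} (i j : σ) : Commute (Weyl.x i) (Weyl.x j) := by
  apply Weyl.toEnd_injective
  apply LinearMap.ext
  intro f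
  rw [map_mul, map_mul, Module.End.mul_apply, Module.End.mul_apply]
  simp only [Weyl.x_apply]
  ring

theorem Weyl.commute_del {σ : Type} (i j : σ) : Commute (Weyl.del i) (Weyl.del j) := by
  classical
  have h : ⁅(MvPolynomial.pderiv i : Derivation ℂ (MvPolynomial σ ℂ) (MvPolynomial σ ℂ)),
      (MvPolynomial.pderiv j : Derivation ℂ (MvPolynomial σ ℂ) (MvPolynomial σ ℂ))⁆ = 0 := by
    refine MvPolynomial.derivation_ext fun k => ?_
    rw [Derivation.commutator_apply, MvPolynomial.pderiv_X, MvPolynomial.pderiv_X]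
    simp only [Pi.single_apply, apply_ite, map_zero, MvPolynomial.pderiv_one]
    simp
  apply Weyl.toEnd_injective
  apply LinearMap.ext
  intro f
  rw [map_mul, map_mul, Module.End.mul_apply, Module.End.mul_apply]
  simp only [Weyl.del_apply]
  have h2 : ⁅(MvPolynomial.pderiv i : Derivation ℂ (MvPolynomial σ ℂ) (MvPolynomial σ ℂ)),
      (MvPolynomial.pderiv j : Derivation ℂ (MvPolynomial σ ℂ) (MvPolynomial σ ℂ))⁆ f = 0 := by
    rw [h]; rfl
  rw [Derivation.commutator_apply] at h2
  exact sub_eq_zero.mp h2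

variable {σ : Type} [Fintype σ]

theorem Weyl.pairwise_x (α : σ → ℕ) : ((Finset.univ : Finset σ) : Set σ).Pairwise
    (Function.onFun Commute fun i => Weyl.x i ^ α i) :=
  fun i _ j _ _ => (Weyl.commute_x i j).pow_pow _ _

theorem Weyl.pairwise_del (β : σ → ℕ) : ((Finset.univ : Finset σ) : Set σ).Pairwise
    (Function.onFun Commute fun i => Weyl.del i ^ β i) :=
  fun i _ j _ _ => (Weyl.commute_del i j).pow_pow _ _

/-- The monomial `x^α`. -/
noncomputable def Weyl.xPow (α : σ → ℕ) : Weyl σ :=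
  Finset.univ.noncommProd (fun i => Weyl.x i ^ α i) (Weyl.pairwise_x α)

/-- The monomial `∂^β`. -/
noncomputable def Weyl.delPow (β : σ → ℕ) : Weyl σ :=
  Finset.univ.noncommProd (fun i => Weyl.del i ^ β i) (Weyl.pairwise_del β)

/-- The weight `∑ u_i α_i + ∑ v_i β_i` of the exponent `(α, β)`. -/
def Weyl.weight (u v : σ → ℤ) (α β : σ → ℕ) : ℤ :=
  ∑ i, u i * α i + ∑ i, v i * β i

/-- The operators of order at most `d` for the weight vector `(u, v)`: those whose normally
ordered expression `∑ a_{αβ} x^α ∂^β` only involves exponents of weight at most `d`. -/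
noncomputable def Weyl.ordFil (u v : σ → ℤ) (d : ℤ) : Submodule ℂ (Weyl σ) :=
  Submodule.span ℂ {P | ∃ α β : σ → ℕ, Weyl.weight u v α β ≤ d ∧ P = Weyl.xPow α * Weyl.delPow β}

theorem Weyl.x_mul_xPow [DecidableEq σ] (i : σ) (α : σ → ℕ) :
    Weyl.x i * Weyl.xPow α = Weyl.xPow (α + Pi.single i 1) := by
  unfold Weyl.xPow
  rw [← Finset.mul_noncommProd_erase _ (Finset.mem_univ i),
    ← Finset.mul_noncommProd_erase _ (Finset.mem_univ i), ← mul_assoc, ← pow_succ']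
  congr 1
  · simp
  · apply Finset.noncommProd_congr rfl
    intro j hj
    simp [Finset.ne_of_mem_erase hj]

theorem Weyl.del_mul_delPow [DecidableEq σ] (i : σ) (β : σ → ℕ) :
    Weyl.del i * Weyl.delPow β = Weyl.delPow (β + Pi.single i 1) := by
  unfold Weyl.delPow
  rw [← Finset.mul_noncommProd_erase _ (Finset.mem_univ i),
    ← Finset.mul_noncommProd_erase _ (Finset.mem_univ i), ← mul_assoc, ← pow_succ']
  congr 1
  · simp
  · apply Finset.noncommProd_congr rfl
    intro j hj
    simp [Finset.ne_of_mem_erase hj]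

theorem Weyl.xPow_apply (α : σ → ℕ) (f : MvPolynomial σ ℂ) :
    Weyl.toEnd σ (Weyl.xPow α) f =
      MvPolynomial.monomial (Finsupp.equivFunOnFinite.symm α) 1 * f := by
  have h : Weyl.toEnd σ (Weyl.xPow α) =
      Algebra.lmul ℂ (MvPolynomial σ ℂ) (∏ i, MvPolynomial.X i ^ α i) := by
    unfold Weyl.xPow
    rw [← Finset.noncommProd_eq_prod]
    refine (Finset.map_noncommProd _ _ _ _).trans
      (Eq.trans ?_ (Finset.map_noncommProd _ _ _ _).symm)
    apply Finset.noncommProd_congr rfl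
    intro i _
    rw [map_pow, map_pow]
    rfl
  rw [h, MvPolynomial.monomial_eq, Finsupp.prod_fintype _ _ (by simp)]
  simp

theorem Weyl.del_mul_xPow [DecidableEq σ] (i : σ) (α : σ → ℕ) :
    Weyl.del i * Weyl.xPow α =
      Weyl.xPow α * Weyl.del i + (α i : ℂ) • Weyl.xPow (α - Pi.single i 1) := by
  apply Weyl.toEnd_injective
  apply LinearMap.ext
  intro f
  have e : Finsupp.equivFunOnFinite.symm α - Finsupp.single i 1 =
      Finsupp.equivFunOnFinite.symm (α - Pi.single i 1) := by
    ext j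
    simp [Finsupp.single_apply, Pi.single_apply, eq_comm]
  rw [map_add, map_mul, map_mul, map_smul, LinearMap.add_apply, LinearMap.smul_apply,
    Module.End.mul_apply, Module.End.mul_apply]
  simp only [Weyl.xPow_apply, Weyl.del_apply, MvPolynomial.pderiv_mul,
    MvPolynomial.pderiv_monomial, e]
  rw [add_comm, ← smul_mul_assoc, MvPolynomial.smul_monomial]
  simp

theorem Weyl.weight_add [DecidableEq σ] (u v : σ → ℤ) (α β : σ → ℕ) (i : σ) :
    Weyl.weight u v (α + Pi.single i 1) β = Weyl.weight u v α β + u i := by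
  simp [Weyl.weight, mul_add, Finset.sum_add_distrib, Pi.single_apply]
  ring

theorem Weyl.weight_add' [DecidableEq σ] (u v : σ → ℤ) (α β : σ → ℕ) (i : σ) :
    Weyl.weight u v α (β + Pi.single i 1) = Weyl.weight u v α β + v i := by
  simp [Weyl.weight, mul_add, Finset.sum_add_distrib, Pi.single_apply]
  ring

theorem Weyl.xPow_zero : Weyl.xPow (0 : σ → ℕ) = 1 := by
  unfold Weyl.xPow
  rw [Finset.noncommProd_eq_pow_card _ _ _ 1 (by simp)]
  simp

theorem Weyl.delPow_zero : Weyl.delPow (0 : σ → ℕ) = 1 := by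
  unfold Weyl.delPow
  rw [Finset.noncommProd_eq_pow_card _ _ _ 1 (by simp)]
  simp

theorem Weyl.ordFil_mono (u v : σ → ℤ) : Monotone (Weyl.ordFil u v) := by
  intro d e h
  apply Submodule.span_mono
  rintro P ⟨α, β, hw, rfl⟩
  exact ⟨α, β, hw.trans h, rfl⟩

theorem Weyl.one_mem_ordFil (u v : σ → ℤ) : (1 : Weyl σ) ∈ Weyl.ordFil u v 0 :=
  Submodule.subset_span ⟨0, 0, by simp [Weyl.weight], by
    rw [Weyl.xPow_zero, Weyl.delPow_zero, one_mul]⟩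

theorem Weyl.x_mul_mem (u v : σ → ℤ) (i : σ) (d : ℤ) {P : Weyl σ} (hP : P ∈ Weyl.ordFil u v d) :
    Weyl.x i * P ∈ Weyl.ordFil u v (u i + d) := by
  classical
  induction hP using Submodule.span_induction with
  | mem P h =>
    obtain ⟨α, β, hw, rfl⟩ := h
    refine Submodule.subset_span ⟨α + Pi.single i 1, β, ?_, ?_⟩
    · rw [Weyl.weight_add]; omega
    · rw [← Weyl.x_mul_xPow, mul_assoc]
  | zero => simp
  | add P Q _ _ h1 h2 => rw [mul_add]; exact Submodule.add_mem _ h1 h2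
  | smul c P _ h => rw [mul_smul_comm]; exact Submodule.smul_mem _ _ h

theorem Weyl.del_mul_mem (u v : σ → ℤ) (huv : ∀ i, 0 ≤ u i + v i) (i : σ) (d : ℤ) {P : Weyl σ}
    (hP : P ∈ Weyl.ordFil u v d) : Weyl.del i * P ∈ Weyl.ordFil u v (v i + d) := by
  classical
  induction hP using Submodule.span_induction with
  | mem P h =>
    obtain ⟨α, β, hw, rfl⟩ := h
    rw [← mul_assoc, Weyl.del_mul_xPow, add_mul, mul_assoc, Weyl.del_mul_delPow]
    refine Submodule.add_mem _ ?_ ?_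
    · refine Submodule.subset_span ⟨α, β + Pi.single i 1, ?_, rfl⟩
      rw [Weyl.weight_add']; omega
    · rw [smul_mul_assoc]
      by_cases hα : α i = 0
      · simp [hα]
      · refine Submodule.smul_mem _ _ (Submodule.subset_span ⟨α - Pi.single i 1, β, ?_, rfl⟩)
        have e : α = (α - Pi.single i 1) + Pi.single i 1 := by
          ext j
          by_cases hj : j = i
          · subst hj; simp; omega
          · simp [hj]
        rw [e, Weyl.weight_add] at hw
        have := huv i
        omega
  | zero => simp
  | add P Q _ _ h1 h2 => rw [mul_add]; exact Submodule.add_mem _ h1 h2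
  | smul c P _ h => rw [mul_smul_comm]; exact Submodule.smul_mem _ _ h

theorem Weyl.noncommProd_mul_mem (u v w : σ → ℤ) (y : σ → Weyl σ)
    (hy : ∀ i d, ∀ P ∈ Weyl.ordFil u v d, y i * P ∈ Weyl.ordFil u v (w i + d))
    (γ : σ → ℕ) (s : Finset σ) (comm) (d : ℤ) {P : Weyl σ} (hP : P ∈ Weyl.ordFil u v d) :
    s.noncommProd (fun i => y i ^ γ i) comm * P ∈ Weyl.ordFil u v (∑ i ∈ s, w i * γ i + d) := by
  classical
  induction s using Finset.induction_on with
  | empty => simpa using hP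
  | insert a s ha ih =>
    rw [Finset.noncommProd_insert_of_notMem _ _ _ _ ha, Finset.sum_insert ha, mul_assoc]
    have key : ∀ (m : ℕ) (e : ℤ) (Q : Weyl σ), Q ∈ Weyl.ordFil u v e →
        y a ^ m * Q ∈ Weyl.ordFil u v (w a * m + e) := by
      intro m
      induction m with
      | zero => intro e Q hQ; simpa using hQ
      | succ m ihm =>
        intro e Q hQ
        rw [pow_succ', mul_assoc]
        have := hy a _ _ (ihm e Q hQ)
        convert this using 2
        push_cast
        ring
    rw [add_assoc]
    exact key _ _ _ (ih _)

theorem Weyl.mul_mem_ordFil (u v : σ → ℤ) (huv : ∀ i, 0 ≤ u i + v i) {d e : ℤ} {P Q : Weyl σ}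
    (hP : P ∈ Weyl.ordFil u v d) (hQ : Q ∈ Weyl.ordFil u v e) :
    P * Q ∈ Weyl.ordFil u v (d + e) := by
  induction hP using Submodule.span_induction with
  | mem P h =>
    obtain ⟨α, β, hw, rfl⟩ := h
    rw [mul_assoc]
    have h1 := Weyl.noncommProd_mul_mem u v v Weyl.del
      (fun i d P hP => Weyl.del_mul_mem u v huv i d hP) β Finset.univ
      (Weyl.pairwise_del β) e hQ
    have h2 := Weyl.noncommProd_mul_mem u v u Weyl.x
      (fun i d P hP => Weyl.x_mul_mem u v i d hP) α Finset.univ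
      (Weyl.pairwise_x α) _ h1
    refine Weyl.ordFil_mono u v ?_ h2
    unfold Weyl.weight at hw
    linarith
  | zero => simp
  | add P P' _ _ h1 h2 => rw [add_mul]; exact Submodule.add_mem _ h1 h2
  | smul c P _ h => rw [smul_mul_assoc]; exact Submodule.smul_mem _ _ h

end Weyl

/-! ### Associated graded rings and modules -/

section Gr

variable {ι : Type*} [AddCommGroup ι] [PartialOrder ι] [IsOrderedAddMonoid ι]

/-- The quotient `F_i / F_{<i}`. -/
def GrPiece {A : Type*} [AddCommGroup A] (F Flt : ι → AddSubgroup A) (i : ι) : Type _ :=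
  F i ⧸ (Flt i).addSubgroupOf (F i)

instance {A : Type*} [AddCommGroup A] (F Flt : ι → AddSubgroup A) (i : ι) :
    AddCommGroup (GrPiece F Flt i) :=
  inferInstanceAs (AddCommGroup (F i ⧸ (Flt i).addSubgroupOf (F i)))

/-- The class of an element of `F_i` in `F_i / F_{<i}`. -/
def GrPiece.mk {A : Type*} [AddCommGroup A] (F Flt : ι → AddSubgroup A) (i : ι) :
    F i →+ GrPiece F Flt i :=
  QuotientAddGroup.mk' ((Flt i).addSubgroupOf (F i))

/-- The associated graded group `⨁ i, F_i / F_{<i}`. -/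
abbrev Gr {A : Type*} [AddCommGroup A] (F Flt : ι → AddSubgroup A) : Type _ :=
  ⨁ i, GrPiece F Flt i

theorem GrPiece.mk_surjective {A : Type*} [AddCommGroup A] (F Flt : ι → AddSubgroup A) (i : ι) :
    Function.Surjective (GrPiece.mk F Flt i) :=
  QuotientAddGroup.mk'_surjective _

theorem GrPiece.sigma_ext {A : Type*} [AddCommGroup A] {F Flt : ι → AddSubgroup A} {i j : ι}
    (h : i = j) {a : F i} {b : F j} (hab : (a : A) = b) :
    (⟨i, GrPiece.mk F Flt i a⟩ : GradedMonoid (GrPiece F Flt)) = ⟨j, GrPiece.mk F Flt j b⟩ := by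
  subst h
  rw [Subtype.ext hab]

variable {A : Type*} [Ring A] (F Flt : ι → AddSubgroup A) [IsRingFiltration F Flt]
variable {M : Type*} [AddCommGroup M] [Module A M] (G Glt : ι → AddSubgroup M)
  [IsModuleFiltration F Flt G Glt]

theorem lt_smul_mem {A M : Type*} [Ring A] [AddCommGroup M] [Module A M]
    (F Flt : ι → AddSubgroup A) [IsRingFiltration F Flt]
    (G Glt : ι → AddSubgroup M) [IsModuleFiltration F Flt G Glt]
    {i j : ι} {a : A} {m : M} (ha : a ∈ Flt i) (hm : m ∈ G j) : a • m ∈ Glt (i + j) := by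
  have h : Flt i ≤ (Glt (i + j)).comap ((AddMonoidHom.flip (smulAddHom A M)) m) := by
    refine IsFiltration.is_sup (F := F) _ _ fun k hk b hb => ?_
    exact IsFiltration.is_le (F := G) (add_lt_add_of_lt_of_le hk (le_refl j))
      (SetLike.GradedSMul.smul_mem (A := F) (B := G) hb hm)
  exact h ha

theorem smul_lt_mem {A M : Type*} [Ring A] [AddCommGroup M] [Module A M]
    (F Flt : ι → AddSubgroup A) [IsRingFiltration F Flt]
    (G Glt : ι → AddSubgroup M) [IsModuleFiltration F Flt G Glt]
    {i j : ι} {a : A} {m : M} (ha : a ∈ F i) (hm : m ∈ Glt j) : a • m ∈ Glt (i + j) := by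
  have h : Glt j ≤ (Glt (i + j)).comap (smulAddHom A M a) := by
    refine IsFiltration.is_sup (F := G) _ _ fun k hk b hb => ?_
    exact IsFiltration.is_le (F := G) (add_lt_add_of_le_of_lt (le_refl i) hk)
      (SetLike.GradedSMul.smul_mem (A := F) (B := G) ha hb)
  exact h hm

/-- The multiplication `F_i / F_{<i} × G_j / G_{<j} → G_{i+j} / G_{<i+j}`. -/
def GrPiece.smul {i j : ι} : GrPiece F Flt i →+ GrPiece G Glt j →+ GrPiece G Glt (i + j) :=
  QuotientAddGroup.lift _
    { toFun := fun a => QuotientAddGroup.lift _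
        { toFun := fun m => GrPiece.mk G Glt (i + j)
            ⟨(a : A) • (m : M), SetLike.GradedSMul.smul_mem (A := F) (B := G) a.2 m.2⟩
          map_zero' := by
            rw [← map_zero (GrPiece.mk G Glt (i + j))]; congr 1; ext; simp
          map_add' := fun m m' => by
            rw [← map_add]; congr 1; ext; simp }
        (by
          intro m hm
          exact (QuotientAddGroup.eq_zero_iff _).mpr (smul_lt_mem F Flt G Glt a.2 hm))
      map_zero' := by
        refine AddMonoidHom.ext fun m => ?_
        obtain ⟨m, rfl⟩ := GrPiece.mk_surjective G Glt j m
        change GrPiece.mk G Glt (i + j) _ = 0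
        rw [← map_zero (GrPiece.mk G Glt (i + j))]; congr 1; ext; simp
      map_add' := fun a a' => by
        refine AddMonoidHom.ext fun m => ?_
        obtain ⟨m, rfl⟩ := GrPiece.mk_surjective G Glt j m
        change GrPiece.mk G Glt (i + j) _ = GrPiece.mk G Glt (i + j) _ + GrPiece.mk G Glt (i + j) _
        rw [← map_add]; congr 1; ext; simp [add_smul] }
    (by
      intro a ha
      rw [AddMonoidHom.mem_ker]
      refine AddMonoidHom.ext fun m => ?_
      obtain ⟨m, rfl⟩ := GrPiece.mk_surjective G Glt j m
      exact (QuotientAddGroup.eq_zero_iff _).mpr (lt_smul_mem F Flt G Glt ha m.2))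

instance isModuleFiltration_self : IsModuleFiltration F Flt F Flt where
  smul_mem := fun _ _ _ _ ha hb => SetLike.GradedMul.mul_mem ha hb

/-- The class of `1` in `F_0 / F_{<0}`. -/
instance grOne : GradedMonoid.GOne (GrPiece F Flt) where
  one := GrPiece.mk F Flt 0 ⟨1, SetLike.GradedOne.one_mem⟩

/-- The product of classes is the class of the product. -/
instance grMul : GradedMonoid.GMul (GrPiece F Flt) where
  mul := fun a b => GrPiece.smul F Flt F Flt a b

/-- `gr^F(A)` is a graded ring. -/
instance grRing : GRing (GrPiece F Flt) where
  mul_zero := fun a => map_zero _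
  zero_mul := fun b => by
    change GrPiece.smul F Flt F Flt 0 b = 0
    simp
  mul_add := fun a b c => map_add _ _ _
  add_mul := fun a b c => by
    change GrPiece.smul F Flt F Flt (a + b) c =
      GrPiece.smul F Flt F Flt a c + GrPiece.smul F Flt F Flt b c
    simp
  one_mul := by
    rintro ⟨i, a⟩
    obtain ⟨a, rfl⟩ := GrPiece.mk_surjective F Flt i a
    exact GrPiece.sigma_ext (zero_add i) (one_mul _)
  mul_one := by
    rintro ⟨i, a⟩
    obtain ⟨a, rfl⟩ := GrPiece.mk_surjective F Flt i a
    exact GrPiece.sigma_ext (add_zero i) (mul_one _)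
  mul_assoc := by
    rintro ⟨i, a⟩ ⟨j, b⟩ ⟨k, c⟩
    obtain ⟨a, rfl⟩ := GrPiece.mk_surjective F Flt i a
    obtain ⟨b, rfl⟩ := GrPiece.mk_surjective F Flt j b
    obtain ⟨c, rfl⟩ := GrPiece.mk_surjective F Flt k c
    exact GrPiece.sigma_ext (add_assoc i j k) (mul_assoc _ _ _)
  natCast := fun m => m • GrPiece.mk F Flt 0 ⟨1, SetLike.GradedOne.one_mem⟩
  natCast_zero := zero_smul _ _
  natCast_succ := fun m => succ_nsmul _ m
  intCast := fun m => m • GrPiece.mk F Flt 0 ⟨1, SetLike.GradedOne.one_mem⟩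
  intCast_ofNat := fun m => natCast_zsmul _ _
  intCast_negSucc_ofNat := fun m => negSucc_zsmul _ _

/-- `gr^G(M)` is a graded module over `gr^F(A)`. -/
instance grModule : Gmodule (GrPiece F Flt) (GrPiece G Glt) where
  smul := fun a m => GrPiece.smul F Flt G Glt a m
  one_smul := by
    rintro ⟨i, m⟩
    obtain ⟨m, rfl⟩ := GrPiece.mk_surjective G Glt i m
    exact GrPiece.sigma_ext (zero_add i) (one_smul A _)
  mul_smul := by
    rintro ⟨i, a⟩ ⟨j, b⟩ ⟨k, m⟩
    obtain ⟨a, rfl⟩ := GrPiece.mk_surjective F Flt i a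
    obtain ⟨b, rfl⟩ := GrPiece.mk_surjective F Flt j b
    obtain ⟨m, rfl⟩ := GrPiece.mk_surjective G Glt k m
    exact GrPiece.sigma_ext (add_assoc i j k) (mul_smul _ _ _)
  smul_add := fun a b c => map_add _ _ _
  smul_zero := fun a => map_zero _
  add_smul := fun a b c => by simp
  zero_smul := fun b => by simp

/-- The image in `F_i / F_{<i}`, viewed inside `gr^F`, of the elements of `F_i` lying in the
subgroup `S`. -/
def symbols [DecidableEq ι] {A : Type*} [AddCommGroup A] (F Flt : ι → AddSubgroup A) (i : ι)
    (S : AddSubgroup A) : AddSubgroup (Gr F Flt) :=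
  ((S.addSubgroupOf (F i)).map (GrPiece.mk F Flt i)).map (DirectSum.of (GrPiece F Flt) i)

end Gr

/-! ### Bifiltrations; the filtrations `L = aF + bV` -/

section Bifil

variable {A : Type*} [AddCommGroup A]

/-- `F_{d-1,k} + F_{d,k-1}`. -/
def biLt (F : ℤ × ℤ → AddSubgroup A) (j : ℤ × ℤ) : AddSubgroup A :=
  F (j.1 - 1, j.2) ⊔ F (j.1, j.2 - 1)

theorem isFiltration_biLt (F : ℤ × ℤ → AddSubgroup A) (hF : Monotone F) :
    IsFiltration F (biLt F) where
  mono := hF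
  is_le := by
    rintro ⟨d, k⟩ ⟨d', k'⟩ h
    rw [Prod.mk_lt_mk] at h
    rcases h with h | h
    · exact le_trans (hF (Prod.mk_le_mk.mpr ⟨by omega, h.2⟩)) le_sup_left
    · exact le_trans (hF (Prod.mk_le_mk.mpr ⟨h.1, by omega⟩)) le_sup_right
  is_sup := by
    rintro B ⟨d, k⟩ h
    exact sup_le (h _ (Prod.mk_lt_mk.mpr (Or.inl ⟨by simp, le_rfl⟩)))
      (h _ (Prod.mk_lt_mk.mpr (Or.inr ⟨le_rfl, by simp⟩)))

/-- The filtration `L = aF + bV`: `L_r = ∑_{a d + b k ≤ r} F_{d,k}`, for `r ∈ ℝ`. -/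
def LFil (a b : ℝ) (F : ℤ × ℤ → AddSubgroup A) (r : ℝ) : AddSubgroup A :=
  ⨆ (j : ℤ × ℤ) (_ : a * j.1 + b * j.2 ≤ r), F j

/-- `L_{<r} = ∑_{a d + b k < r} F_{d,k}`, the union of the `L_s` with `s < r`. -/
def LLt (a b : ℝ) (F : ℤ × ℤ → AddSubgroup A) (r : ℝ) : AddSubgroup A :=
  ⨆ (j : ℤ × ℤ) (_ : a * j.1 + b * j.2 < r), F j

theorem le_LFil {a b : ℝ} {F : ℤ × ℤ → AddSubgroup A} {r : ℝ} {j : ℤ × ℤ}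
    (h : a * j.1 + b * j.2 ≤ r) : F j ≤ LFil a b F r :=
  le_iSup₂ (f := fun (j : ℤ × ℤ) (_ : a * j.1 + b * j.2 ≤ r) => F j) j h

theorem le_LLt {a b : ℝ} {F : ℤ × ℤ → AddSubgroup A} {r : ℝ} {j : ℤ × ℤ}
    (h : a * j.1 + b * j.2 < r) : F j ≤ LLt a b F r :=
  le_iSup₂ (f := fun (j : ℤ × ℤ) (_ : a * j.1 + b * j.2 < r) => F j) j h

theorem isFiltration_L (a b : ℝ) (F : ℤ × ℤ → AddSubgroup A) :
    IsFiltration (LFil a b F) (LLt a b F) where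
  mono := fun _ _ h => iSup₂_le fun _ hj => le_LFil (hj.trans h)
  is_le := fun h => iSup₂_le fun _ hj => le_LLt (hj.trans_lt h)
  is_sup := fun _ _ h => iSup₂_le fun _ hj => (le_LFil le_rfl).trans (h _ hj)

theorem LFil_smul_mem {R M : Type*} [Ring R] [AddCommGroup M] [Module R M] (a b : ℝ)
    (F : ℤ × ℤ → AddSubgroup R) (G : ℤ × ℤ → AddSubgroup M) [SetLike.GradedSMul F G]
    {r s : ℝ} {c : R} {m : M} (hc : c ∈ LFil a b F r) (hm : m ∈ LFil a b G s) :
    c • m ∈ LFil a b G (r + s) := by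
  have h1 : LFil a b F r ≤ (LFil a b G (r + s)).comap ((AddMonoidHom.flip (smulAddHom R M)) m) := by
    refine iSup₂_le fun i hi c hc => ?_
    have h2 : LFil a b G s ≤ (LFil a b G (r + s)).comap (smulAddHom R M c) := by
      refine iSup₂_le fun j hj m hm => ?_
      have h3 : c • m ∈ G (i + j) := SetLike.GradedSMul.smul_mem (A := F) (B := G) hc hm
      have h4 : a * (i + j).1 + b * (i + j).2 ≤ r + s := by
        simp only [Prod.fst_add, Prod.snd_add]
        push_cast
        linarith
      exact le_LFil h4 h3
    exact h2 hm
  exact h1 hc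

instance isRingFiltration_L {R : Type*} [Ring R] (a b : ℝ) (F : ℤ × ℤ → AddSubgroup R)
    [IsRingFiltration F (biLt F)] : IsRingFiltration (LFil a b F) (LLt a b F) where
  toIsFiltration := isFiltration_L a b F
  one_mem := le_LFil (j := 0) (by simp) SetLike.GradedOne.one_mem
  mul_mem := fun _ _ _ _ hx hy => by
    have := isModuleFiltration_self F (biLt F)
    exact LFil_smul_mem a b F F hx hy

instance isModuleFiltration_L {R M : Type*} [Ring R] [AddCommGroup M] [Module R M] (a b : ℝ)
    (F : ℤ × ℤ → AddSubgroup R) [IsRingFiltration F (biLt F)]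
    (G : ℤ × ℤ → AddSubgroup M) [IsModuleFiltration F (biLt F) G (biLt G)] :
    IsModuleFiltration (LFil a b F) (LLt a b F) (LFil a b G) (LLt a b G) where
  toIsFiltration := isFiltration_L a b G
  smul_mem := fun _ _ _ _ hx hy => LFil_smul_mem a b F G hx hy

/-- `bigr(M) = ⨁_{d,k} F_{d,k}(M) / (F_{d-1,k}(M) + F_{d,k-1}(M))`. -/
abbrev Bigr (F : ℤ × ℤ → AddSubgroup A) : Type _ := Gr F (biLt F)

/-- The bigrading of `bigr(M)`. -/
def bigrPiece (F : ℤ × ℤ → AddSubgroup A) (j : ℤ × ℤ) : AddSubgroup (Bigr F) :=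
  symbols F (biLt F) j (F j)

/-- `gr^L(M)` for `L = aF + bV`. -/
abbrev GrL (a b : ℝ) (F : ℤ × ℤ → AddSubgroup A) : Type _ := Gr (LFil a b F) (LLt a b F)

/-- The piece of bidegree `(d, k)` of `gr^L(M)`, `L = aF + bV`: the image of `F_{d,k}(M)` in
`gr^L_{ad+bk}(M)`. -/
noncomputable def grLPiece (a b : ℝ) (F : ℤ × ℤ → AddSubgroup A) (j : ℤ × ℤ) :
    AddSubgroup (GrL a b F) :=
  symbols (LFil a b F) (LLt a b F) (a * j.1 + b * j.2) (F j)

end Bifil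

/-! ### Free resolutions and `K`-polynomials -/

section Resolution

variable {A : Type*} [Ring A] {N : Type*} [AddCommGroup N] [Module A N]

/-- The pieces of the free module `A^r[b] = ⨁ i, A[b_i]`, where `A[b]_j = A_{j-b}`. This applies
both when the family `𝒜` is a bigrading and when it is a bifiltration of `A`. -/
def shifted (𝒜 : ℤ × ℤ → AddSubgroup A) {r : ℕ} (b : Fin r → ℤ × ℤ) (j : ℤ × ℤ) :
    AddSubgroup (Fin r → A) :=
  AddSubgroup.pi Set.univ (fun i => 𝒜 (j - b i))

/-- `𝒜` is a bigrading of the ring `A` and `𝒩` makes `N` a bigraded module over it. -/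
structure IsBigraded (𝒜 : ℤ × ℤ → AddSubgroup A) (𝒩 : ℤ × ℤ → AddSubgroup N) : Prop where
  ring_mul : SetLike.GradedMonoid 𝒜
  ring_internal : DirectSum.IsInternal 𝒜
  module_smul : SetLike.GradedSMul 𝒜 𝒩
  module_internal : DirectSum.IsInternal 𝒩

/-- A finite free resolution
`0 → A^{r_δ}[b^{(δ)}] → ⋯ → A^{r_1}[b^{(1)}] → A^{r_0}[b^{(0)}] → N → 0`:
an exact sequence of `A`-modules which is also exact on the pieces of index `j`, for every `j`.
For families of subgroups which are bifiltrations this is a bifiltered free resolution; for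
bigradings it is a bigraded free resolution. -/
structure FreeResolution (𝒜 : ℤ × ℤ → AddSubgroup A) (𝒩 : ℤ × ℤ → AddSubgroup N) where
  /-- the length `δ` -/
  length : ℕ
  /-- the ranks `r_i` -/
  rank : ℕ → ℕ
  rank_eq_zero : ∀ i, length < i → rank i = 0
  /-- the shifts `b^{(i)}` -/
  shift : ∀ i, Fin (rank i) → ℤ × ℤ
  /-- the augmentation -/
  aug : (Fin (rank 0) → A) →ₗ[A] N
  /-- the differentials -/
  diff : ∀ i, (Fin (rank (i + 1)) → A) →ₗ[A] (Fin (rank i) → A)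
  aug_surjective : Function.Surjective aug
  exact_zero : Function.Exact (diff 0) aug
  exact_succ : ∀ i, Function.Exact (diff (i + 1)) (diff i)
  aug_piece : ∀ j, (shifted 𝒜 (shift 0) j).map aug.toAddMonoidHom = 𝒩 j
  exact_zero_piece : ∀ j, (shifted 𝒜 (shift 1) j).map (diff 0).toAddMonoidHom =
    shifted 𝒜 (shift 0) j ⊓ aug.toAddMonoidHom.ker
  exact_succ_piece : ∀ i j, (shifted 𝒜 (shift (i + 2)) j).map (diff (i + 1)).toAddMonoidHom =
    shifted 𝒜 (shift (i + 1)) j ⊓ (diff i).toAddMonoidHom.ker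

/-- The Laurent polynomial `∑_i (-1)^i ∑_l T^{b^{(i)}_l}` in `ℤ[T₁^±, T₂^±] = ℤ[ℤ × ℤ]`, where
`T₁^d T₂^k` is the basis element of index `(d, k)`. -/
noncomputable def FreeResolution.kPoly {𝒜 : ℤ × ℤ → AddSubgroup A} {𝒩 : ℤ × ℤ → AddSubgroup N}
    (R : FreeResolution 𝒜 𝒩) : AddMonoidAlgebra ℤ (ℤ × ℤ) :=
  ∑ i ∈ Finset.range (R.length + 1),
    (-1) ^ i * ∑ l : Fin (R.rank i), AddMonoidAlgebra.single (R.shift i l) (1 : ℤ)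

/-- `K` is the `K`-polynomial of `N`: there are finite free resolutions of `N`, and each of them
yields `K`. -/
def IsKPoly (𝒜 : ℤ × ℤ → AddSubgroup A) (𝒩 : ℤ × ℤ → AddSubgroup N)
    (K : AddMonoidAlgebra ℤ (ℤ × ℤ)) : Prop :=
  Nonempty (FreeResolution 𝒜 𝒩) ∧ ∀ R : FreeResolution 𝒜 𝒩, R.kPoly = K

end Resolution

/-! ### `(F, V)`-bifiltered modules over `D = ℂ[x, t]⟨∂_x, ∂_t⟩` -/

section FV

/-- The Weyl algebra `D` in the variables `x_1, …, x_n, t_1, …, t_p`. -/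
abbrev D (n p : ℕ) : Type := Weyl (Fin n ⊕ Fin p)

/-- The filtration `F` by the order of operators: all `x_i, t_i` have weight `0` and all
`∂_{x_i}, ∂_{t_i}` have weight `1`. -/
noncomputable def FFil (n p : ℕ) (d : ℤ) : Submodule ℂ (D n p) :=
  Weyl.ordFil (fun _ => 0) (fun _ => 1) d

/-- The filtration `V` along `t = 0`: `x_i, t_i, ∂_{x_i}, ∂_{t_i}` have weights `0, -1, 0, 1`. -/
noncomputable def VFil (n p : ℕ) (k : ℤ) : Submodule ℂ (D n p) :=
  Weyl.ordFil (Sum.elim (fun _ => 0) (fun _ => -1)) (Sum.elim (fun _ => 0) (fun _ => 1)) k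

/-- The bifiltration `F_{d,k}(D) = F_d(D) ∩ V_k(D)`. -/
noncomputable def FV (n p : ℕ) (j : ℤ × ℤ) : AddSubgroup (D n p) :=
  (FFil n p j.1 ⊓ VFil n p j.2).toAddSubgroup

instance isRingFiltration_FV (n p : ℕ) : IsRingFiltration (FV n p) (biLt (FV n p)) where
  toIsFiltration := isFiltration_biLt _ (fun _ _ h _ hP =>
    ⟨Weyl.ordFil_mono _ _ h.1 hP.1, Weyl.ordFil_mono _ _ h.2 hP.2⟩)
  one_mem := ⟨Weyl.one_mem_ordFil _ _, Weyl.one_mem_ordFil _ _⟩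
  mul_mem := fun _ _ _ _ hP hQ =>
    ⟨Weyl.mul_mem_ordFil _ _ (by simp) hP.1 hQ.1,
      Weyl.mul_mem_ordFil _ _ (by rintro (i | i) <;> simp) hP.2 hQ.2⟩

variable {n p : ℕ} {M : Type*} [AddCommGroup M] [Module (D n p) M]

/-- The bifiltration `F` of `M` is good: as a bifiltered module, `M` is isomorphic to a quotient
`D^r[𝐧][𝐦]/N` with the quotient bifiltration; the shifts are `b_i = (𝐧_i, 𝐦_i)`. -/
def IsGood (F : ℤ × ℤ → AddSubgroup M) : Prop :=
  ∃ (r : ℕ) (b : Fin r → ℤ × ℤ) (N : Submodule (D n p) (Fin r → D n p))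
    (e : ((Fin r → D n p) ⧸ N) ≃ₗ[D n p] M),
    ∀ j, F j = ((shifted (FV n p) b j).map N.mkQ.toAddMonoidHom).map
      e.toLinearMap.toAddMonoidHom

/-- The bifiltration is nice:
`(⋃_{d'} F_{d',k}(M)) ∩ (⋃_{k'} F_{d,k'}(M)) = F_{d,k}(M)` for all `d, k`. -/
def IsNice {M : Type*} [AddCommGroup M] (F : ℤ × ℤ → AddSubgroup M) : Prop :=
  ∀ d k : ℤ, (⋃ d' : ℤ, (F (d', k) : Set M)) ∩ (⋃ k' : ℤ, (F (d, k') : Set M)) = F (d, k)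

end FV

end BifilteredD

open BifilteredD

/-! A bifiltration is handled as the family of its pieces `F (d, k)`, which are the homogeneous pieces
of its Rees module; the two homogenizing variables of the Rees ring act on the pieces as inclusions,
that is, as multiplication by `1`. A finite free resolution of the family is a finite graded free
resolution of the Rees module.

*Existence.* Hilbert's syzygy theorem holds over the Rees ring of `D`: this ring is built from `ℂ` by
adjoining one after the other the two homogenizing variables, the `x_i` and `t_i`, and the `∂`'s, and
each step is an Ore extension `𝒜[y; [y, -]]`. If the syzygy theorem holds over `𝒜`, it holds over
the extension (`SyzygyProp.lext`), by Serre's argument for polynomial rings: the elements of a graded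
submodule `N` which have degree less than `n` in `y` form a graded module `N_n` over `𝒜`, which has a
finite resolution, and for `n` large, when the leading coefficients no longer grow, `N` is the
cokernel of a map from the module induced by `N_n` to the one induced by `N_{n+1}`. The relations of
a good bifiltration thus have a finite free resolution (`IsGood.nonempty_freeResolution`).

*Comparison.* For a nicely bifiltered module the homogenizing variables form a regular sequence on
the Rees module. Reducing a bifiltered free resolution of `M` modulo both variables therefore yields
a free resolution with the same ranks and shifts (`FreeResolution.symbol`); what is resolved is
`bigr(M)`. Moreover, niceness makes the two filtrations distributive enough
(`IsNice.mem_biLt`) for `gr^L(M)` to be the direct sum of the images of the `F (d, k)`, and for these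
images to be the pieces of `bigr(M)`, for every `L = aF + bV` with `a, b > 0` (`isRefinement_L`). The
structure `IsRefinement` covers `bigr` and `gr^L` at the same time; any `ε₀` will do.

*Uniqueness.* The pieces of `bigr(D)` are finitely generated modules over `ℂ[x_1, …, x_n]`, so the
ranks of the pieces of a bigraded module are additive, and the rank of the piece of degree `j` is
`∑_b K_b H(j - b)`, where `K` is the `K`-polynomial of any resolution and `H` is the Hilbert function
of `bigr(D)`. As `H 0 ≠ 0` and the support of `H` is nonnegative for a lexicographic order of
`ℤ × ℤ`, `K` can be recovered (`kPoly_unique_of_isSymbol`). A bifiltered resolution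
induces one of `bigr(M)` with the same `K`-polynomial, so uniqueness also holds for `M`.
-/

set_option linter.unusedSectionVars false

namespace BifilteredD

/-! ### Families of subgroups and their free resolutions -/

section Families

variable {R : Type} [Ring R]

/-- The family of pieces of the free module `⨁ l, R[b_l]` on an arbitrary index type: the
version of `shifted` without the restriction to `Fin r`. -/
def gshift (𝒜 : ℤ × ℤ → AddSubgroup R) {ι : Type} (b : ι → ℤ × ℤ) (j : ℤ × ℤ) :
    AddSubgroup (ι → R) :=
  AddSubgroup.pi Set.univ fun l => 𝒜 (j - b l)

theorem mem_gshift {𝒜 : ℤ × ℤ → AddSubgroup R} {ι : Type} {b : ι → ℤ × ℤ} {j : ℤ × ℤ}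
    {v : ι → R} : v ∈ gshift 𝒜 b j ↔ ∀ l, v l ∈ 𝒜 (j - b l) := by
  simp [gshift, AddSubgroup.mem_pi]

/-- `𝒜` is a multiplicative family: `1 ∈ 𝒜 0` and `𝒜 i * 𝒜 j ⊆ 𝒜 (i + j)`. Such a family is the
list of homogeneous pieces of a graded ring, whose multiplication is that of `R`. -/
structure IsMulFamily (𝒜 : ℤ × ℤ → AddSubgroup R) : Prop where
  one_mem : 1 ∈ 𝒜 0
  mul_mem : ∀ {i j a b}, a ∈ 𝒜 i → b ∈ 𝒜 j → a * b ∈ 𝒜 (i + j)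

/-- The family `𝒦` of subgroups of a module is stable under the family `𝒜` of subgroups of the
ring: it consists of the pieces of a graded module over the graded ring given by `𝒜`. -/
def Stable (𝒜 : ℤ × ℤ → AddSubgroup R) {X : Type*} [AddCommGroup X] [Module R X]
    (𝒦 : ℤ × ℤ → AddSubgroup X) : Prop :=
  ∀ ⦃i j : ℤ × ℤ⦄ ⦃a : R⦄ ⦃x : X⦄, a ∈ 𝒜 i → x ∈ 𝒦 j → a • x ∈ 𝒦 (i + j)

/-- The pieces of the kernel of a homomorphism from a free module. -/
def kerFamily (𝒜 : ℤ × ℤ → AddSubgroup R) {ι : Type} (b : ι → ℤ × ℤ) {X : Type*}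
    [AddCommGroup X] [Module R X] (φ : (ι → R) →ₗ[R] X) (j : ℤ × ℤ) : AddSubgroup (ι → R) :=
  gshift 𝒜 b j ⊓ φ.toAddMonoidHom.ker

theorem mem_kerFamily {𝒜 : ℤ × ℤ → AddSubgroup R} {ι : Type} {b : ι → ℤ × ℤ} {X : Type*}
    [AddCommGroup X] [Module R X] {φ : (ι → R) →ₗ[R] X} {j : ℤ × ℤ} {v : ι → R} :
    v ∈ kerFamily 𝒜 b φ j ↔ v ∈ gshift 𝒜 b j ∧ φ v = 0 := Iff.rfl

/-- `HasRes 𝒜 n 𝒦`: the graded module with pieces `𝒦 j` over the graded ring with pieces `𝒜 j` has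
a graded free resolution `0 → P_{n-1} → ⋯ → P_0` with `n` terms of finite rank. The pieces `𝒦 j`
are subgroups of one ambient `R`-module, and the differentials are `R`-linear maps `R^ι → R^κ`
which respect the pieces. -/
def HasRes (𝒜 : ℤ × ℤ → AddSubgroup R) : ℕ → ∀ {X : Type} [AddCommGroup X] [Module R X],
    (ℤ × ℤ → AddSubgroup X) → Prop
  | 0, _, _, _, 𝒦 => ∀ j, 𝒦 j = ⊥
  | n + 1, X, _, _, 𝒦 => ∃ (ι : Type) (_ : Fintype ι) (b : ι → ℤ × ℤ) (φ : (ι → R) →ₗ[R] X),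
      (∀ j, (gshift 𝒜 b j).map φ.toAddMonoidHom = 𝒦 j) ∧ HasRes 𝒜 n (kerFamily 𝒜 b φ)

variable {𝒜 : ℤ × ℤ → AddSubgroup R}

theorem Stable.gshift (h𝒜 : IsMulFamily 𝒜) {ι : Type} (b : ι → ℤ × ℤ) :
    Stable 𝒜 (gshift 𝒜 b) := by
  intro i j a v ha hv
  rw [mem_gshift] at hv ⊢
  intro l
  rw [add_sub_assoc]
  exact h𝒜.mul_mem ha (hv l)

theorem Stable.kerFamily (h𝒜 : IsMulFamily 𝒜) {ι : Type} (b : ι → ℤ × ℤ) {X : Type*}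
    [AddCommGroup X] [Module R X] (φ : (ι → R) →ₗ[R] X) : Stable 𝒜 (kerFamily 𝒜 b φ) := by
  intro i j a v ha hv
  rw [mem_kerFamily] at hv ⊢
  exact ⟨Stable.gshift h𝒜 b ha hv.1, by rw [map_smul, hv.2, smul_zero]⟩

theorem single_mem_gshift (h𝒜 : IsMulFamily 𝒜) {ι : Type} [DecidableEq ι] (b : ι → ℤ × ℤ)
    (l : ι) : Pi.single l 1 ∈ gshift 𝒜 b (b l) := by
  rw [mem_gshift]
  intro k
  by_cases h : k = l
  · subst h; simpa using h𝒜.one_mem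
  · simp [h, zero_mem]

theorem map_eq_linearCombination {X : Type*} [AddCommGroup X] [Module R X] {ι : Type} [Fintype ι]
    [DecidableEq ι] (φ : (ι → R) →ₗ[R] X) (v : ι → R) :
    φ v = Fintype.linearCombination R (fun l => φ (Pi.single l 1)) v := by
  rw [Fintype.linearCombination_apply]
  conv_lhs => rw [← LinearMap.sum_single_apply (fun _ => R) v, map_sum]
  refine Finset.sum_congr rfl fun l _ => ?_
  rw [← map_smul]
  congr 1
  ext k
  by_cases hk : k = l
  · subst hk; simp
  · simp [hk]

/-- A linear combination `∑ v_l • w_l` with `v` in degree `j` of `⨁ R[b_l]` and `w_l` of degree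
`b_l` has degree `j`. -/
theorem Stable.sum_smul_mem {X : Type*} [AddCommGroup X] [Module R X]
    {𝒦 : ℤ × ℤ → AddSubgroup X} (h𝒦 : Stable 𝒜 𝒦) {ι : Type} [Fintype ι] {b : ι → ℤ × ℤ}
    {w : ι → X} (hw : ∀ l, w l ∈ 𝒦 (b l)) {j : ℤ × ℤ} {v : ι → R} (hv : v ∈ BifilteredD.gshift 𝒜 b j) :
    Fintype.linearCombination R w v ∈ 𝒦 j := by
  rw [Fintype.linearCombination_apply]
  refine sum_mem fun l _ => ?_
  have := h𝒦 (mem_gshift.mp hv l) (hw l)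
  rwa [sub_add_cancel] at this

theorem HasRes.congr {n : ℕ} {X : Type} [AddCommGroup X] [Module R X]
    {𝒦 𝒦' : ℤ × ℤ → AddSubgroup X} (h : HasRes 𝒜 n 𝒦) (e : ∀ j, 𝒦 j = 𝒦' j) :
    HasRes 𝒜 n 𝒦' := by
  rw [← funext e]; exact h

/-- Transport of a resolution along a linear map which is injective on the pieces. -/
theorem HasRes.map {n : ℕ} {X X' : Type} [AddCommGroup X] [Module R X] [AddCommGroup X']
    [Module R X'] {𝒦 : ℤ × ℤ → AddSubgroup X} (h : HasRes 𝒜 n 𝒦) (e : X →ₗ[R] X')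
    (he : ∀ j, ∀ x ∈ 𝒦 j, e x = 0 → x = 0) :
    HasRes 𝒜 n (fun j => (𝒦 j).map e.toAddMonoidHom) := by
  cases n with
  | zero => intro j; simp [h j]
  | succ n =>
    obtain ⟨ι, _, b, φ, h1, h2⟩ := h
    refine ⟨ι, inferInstance, b, e ∘ₗ φ, fun j => ?_, h2.congr fun j => ?_⟩
    · beta_reduce
      rw [← h1 j, AddSubgroup.map_map]; rfl
    · ext v
      rw [mem_kerFamily, mem_kerFamily]
      refine and_congr_right fun hv => ⟨fun h => by simp [h], fun h => ?_⟩
      exact he j _ (by rw [← h1 j]; exact ⟨v, hv, rfl⟩) h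

theorem HasRes.succ {n : ℕ} {X : Type} [AddCommGroup X] [Module R X]
    {𝒦 : ℤ × ℤ → AddSubgroup X} (h : HasRes 𝒜 n 𝒦) : HasRes 𝒜 (n + 1) 𝒦 := by
  induction n generalizing X with
  | zero =>
    refine ⟨Empty, inferInstance, Empty.elim, 0, fun j => ?_, fun j => ?_⟩
    · rw [h j, eq_bot_iff]
      rintro _ ⟨v, -, rfl⟩
      simp
    · rw [eq_bot_iff]
      intro v _
      exact Subsingleton.elim _ _
  | succ n ih =>
    obtain ⟨ι, _, b, φ, h1, h2⟩ := h
    exact ⟨ι, inferInstance, b, φ, h1, ih h2⟩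

theorem HasRes.mono {n m : ℕ} (hnm : n ≤ m) {X : Type} [AddCommGroup X] [Module R X]
    {𝒦 : ℤ × ℤ → AddSubgroup X} (h : HasRes 𝒜 n 𝒦) : HasRes 𝒜 m 𝒦 := by
  induction m, hnm using Nat.le_induction with
  | base => exact h
  | succ m _ ih => exact ih.succ

theorem HasRes.shift {n : ℕ} {X : Type} [AddCommGroup X] [Module R X]
    {𝒦 : ℤ × ℤ → AddSubgroup X} (h : HasRes 𝒜 n 𝒦) (g : ℤ × ℤ) :
    HasRes 𝒜 n (fun j => 𝒦 (j - g)) := by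
  induction n generalizing X with
  | zero => exact fun j => h _
  | succ n ih =>
    obtain ⟨ι, _, b, φ, h1, h2⟩ := h
    have e : ∀ j, BifilteredD.gshift 𝒜 (fun l => b l + g) j = BifilteredD.gshift 𝒜 b (j - g) := by
      intro j
      ext v
      simp only [mem_gshift]
      refine forall_congr' fun l => ?_
      rw [show j - (b l + g) = j - g - b l by abel]
    refine ⟨ι, inferInstance, fun l => b l + g, φ, fun j => ?_, (ih h2).congr fun j => ?_⟩
    · rw [e, h1]
    · simp only [BifilteredD.kerFamily, e]

/-- The horseshoe lemma: if the kernel and the image of `π` on `𝒦` have free resolutions, so does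
`𝒦`. -/
theorem HasRes.ext (h𝒜 : IsMulFamily 𝒜) {n : ℕ} {X Y : Type} [AddCommGroup X] [Module R X]
    [AddCommGroup Y] [Module R Y] {𝒦 : ℤ × ℤ → AddSubgroup X} (h𝒦 : Stable 𝒜 𝒦) (π : X →ₗ[R] Y)
    (hker : HasRes 𝒜 n (fun j => 𝒦 j ⊓ π.toAddMonoidHom.ker))
    (him : HasRes 𝒜 n (fun j => (𝒦 j).map π.toAddMonoidHom)) : HasRes 𝒜 n 𝒦 := by
  classical
  induction n generalizing X Y with
  | zero =>
    intro j
    rw [eq_bot_iff]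
    intro x hx
    rw [← hker j]
    refine ⟨hx, ?_⟩
    have := him j
    rw [eq_bot_iff] at this
    exact this ⟨x, hx, rfl⟩
  | succ n ih =>
    obtain ⟨ι₁, _, b₁, φ₁, h1, h2⟩ := hker
    obtain ⟨ι₂, _, b₂, φ₂, h3, h4⟩ := him
    beta_reduce at h1 h3
    have hlift : ∀ l : ι₂, ∃ k ∈ 𝒦 (b₂ l), π k = φ₂ (Pi.single l 1) := by
      intro l
      have : φ₂ (Pi.single l 1) ∈ (𝒦 (b₂ l)).map π.toAddMonoidHom := by
        rw [← h3]
        exact ⟨_, single_mem_gshift h𝒜 b₂ l, rfl⟩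
      obtain ⟨k, hk, e⟩ := this
      exact ⟨k, hk, e⟩
    choose w hw hwπ using hlift
    set ψ := Fintype.linearCombination R w with hψ
    have hπψ : ∀ v, π (ψ v) = φ₂ v := by
      intro v
      rw [map_eq_linearCombination φ₂, hψ, Fintype.linearCombination_apply,
        Fintype.linearCombination_apply, map_sum]
      exact Finset.sum_congr rfl fun l _ => by rw [map_smul, hwπ]
    -- the projections of `R^(ι₁ ⊕ ι₂)` to its two factors
    let p₁ : (ι₁ ⊕ ι₂ → R) →ₗ[R] (ι₁ → R) := LinearMap.funLeft R R Sum.inl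
    let p₂ : (ι₁ ⊕ ι₂ → R) →ₗ[R] (ι₂ → R) := LinearMap.funLeft R R Sum.inr
    have hp : ∀ j v, v ∈ BifilteredD.gshift 𝒜 (Sum.elim b₁ b₂) j ↔
        p₁ v ∈ BifilteredD.gshift 𝒜 b₁ j ∧ p₂ v ∈ BifilteredD.gshift 𝒜 b₂ j := by
      intro j v
      simp only [mem_gshift, Sum.forall]
      rfl
    let Φ : (ι₁ ⊕ ι₂ → R) →ₗ[R] X := φ₁ ∘ₗ p₁ + ψ ∘ₗ p₂
    have hΦ : ∀ v, Φ v = φ₁ (p₁ v) + ψ (p₂ v) := fun v => rfl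
    have hφ₁ : ∀ j, ∀ v ∈ BifilteredD.gshift 𝒜 b₁ j, φ₁ v ∈ 𝒦 j ∧ π (φ₁ v) = 0 := by
      intro j v hv
      have : φ₁ v ∈ 𝒦 j ⊓ π.toAddMonoidHom.ker := by
        rw [← h1 j]; exact ⟨v, hv, rfl⟩
      exact this
    have hφ₁' : ∀ j, ∀ x ∈ 𝒦 j, π x = 0 → ∃ v ∈ BifilteredD.gshift 𝒜 b₁ j, φ₁ v = x := by
      intro j x hx hx0
      have : x ∈ 𝒦 j ⊓ π.toAddMonoidHom.ker := ⟨hx, hx0⟩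
      rw [← h1 j] at this
      exact this
    refine ⟨ι₁ ⊕ ι₂, inferInstance, Sum.elim b₁ b₂, Φ, fun j => ?_, ?_⟩
    · apply le_antisymm
      · rintro _ ⟨v, hv, rfl⟩
        obtain ⟨hv1, hv2⟩ := (hp j v).mp hv
        exact add_mem (hφ₁ j _ hv1).1 (h𝒦.sum_smul_mem hw hv2)
      · intro x hx
        have : π x ∈ (𝒦 j).map π.toAddMonoidHom := ⟨x, hx, rfl⟩
        rw [← h3 j] at this
        obtain ⟨v₂, hv₂, e⟩ := this
        obtain ⟨v₁, hv₁, e₁⟩ := hφ₁' j (x - ψ v₂) (sub_mem hx (h𝒦.sum_smul_mem hw hv₂))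
          (by rw [map_sub, hπψ, sub_eq_zero]; exact e.symm)
        refine ⟨Sum.elim v₁ v₂, (hp j _).mpr ⟨hv₁, hv₂⟩, ?_⟩
        change φ₁ v₁ + ψ v₂ = x
        rw [e₁, sub_add_cancel]
    · refine ih (Stable.kerFamily h𝒜 _ Φ) p₂ ?_ ?_
      · let i₁ : (ι₁ → R) →ₗ[R] (ι₁ ⊕ ι₂ → R) :=
          LinearMap.pi (Sum.elim (fun l => LinearMap.proj l) fun _ => 0)
        have hi : ∀ v, p₁ (i₁ v) = v := fun v => rfl
        have hi' : ∀ v, p₂ (i₁ v) = 0 := fun v => rfl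
        refine (h2.map i₁ fun j x _ hx => ?_).congr fun j => ?_
        · rw [← hi x, hx, map_zero]
        · ext v
          constructor
          · rintro ⟨u, hu, rfl⟩
            refine ⟨⟨(hp j _).mpr ⟨hu.1, ?_⟩, ?_⟩, hi' u⟩
            · change p₂ (i₁ u) ∈ _
              rw [hi']; exact zero_mem _
            · change φ₁ (p₁ (i₁ u)) + ψ (p₂ (i₁ u)) = 0
              rw [hi, hi', map_zero, add_zero]; exact hu.2
          · rintro ⟨⟨hv, hv0⟩, hv2⟩
            replace hv2 : p₂ v = 0 := hv2
            replace hv0 : φ₁ (p₁ v) + ψ (p₂ v) = 0 := hv0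
            rw [hv2, map_zero, add_zero] at hv0
            refine ⟨p₁ v, ⟨((hp j v).mp hv).1, hv0⟩, ?_⟩
            ext (l | l)
            · rfl
            · exact (congrFun hv2 l).symm
      · refine h4.congr fun j => ?_
        ext v₂
        constructor
        · rintro ⟨hv, hv0⟩
          replace hv0 : φ₂ v₂ = 0 := hv0
          obtain ⟨v₁, hv₁, e₁⟩ := hφ₁' j (-ψ v₂) (neg_mem (h𝒦.sum_smul_mem hw hv))
            (by rw [map_neg, hπψ, hv0, neg_zero])
          refine ⟨Sum.elim v₁ v₂, ⟨(hp j _).mpr ⟨hv₁, hv⟩, ?_⟩, rfl⟩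
          change φ₁ v₁ + ψ v₂ = 0
          rw [e₁, neg_add_cancel]
        · rintro ⟨v, ⟨hv, hv0⟩, rfl⟩
          replace hv0 : φ₁ (p₁ v) + ψ (p₂ v) = 0 := hv0
          obtain ⟨hv1, hv2⟩ := (hp j v).mp hv
          refine ⟨hv2, ?_⟩
          change φ₂ (p₂ v) = 0
          rw [← hπψ, eq_neg_of_add_eq_zero_right hv0, map_neg, (hφ₁ j _ hv1).2, neg_zero]

/-- The mapping cone: if `𝓔` and the kernel of `π` on `𝓔` have free resolutions, so does the image
of `𝓔`. -/
theorem HasRes.cone (h𝒜 : IsMulFamily 𝒜) {n : ℕ} {X Y : Type} [AddCommGroup X] [Module R X]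
    [AddCommGroup Y] [Module R Y] {𝓔 : ℤ × ℤ → AddSubgroup X} (π : X →ₗ[R] Y)
    (hker : HasRes 𝒜 n (fun j => 𝓔 j ⊓ π.toAddMonoidHom.ker)) (h : HasRes 𝒜 n 𝓔) :
    HasRes 𝒜 (n + 1) (fun j => (𝓔 j).map π.toAddMonoidHom) := by
  obtain ⟨ι, _, b, φ, h1, h2⟩ := h.succ
  refine ⟨ι, inferInstance, b, π ∘ₗ φ, fun j => ?_, ?_⟩
  · beta_reduce
    rw [← h1 j, AddSubgroup.map_map]; rfl
  · refine HasRes.ext h𝒜 (Stable.kerFamily h𝒜 _ _) φ (h2.congr fun j => ?_)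
      (hker.congr fun j => ?_)
    · ext v
      constructor
      · rintro ⟨hv, hv0⟩
        replace hv0 : φ v = 0 := hv0
        exact ⟨⟨hv, by change π (φ v) = 0; rw [hv0, map_zero]⟩, hv0⟩
      · rintro ⟨⟨hv, -⟩, hv0⟩
        exact ⟨hv, hv0⟩
    · ext x
      constructor
      · rintro ⟨hx, hx0⟩
        rw [← h1 j] at hx
        obtain ⟨v, hv, rfl⟩ := hx
        exact ⟨v, ⟨hv, hx0⟩, rfl⟩
      · rintro ⟨v, ⟨hv, hv0⟩, rfl⟩
        refine ⟨?_, hv0⟩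
        rw [← h1 j]
        exact ⟨v, hv, rfl⟩

/-- Hilbert's syzygy theorem holds over the graded ring with pieces `𝒜 j`: every graded submodule
of a free module of finite rank has a finite graded free resolution. This includes that such
submodules are finitely generated. -/
def SyzygyProp (𝒜 : ℤ × ℤ → AddSubgroup R) : Prop :=
  ∀ (ι : Type) [Fintype ι] (b : ι → ℤ × ℤ) (𝒦 : ℤ × ℤ → AddSubgroup (ι → R)),
    (∀ j, 𝒦 j ≤ gshift 𝒜 b j) → Stable 𝒜 𝒦 → ∃ n, HasRes 𝒜 n 𝒦

end Families

/-! ### Ore extensions of graded rings -/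

section Ore

variable {R : Type} [Ring R]

/-- The hypotheses on `y` of degree `g` making the ring with pieces `lext 𝒜 y g j` an Ore extension
`𝒜[y; [y, -]]` of the graded ring with pieces `𝒜 j`. Directness is only asked in each degree:
`y` may be `1`, which then plays the role of a homogenizing variable. -/
structure IsOreStep (𝒜 : ℤ × ℤ → AddSubgroup R) (y : R) (g : ℤ × ℤ) : Prop where
  isMul : IsMulFamily 𝒜
  comm_mem : ∀ {j a}, a ∈ 𝒜 j → y * a - a * y ∈ 𝒜 (j + g)
  direct : ∀ {j : ℤ × ℤ} {a : ℕ → R} {n : ℕ}, (∀ i, a i ∈ 𝒜 (j - i • g)) →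
    ∑ i ∈ Finset.range n, a i * y ^ i = 0 → ∀ i < n, a i = 0

/-- The pieces of the Ore extension: the sums `∑ a_i y^i` with `a_i` of degree `j - i g`. -/
def lext (𝒜 : ℤ × ℤ → AddSubgroup R) (y : R) (g j : ℤ × ℤ) : AddSubgroup R :=
  ⨆ i : ℕ, (𝒜 (j - i • g)).map (AddMonoidHom.mulRight (y ^ i))

/-- The pieces of the module induced to the Ore extension: the sums `∑ y^i v_i` with `v_i` of
degree `j - i g`. -/
def rext {X : Type} [AddCommGroup X] [Module R X] (𝒦 : ℤ × ℤ → AddSubgroup X) (y : R)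
    (g j : ℤ × ℤ) : AddSubgroup X :=
  ⨆ i : ℕ, (𝒦 (j - i • g)).map (smulAddHom R X (y ^ i))

/-- Right multiplication of vectors by a scalar. -/
def rmul {ι : Type} (c : R) : (ι → R) →ₗ[R] (ι → R) where
  toFun v l := v l * c
  map_add' v w := by ext l; simp [add_mul]
  map_smul' a v := by ext l; simp [mul_assoc]

/-- The value `∑_{i < n} a_i y^i` of the polynomial with vector coefficients `a_i`. -/
def polyEval {ι : Type} (y : R) (n : ℕ) : (ℕ → ι → R) →ₗ[R] (ι → R) :=
  ∑ i ∈ Finset.range n, rmul (y ^ i) ∘ₗ LinearMap.proj i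

theorem polyEval_apply {ι : Type} (y : R) (n : ℕ) (a : ℕ → ι → R) :
    polyEval y n a = ∑ i ∈ Finset.range n, rmul (y ^ i) (a i) := by
  simp [polyEval, LinearMap.sum_apply]

theorem polyEval_succ {ι : Type} (y : R) (n : ℕ) (a : ℕ → ι → R) :
    polyEval y (n + 1) a = polyEval y n a + rmul (y ^ n) (a n) := by
  simp only [polyEval_apply, Finset.sum_range_succ]

theorem polyEval_congr {ι : Type} (y : R) (n : ℕ) {a a' : ℕ → ι → R} (h : ∀ i < n, a i = a' i) :
    polyEval y n a = polyEval y n a' := by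
  simp only [polyEval_apply]
  exact Finset.sum_congr rfl fun i hi => by rw [h i (Finset.mem_range.mp hi)]

theorem polyEval_of_le {ι : Type} (y : R) {n m : ℕ} (hnm : n ≤ m) {a : ℕ → ι → R}
    (h : ∀ i, n ≤ i → a i = 0) : polyEval y m a = polyEval y n a := by
  simp only [polyEval_apply]
  refine (Finset.sum_subset (Finset.range_mono hnm) fun i _ hi => ?_).symm
  rw [h i (by simpa using hi), map_zero]

theorem rmul_rmul {ι : Type} (c d : R) (v : ι → R) : rmul d (rmul c v) = rmul (c * d) v := by
  ext l
  exact mul_assoc _ _ _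

theorem rmul_one {ι : Type} (v : ι → R) : rmul 1 v = v := by
  ext l
  exact mul_one _

/-- The families of coefficients of polynomials of degree `j`. -/
def coeffFamily (𝒜 : ℤ × ℤ → AddSubgroup R) (g : ℤ × ℤ) {ι : Type} (b : ι → ℤ × ℤ)
    (j : ℤ × ℤ) : AddSubgroup (ℕ → ι → R) :=
  AddSubgroup.pi Set.univ fun i => gshift 𝒜 b (j - i • g)

theorem mem_coeffFamily {𝒜 : ℤ × ℤ → AddSubgroup R} {g : ℤ × ℤ} {ι : Type} {b : ι → ℤ × ℤ}
    {j : ℤ × ℤ} {a : ℕ → ι → R} :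
    a ∈ coeffFamily 𝒜 g b j ↔ ∀ i, a i ∈ gshift 𝒜 b (j - i • g) := by
  simp [coeffFamily, AddSubgroup.mem_pi]

/-- The polynomials of degree less than `n` in `y`, in degree `j` of the free module. -/
def polyLT (𝒜 : ℤ × ℤ → AddSubgroup R) (y : R) (g : ℤ × ℤ) {ι : Type} (b : ι → ℤ × ℤ) (n : ℕ)
    (j : ℤ × ℤ) : AddSubgroup (ι → R) :=
  (coeffFamily 𝒜 g b j).map (polyEval y n).toAddMonoidHom

theorem mem_polyLT {𝒜 : ℤ × ℤ → AddSubgroup R} {y : R} {g : ℤ × ℤ} {ι : Type} {b : ι → ℤ × ℤ}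
    {n : ℕ} {j : ℤ × ℤ} {w : ι → R} : w ∈ polyLT 𝒜 y g b n j ↔
      ∃ a : ℕ → ι → R, (∀ i, a i ∈ gshift 𝒜 b (j - i • g)) ∧ polyEval y n a = w := by
  rw [polyLT, AddSubgroup.mem_map]
  simp only [mem_coeffFamily]
  rfl

variable {𝒜 : ℤ × ℤ → AddSubgroup R} {y : R} {g : ℤ × ℤ} {ι : Type} {b : ι → ℤ × ℤ}

/-- The coefficients of an element of `polyLT` can be chosen zero from the index `n` on. -/
theorem exists_coeff {n : ℕ} {j : ℤ × ℤ} {w : ι → R} (hw : w ∈ polyLT 𝒜 y g b n j) :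
    ∃ a : ℕ → ι → R, (∀ i, a i ∈ gshift 𝒜 b (j - i • g)) ∧ (∀ i, n ≤ i → a i = 0) ∧
      polyEval y n a = w := by
  obtain ⟨a, ha, rfl⟩ := mem_polyLT.mp hw
  refine ⟨fun i => if i < n then a i else 0, fun i => ?_, fun i hi => ?_, ?_⟩
  · by_cases h : i < n
    · simpa [h] using ha i
    · simp [h, zero_mem]
  · simp [Nat.not_lt.mpr hi]
  · exact polyEval_congr y n fun i hi => by simp [hi]

theorem polyLT_mono {n m : ℕ} (hnm : n ≤ m) (j : ℤ × ℤ) :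
    polyLT 𝒜 y g b n j ≤ polyLT 𝒜 y g b m j := by
  intro w hw
  obtain ⟨a, ha, h0, rfl⟩ := exists_coeff hw
  exact mem_polyLT.mpr ⟨a, ha, polyEval_of_le y hnm h0⟩

theorem rmul_pow_mem_polyLT {n m : ℕ} (hnm : n < m) {j : ℤ × ℤ} {c : ι → R}
    (hc : c ∈ gshift 𝒜 b (j - n • g)) : rmul (y ^ n) c ∈ polyLT 𝒜 y g b m j := by
  refine polyLT_mono (Nat.succ_le_of_lt hnm) j
    (mem_polyLT.mpr ⟨fun i => if i = n then c else 0, fun i => ?_, ?_⟩)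
  · by_cases h : i = n
    · subst h; simpa using hc
    · simp [h, zero_mem]
  · rw [Nat.succ_eq_add_one, polyEval_succ]
    rw [polyEval_apply, Finset.sum_eq_zero, zero_add, if_pos rfl]
    intro i hi
    rw [if_neg (Finset.mem_range.mp hi).ne, map_zero]

theorem sub_top_mem_polyLT {n : ℕ} {j : ℤ × ℤ} {a : ℕ → ι → R}
    (ha : ∀ i, a i ∈ gshift 𝒜 b (j - i • g)) :
    polyEval y (n + 1) a - rmul (y ^ n) (a n) ∈ polyLT 𝒜 y g b n j := by
  rw [polyEval_succ, add_sub_cancel_right]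
  exact mem_polyLT.mpr ⟨a, ha, rfl⟩

theorem rmul_mem_polyLT {n : ℕ} {j : ℤ × ℤ} {w : ι → R} (hw : w ∈ polyLT 𝒜 y g b n j) :
    rmul y w ∈ polyLT 𝒜 y g b (n + 1) (j + g) := by
  obtain ⟨a, ha, rfl⟩ := mem_polyLT.mp hw
  rw [polyEval_apply, map_sum]
  refine sum_mem fun i hi => ?_
  rw [rmul_rmul, ← pow_succ]
  refine rmul_pow_mem_polyLT (by simpa using hi) ?_
  rw [show j + g - (i + 1) • g = j - i • g by rw [succ_nsmul]; abel]
  exact ha i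

theorem IsOreStep.comm_mem_gshift (h : IsOreStep 𝒜 y g) {j : ℤ × ℤ} {c : ι → R}
    (hc : c ∈ gshift 𝒜 b j) : y • c - rmul y c ∈ gshift 𝒜 b (j + g) := by
  rw [mem_gshift] at hc ⊢
  intro l
  have := h.comm_mem (hc l)
  rwa [show j - b l + g = j + g - b l by abel] at this

/-- The commutator with `y` does not raise the degree in `y`. -/
theorem IsOreStep.comm_mem_polyLT (h : IsOreStep 𝒜 y g) {n : ℕ} {j : ℤ × ℤ} {w : ι → R}
    (hw : w ∈ polyLT 𝒜 y g b n j) : y • w - rmul y w ∈ polyLT 𝒜 y g b n (j + g) := by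
  obtain ⟨a, ha, rfl⟩ := mem_polyLT.mp hw
  rw [polyEval_apply, map_sum, Finset.smul_sum, ← Finset.sum_sub_distrib]
  refine sum_mem fun i hi => ?_
  have e : y • rmul (y ^ i) (a i) - rmul y (rmul (y ^ i) (a i)) =
      rmul (y ^ i) (y • a i - rmul y (a i)) := by
    rw [map_sub, map_smul, rmul_rmul, rmul_rmul, ← pow_succ, ← pow_succ']
  rw [e]
  refine rmul_pow_mem_polyLT (by simpa using hi) ?_
  rw [show j + g - i • g = j - i • g + g by abel]
  exact h.comm_mem_gshift (ha i)

/-- Left multiplication by `y^k` shifts the leading term. -/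
theorem IsOreStep.pow_smul_sub_mem (h : IsOreStep 𝒜 y g) {n : ℕ} {j : ℤ × ℤ} {w c : ι → R}
    (hc : c ∈ gshift 𝒜 b (j - n • g)) (hw : w - rmul (y ^ n) c ∈ polyLT 𝒜 y g b n j) (k : ℕ) :
    y ^ k • w - rmul (y ^ (n + k)) c ∈ polyLT 𝒜 y g b (n + k) (j + k • g) := by
  induction k with
  | zero => simpa using hw
  | succ k ih =>
    have h1 : y ^ k • w ∈ polyLT 𝒜 y g b (n + k + 1) (j + k • g) := by
      have := add_mem (polyLT_mono (n + k).le_succ _ ih)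
        (rmul_pow_mem_polyLT (y := y) (Nat.lt_succ_self (n + k)) (j := j + k • g) (c := c) (by
          rwa [show j + k • g - (n + k) • g = j - n • g by rw [add_nsmul]; abel]))
      rwa [sub_add_cancel] at this
    have h2 := add_mem (h.comm_mem_polyLT h1) (rmul_mem_polyLT ih)
    rw [map_sub, rmul_rmul, sub_add_sub_cancel, ← pow_succ, smul_smul, ← pow_succ',
      add_assoc j, ← succ_nsmul] at h2
    exact h2

theorem IsOreStep.polyEval_eq_zero (h : IsOreStep 𝒜 y g) {n : ℕ} {j : ℤ × ℤ} {a : ℕ → ι → R}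
    (ha : ∀ i, a i ∈ gshift 𝒜 b (j - i • g)) (h0 : polyEval y n a = 0) : ∀ i < n, a i = 0 := by
  intro i hi
  ext l
  refine h.direct (j := j - b l) (a := fun i => a i l) (fun i => ?_) ?_ i hi
  · have := mem_gshift.mp (ha i) l
    rwa [sub_right_comm] at this
  · have := congrFun h0 l
    rw [polyEval_apply, Finset.sum_apply] at this
    exact this

theorem IsOreStep.eq_zero_of_rmul_mem (h : IsOreStep 𝒜 y g) {n : ℕ} {j : ℤ × ℤ} {c : ι → R}
    (hc : c ∈ gshift 𝒜 b (j - n • g)) (hw : rmul (y ^ n) c ∈ polyLT 𝒜 y g b n j) : c = 0 := by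
  obtain ⟨a, ha, h0, e⟩ := exists_coeff hw
  have := h.polyEval_eq_zero (n := n + 1) (j := j) (b := b) (a := fun i => if i = n then -c else a i)
    (fun i => by
      by_cases hi : i = n
      · subst hi; simpa using hc
      · simpa [hi] using ha i)
    (by
      rw [polyEval_succ, polyEval_congr y n (a' := a) (fun i hi => if_neg hi.ne), e]
      simp) n (Nat.lt_succ_self n)
  simpa using this

theorem mem_rext {X : Type} [AddCommGroup X] [Module R X] {𝒦 : ℤ × ℤ → AddSubgroup X}
    {j : ℤ × ℤ} {x : X} : x ∈ rext 𝒦 y g j ↔ ∃ (K : ℕ) (v : ℕ → X),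
      (∀ k, v k ∈ 𝒦 (j - k • g)) ∧ ∑ k ∈ Finset.range K, y ^ k • v k = x := by
  constructor
  · intro hx
    induction hx using AddSubgroup.iSup_induction' with
    | hp i x hx =>
      obtain ⟨v, hv, rfl⟩ := hx
      refine ⟨i + 1, fun k => if k = i then v else 0, fun k => ?_, ?_⟩
      · by_cases hk : k = i
        · subst hk; simpa using hv
        · simp [hk, zero_mem]
      · rw [Finset.sum_eq_single i]
        · simp
        · intro k _ hk; simp [hk]
        · simp
    | h1 => exact ⟨0, 0, fun k => zero_mem _, by simp⟩
    | hadd x x' _ _ h1 h2 =>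
      obtain ⟨K, v, hv, rfl⟩ := h1
      obtain ⟨K', v', hv', rfl⟩ := h2
      refine ⟨max K K', fun k => (if k < K then v k else 0) + (if k < K' then v' k else 0),
        fun k => add_mem ?_ ?_, ?_⟩
      · split_ifs
        exacts [hv k, zero_mem _]
      · split_ifs
        exacts [hv' k, zero_mem _]
      · simp only [smul_add, Finset.sum_add_distrib, smul_ite, smul_zero]
        rw [← Finset.sum_filter, ← Finset.sum_filter]
        congr 2 <;> (ext k; simp; omega)
  · rintro ⟨K, v, hv, rfl⟩
    refine sum_mem fun k _ => ?_
    exact (le_iSup (fun i : ℕ => (𝒦 (j - i • g)).map (smulAddHom R X (y ^ i))) k)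
      ⟨v k, hv k, rfl⟩

theorem pow_smul_mem_rext {X : Type} [AddCommGroup X] [Module R X]
    {𝒦 : ℤ × ℤ → AddSubgroup X} {j : ℤ × ℤ} {x : X} {k : ℕ} (hx : x ∈ 𝒦 (j - k • g)) :
    y ^ k • x ∈ rext 𝒦 y g j :=
  (le_iSup (fun i : ℕ => (𝒦 (j - i • g)).map (smulAddHom R X (y ^ i))) k) ⟨x, hx, rfl⟩

theorem mem_rext_of_mem {X : Type} [AddCommGroup X] [Module R X]
    {𝒦 : ℤ × ℤ → AddSubgroup X} {j : ℤ × ℤ} {x : X} (hx : x ∈ 𝒦 j) : x ∈ rext 𝒦 y g j := by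
  have := pow_smul_mem_rext (y := y) (g := g) (k := 0) (j := j) (x := x) (𝒦 := 𝒦) (by simpa using hx)
  simpa using this

theorem mul_pow_mem_lext {j : ℤ × ℤ} {a : R} {k : ℕ} (ha : a ∈ 𝒜 (j - k • g)) :
    a * y ^ k ∈ lext 𝒜 y g j :=
  (le_iSup (fun i : ℕ => (𝒜 (j - i • g)).map (AddMonoidHom.mulRight (y ^ i))) k) ⟨a, ha, rfl⟩

theorem mem_lext_of_mem {j : ℤ × ℤ} {a : R} (ha : a ∈ 𝒜 j) : a ∈ lext 𝒜 y g j := by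
  have := mul_pow_mem_lext (y := y) (g := g) (k := 0) (j := j) (a := a) (𝒜 := 𝒜) (by simpa using ha)
  simpa using this

theorem IsOreStep.mem_lext_self (h : IsOreStep 𝒜 y g) : y ∈ lext 𝒜 y g g := by
  have := mul_pow_mem_lext (y := y) (g := g) (k := 1) (j := g) (a := 1) (𝒜 := 𝒜)
    (by simpa using h.isMul.one_mem)
  simpa using this

theorem IsOreStep.mul_mem_lext (h : IsOreStep 𝒜 y g) {j : ℤ × ℤ} {x : R}
    (hx : x ∈ lext 𝒜 y g j) : y * x ∈ lext 𝒜 y g (j + g) := by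
  induction hx using AddSubgroup.iSup_induction' with
  | hp i x hx =>
    obtain ⟨a, ha, rfl⟩ := hx
    have e : y * (a * y ^ i) = (y * a - a * y) * y ^ i + a * y ^ (i + 1) := by
      rw [pow_succ']; noncomm_ring
    change y * (a * y ^ i) ∈ _
    rw [e]
    refine add_mem (mul_pow_mem_lext ?_) (mul_pow_mem_lext ?_)
    · rw [show j + g - i • g = j - i • g + g by abel]
      exact h.comm_mem ha
    · rwa [show j + g - (i + 1) • g = j - i • g by rw [succ_nsmul]; abel]
  | h1 => rw [mul_zero]; exact zero_mem _
  | hadd x x' _ _ h1 h2 => rw [mul_add]; exact add_mem h1 h2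

theorem IsOreStep.isMulFamily_lext (h : IsOreStep 𝒜 y g) : IsMulFamily (lext 𝒜 y g) where
  one_mem := mem_lext_of_mem h.isMul.one_mem
  mul_mem := by
    intro i j a x ha hx
    have h1 : ∀ {i j : ℤ × ℤ} {a x : R}, a ∈ 𝒜 i → x ∈ lext 𝒜 y g j → a * x ∈ lext 𝒜 y g (i + j) := by
      intro i j a x ha hx
      induction hx using AddSubgroup.iSup_induction' with
      | hp k x hx =>
        obtain ⟨c, hc, rfl⟩ := hx
        change a * (c * y ^ k) ∈ _
        rw [← mul_assoc]
        refine mul_pow_mem_lext ?_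
        rw [add_sub_assoc]
        exact h.isMul.mul_mem ha hc
      | h1 => rw [mul_zero]; exact zero_mem _
      | hadd x x' _ _ h1 h2 => rw [mul_add]; exact add_mem h1 h2
    have h2 : ∀ (k : ℕ) {j : ℤ × ℤ} {x : R}, x ∈ lext 𝒜 y g j → y ^ k * x ∈ lext 𝒜 y g (j + k • g) := by
      intro k
      induction k with
      | zero => intro j x hx; simpa using hx
      | succ k ih =>
        intro j x hx
        rw [pow_succ', mul_assoc, succ_nsmul, ← add_assoc]
        exact h.mul_mem_lext (ih hx)
    induction ha using AddSubgroup.iSup_induction' with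
    | hp k a ha =>
      obtain ⟨c, hc, rfl⟩ := ha
      change c * y ^ k * x ∈ _
      rw [mul_assoc, show i + j = i - k • g + (j + k • g) by abel]
      exact h1 hc (h2 k hx)
    | h1 => rw [zero_mul]; exact zero_mem _
    | hadd a a' _ _ h1 h2 => rw [add_mul]; exact add_mem h1 h2

theorem mem_gshift_lext_of_mem_polyLT {n : ℕ} {j : ℤ × ℤ} {w : ι → R}
    (hw : w ∈ polyLT 𝒜 y g b n j) : w ∈ gshift (lext 𝒜 y g) b j := by
  obtain ⟨a, ha, rfl⟩ := mem_polyLT.mp hw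
  rw [polyEval_apply]
  refine sum_mem fun i _ => mem_gshift.mpr fun l => mul_pow_mem_lext ?_
  rw [sub_right_comm]
  exact mem_gshift.mp (ha i) l

theorem exists_mem_polyLT [Fintype ι] {j : ℤ × ℤ} {w : ι → R}
    (hw : w ∈ gshift (lext 𝒜 y g) b j) : ∃ n, w ∈ polyLT 𝒜 y g b n j := by
  classical
  have key : ∀ (l : ι) (x : R), x ∈ lext 𝒜 y g (j - b l) →
      ∃ n, (Pi.single l x : ι → R) ∈ polyLT 𝒜 y g b n j := by
    intro l x hx
    induction hx using AddSubgroup.iSup_induction' with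
    | hp i x hx =>
      obtain ⟨a, ha, rfl⟩ := hx
      refine ⟨i + 1, ?_⟩
      have e : (Pi.single l (a * y ^ i) : ι → R) = rmul (y ^ i) (Pi.single l a) := by
        ext k
        by_cases hk : k = l
        · subst hk; simp [rmul]
        · simp [rmul, hk]
      change (Pi.single l (a * y ^ i) : ι → R) ∈ _
      rw [e]
      refine rmul_pow_mem_polyLT (Nat.lt_succ_self i) (mem_gshift.mpr fun k => ?_)
      by_cases hk : k = l
      · subst hk
        rw [sub_right_comm]
        simpa using ha
      · simp [hk, zero_mem]
    | h1 => exact ⟨0, by simp [zero_mem]⟩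
    | hadd x x' _ _ h1 h2 =>
      obtain ⟨n, hn⟩ := h1
      obtain ⟨m, hm⟩ := h2
      refine ⟨max n m, ?_⟩
      rw [Pi.single_add]
      exact add_mem (polyLT_mono (le_max_left _ _) _ hn) (polyLT_mono (le_max_right _ _) _ hm)
  choose n hn using fun l => key l (w l) (mem_gshift.mp hw l)
  refine ⟨Finset.univ.sup n, ?_⟩
  rw [← Finset.univ_sum_single w]
  exact sum_mem fun l _ => polyLT_mono (Finset.le_sup (Finset.mem_univ l)) _ (hn l)

/-- The free module over the Ore extension is induced from the free module over the base. -/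
theorem IsOreStep.rext_gshift [Fintype ι] (h : IsOreStep 𝒜 y g) (j : ℤ × ℤ) :
    rext (gshift 𝒜 b) y g j = gshift (lext 𝒜 y g) b j := by
  have hpow : ∀ {k : ℕ} {j : ℤ × ℤ} {c : ι → R}, c ∈ gshift 𝒜 b (j - k • g) →
      y ^ k • c - rmul (y ^ k) c ∈ polyLT 𝒜 y g b k j := by
    intro k j c hc
    have := h.pow_smul_sub_mem (n := 0) (j := j - k • g) (w := c) (c := c) (by simpa using hc)
      (by rw [pow_zero, rmul_one, sub_self]; exact zero_mem _) k
    rwa [zero_add, sub_add_cancel] at this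
  apply le_antisymm
  · refine iSup_le fun k => ?_
    rintro _ ⟨c, hc, rfl⟩
    have h1 := polyLT_mono k.le_succ j (hpow hc)
    have h2 := rmul_pow_mem_polyLT (𝒜 := 𝒜) (y := y) k.lt_succ_self hc
    have h3 := add_mem h1 h2
    rw [sub_add_cancel] at h3
    exact mem_gshift_lext_of_mem_polyLT h3
  · intro w hw
    obtain ⟨n, hn⟩ := exists_mem_polyLT hw
    clear hw
    induction n generalizing w with
    | zero =>
      obtain ⟨a, -, rfl⟩ := mem_polyLT.mp hn
      simp [polyEval_apply, zero_mem]
    | succ n ih =>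
      obtain ⟨a, ha, rfl⟩ := mem_polyLT.mp hn
      have h1 := sub_mem (sub_top_mem_polyLT (y := y) (n := n) ha) (hpow (ha n))
      have h2 := add_mem (ih h1) (pow_smul_mem_rext (y := y) (ha n))
      rw [sub_sub_eq_add_sub] at h2
      simpa using h2

/-- Sums `∑ y^k v_k` of elements of the pieces of `𝒦` in a fixed total degree are direct. -/
def RDirect (y : R) (g : ℤ × ℤ) {X : Type} [AddCommGroup X] [Module R X]
    (𝒦 : ℤ × ℤ → AddSubgroup X) : Prop :=
  ∀ ⦃j : ℤ × ℤ⦄ ⦃K : ℕ⦄ ⦃v : ℕ → X⦄, (∀ k, v k ∈ 𝒦 (j - k • g)) →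
    ∑ k ∈ Finset.range K, y ^ k • v k = 0 → ∀ k < K, v k = 0

theorem IsOreStep.rDirect_gshift (h : IsOreStep 𝒜 y g) (b : ι → ℤ × ℤ) :
    RDirect y g (gshift 𝒜 b) := by
  intro j K v hv h0
  have hpow : ∀ k, y ^ k • v k - rmul (y ^ k) (v k) ∈ polyLT 𝒜 y g b k j := by
    intro k
    have := h.pow_smul_sub_mem (n := 0) (j := j - k • g) (w := v k) (c := v k)
      (by simpa using hv k) (by rw [pow_zero, rmul_one, sub_self]; exact zero_mem _) k
    rwa [zero_add, sub_add_cancel] at this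
  induction K with
  | zero => intro k hk; omega
  | succ K ih =>
    have hlow : ∑ k ∈ Finset.range K, y ^ k • v k ∈ polyLT 𝒜 y g b K j := by
      refine sum_mem fun k hk => polyLT_mono (Nat.succ_le_of_lt (Finset.mem_range.mp hk)) _ ?_
      have := add_mem (polyLT_mono k.le_succ _ (hpow k))
        (rmul_pow_mem_polyLT (𝒜 := 𝒜) (y := y) k.lt_succ_self (hv k))
      rwa [sub_add_cancel] at this
    rw [Finset.sum_range_succ] at h0
    have htop : v K = 0 := by
      refine h.eq_zero_of_rmul_mem (hv K) ?_
      have := neg_mem (add_mem (hpow K) hlow)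
      rw [show -(y ^ K • v K - rmul (y ^ K) (v K) + ∑ k ∈ Finset.range K, y ^ k • v k) =
        rmul (y ^ K) (v K) - (∑ k ∈ Finset.range K, y ^ k • v k + y ^ K • v K) by abel,
        h0, sub_zero] at this
      exact this
    rw [htop, smul_zero, add_zero] at h0
    intro k hk
    rcases Nat.lt_succ_iff_lt_or_eq.mp hk with hk | rfl
    · exact ih h0 k hk
    · exact htop

theorem map_rext {X X' : Type} [AddCommGroup X] [Module R X] [AddCommGroup X'] [Module R X']
    (φ : X →ₗ[R] X') (𝒦 : ℤ × ℤ → AddSubgroup X) (j : ℤ × ℤ) :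
    (rext 𝒦 y g j).map φ.toAddMonoidHom =
      rext (fun j => (𝒦 j).map φ.toAddMonoidHom) y g j := by
  simp only [rext, AddSubgroup.map_iSup, AddSubgroup.map_map]
  congr 1
  ext i : 1
  congr 1
  ext x
  simp

/-- Base change to the Ore extension: the matrices of a free resolution over the base give a free
resolution of the induced module. -/
theorem HasRes.rext (h : IsOreStep 𝒜 y g) {n : ℕ} {X : Type} [AddCommGroup X] [Module R X]
    {𝒦 : ℤ × ℤ → AddSubgroup X} (h𝒦 : HasRes 𝒜 n 𝒦) (hd : RDirect y g 𝒦) :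
    HasRes (lext 𝒜 y g) n (rext 𝒦 y g) := by
  induction n generalizing X with
  | zero => intro j; simp [BifilteredD.rext, h𝒦 _]
  | succ n ih =>
    obtain ⟨ι, _, b, φ, h1, h2⟩ := h𝒦
    refine ⟨ι, inferInstance, b, φ, fun j => ?_, (ih h2 ?_).congr fun j => ?_⟩
    · rw [← h.rext_gshift, map_rext]
      congr 1
      exact funext h1
    · intro j K v hv
      exact h.rDirect_gshift b fun k => (hv k).1
    · ext v
      rw [mem_kerFamily, ← h.rext_gshift, mem_rext, mem_rext]
      constructor
      · rintro ⟨K, v, hv, rfl⟩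
        refine ⟨⟨K, v, fun k => (hv k).1, rfl⟩, ?_⟩
        rw [map_sum]
        refine Finset.sum_eq_zero fun k _ => ?_
        rw [map_smul, (mem_kerFamily.mp (hv k)).2, smul_zero]
      · rintro ⟨⟨K, v, hv, rfl⟩, h0⟩
        rw [map_sum] at h0
        simp only [map_smul] at h0
        have := hd (j := j) (K := K) (v := fun k => φ (v k))
          (fun k => by rw [← h1]; exact ⟨v k, hv k, rfl⟩) h0
        refine ⟨K, fun k => if k < K then v k else 0, fun k => ?_, ?_⟩
        · beta_reduce
          split_ifs with hk
          · exact ⟨hv k, this k hk⟩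
          · exact zero_mem _
        · refine Finset.sum_congr rfl fun k hk => ?_
          simp only [if_pos (Finset.mem_range.mp hk)]

end Ore

/-! ### The syzygy theorem for Ore extensions -/

section OreSyzygy

variable {R : Type} [Ring R] {𝒜 : ℤ × ℤ → AddSubgroup R} {y : R} {g : ℤ × ℤ} {ι : Type}
  {b : ι → ℤ × ℤ}

/-- For a graded submodule `N` of the free module over the Ore extension, the coefficients of the
elements of `N` of degree less than `n` in `y`. -/
def liftFamily (𝒜 : ℤ × ℤ → AddSubgroup R) (y : R) (g : ℤ × ℤ) (b : ι → ℤ × ℤ)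
    (N : ℤ × ℤ → AddSubgroup (ι → R)) (n : ℕ) (j : ℤ × ℤ) : AddSubgroup (ℕ → ι → R) :=
  coeffFamily 𝒜 g b j ⊓ AddSubgroup.pi {i | n ≤ i} (fun _ => ⊥) ⊓
    (N j).comap (polyEval y n).toAddMonoidHom

variable {N : ℤ × ℤ → AddSubgroup (ι → R)}

theorem mem_liftFamily {n : ℕ} {j : ℤ × ℤ} {a : ℕ → ι → R} :
    a ∈ liftFamily 𝒜 y g b N n j ↔ (∀ i, a i ∈ gshift 𝒜 b (j - i • g)) ∧
      (∀ i, n ≤ i → a i = 0) ∧ polyEval y n a ∈ N j := by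
  rw [liftFamily, AddSubgroup.mem_inf, AddSubgroup.mem_inf, mem_coeffFamily, AddSubgroup.mem_pi,
    and_assoc]
  rfl

theorem liftFamily_mono {n m : ℕ} (hnm : n ≤ m) (j : ℤ × ℤ) :
    liftFamily 𝒜 y g b N n j ≤ liftFamily 𝒜 y g b N m j := by
  intro a ha
  rw [mem_liftFamily] at ha ⊢
  exact ⟨ha.1, fun i hi => ha.2.1 i (hnm.trans hi), by rw [polyEval_of_le y hnm ha.2.1]; exact ha.2.2⟩

theorem Stable.liftFamily (h𝒜 : IsMulFamily 𝒜) (hN : Stable 𝒜 N) (n : ℕ) :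
    Stable 𝒜 (liftFamily 𝒜 y g b N n) := by
  intro i j c a hc ha
  rw [mem_liftFamily] at ha ⊢
  refine ⟨fun k => ?_, fun k hk => ?_, ?_⟩
  · rw [add_sub_assoc]
    exact Stable.gshift h𝒜 b hc (ha.1 k)
  · rw [Pi.smul_apply, ha.2.1 k hk, smul_zero]
  · rw [map_smul]; exact hN hc ha.2.2

theorem SyzygyProp.liftFamily [Fintype ι] (h𝒜 : IsMulFamily 𝒜) (hs : SyzygyProp 𝒜)
    (hN : Stable 𝒜 N) (n : ℕ) : ∃ m, HasRes 𝒜 m (liftFamily 𝒜 y g b N n) := by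
  let e : (ι × Fin n → R) →ₗ[R] (ℕ → ι → R) :=
    LinearMap.pi fun i => LinearMap.pi fun l =>
      if h : i < n then LinearMap.proj (l, (⟨i, h⟩ : Fin n)) else 0
  have he : ∀ v (i : Fin n) l, e v i l = v (l, i) := by
    intro v i l
    simp [e]
  have he' : ∀ v i, n ≤ i → e v i = 0 := by
    intro v i hi
    ext l
    simp [e, Nat.not_lt.mpr hi]
  obtain ⟨m, hm⟩ := hs (ι × Fin n) (fun q => b q.1 + (q.2 : ℕ) • g)
    (fun j => (BifilteredD.liftFamily 𝒜 y g b N n j).comap e.toAddMonoidHom)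
    (by
      intro j v hv
      have hv := mem_liftFamily.mp (AddSubgroup.mem_comap.mp hv)
      rw [mem_gshift]
      rintro ⟨l, i⟩
      have := mem_gshift.mp (hv.1 i) l
      rw [show j - (b l + (i : ℕ) • g) = j - (i : ℕ) • g - b l by abel]
      change e v i l ∈ _ at this
      rwa [he] at this)
    (by
      intro i j c v hc hv
      rw [AddSubgroup.mem_comap] at hv ⊢
      change e (c • v) ∈ _
      rw [map_smul]
      exact Stable.liftFamily h𝒜 hN n hc hv)
  refine ⟨m, (hm.map e ?_).congr fun j => ?_⟩
  · intro j v _ hv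
    ext ⟨l, i⟩
    rw [← he v i l, hv]; rfl
  · ext a
    constructor
    · rintro ⟨v, hv, rfl⟩
      exact hv
    · intro ha
      have hav : e (fun q => a q.2 q.1) = a := by
        ext i l
        by_cases hi : i < n
        · exact he _ ⟨i, hi⟩ l
        · rw [he' _ i (by omega), (mem_liftFamily.mp ha).2.1 i (by omega)]
      refine ⟨fun q => a q.2 q.1, ?_, hav⟩
      rw [SetLike.mem_coe, AddSubgroup.mem_comap]
      change e _ ∈ _
      rwa [hav]

/-- The leading coefficients of the elements of `N` of degree at most `n` in `y`. -/
def leadFamily (𝒜 : ℤ × ℤ → AddSubgroup R) (y : R) (g : ℤ × ℤ) (b : ι → ℤ × ℤ)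
    (N : ℤ × ℤ → AddSubgroup (ι → R)) (n : ℕ) (j : ℤ × ℤ) : AddSubgroup (ι → R) :=
  gshift 𝒜 b j ⊓
    (N (j + n • g) ⊔ polyLT 𝒜 y g b n (j + n • g)).comap (rmul (y ^ n)).toAddMonoidHom

theorem mem_leadFamily {n : ℕ} {j : ℤ × ℤ} {c : ι → R} :
    c ∈ leadFamily 𝒜 y g b N n j ↔ c ∈ gshift 𝒜 b j ∧
      ∃ w ∈ N (j + n • g), w - rmul (y ^ n) c ∈ polyLT 𝒜 y g b n (j + n • g) := by
  rw [leadFamily, AddSubgroup.mem_inf, AddSubgroup.mem_comap, AddSubgroup.mem_sup]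
  refine and_congr_right fun _ => ⟨?_, ?_⟩
  · rintro ⟨w, hw, z, hz, e⟩
    refine ⟨w, hw, ?_⟩
    have e : w + z = rmul (y ^ n) c := e
    rw [← e, sub_add_cancel_left]
    exact neg_mem hz
  · rintro ⟨w, hw, hz⟩
    exact ⟨w, hw, _, neg_mem hz, by simp⟩

theorem IsOreStep.leadFamily_mono (h : IsOreStep 𝒜 y g) (hN : Stable (lext 𝒜 y g) N)
    (j : ℤ × ℤ) : Monotone fun n => leadFamily 𝒜 y g b N n j := by
  refine monotone_nat_of_le_succ fun n c hc => ?_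
  rw [mem_leadFamily] at hc ⊢
  obtain ⟨hc, w, hw, hwc⟩ := hc
  refine ⟨hc, y • w, ?_, ?_⟩
  · have := hN h.mem_lext_self hw
    rwa [show g + (j + n • g) = j + (n + 1) • g by rw [succ_nsmul]; abel] at this
  · have := h.pow_smul_sub_mem (by rwa [add_sub_cancel_right]) hwc 1
    rw [pow_one, one_nsmul, add_assoc, ← succ_nsmul] at this
    exact this

theorem IsOreStep.stable_of_lext {X : Type*} [AddCommGroup X] [Module R X]
    {𝒦 : ℤ × ℤ → AddSubgroup X} (h : Stable (lext 𝒜 y g) 𝒦) : Stable 𝒜 𝒦 :=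
  fun _ _ _ _ ha hx => h (mem_lext_of_mem ha) hx

theorem Stable.polyLT (h𝒜 : IsMulFamily 𝒜) (n : ℕ) : Stable 𝒜 (polyLT 𝒜 y g b n) := by
  intro i j c w hc hw
  obtain ⟨a, ha, rfl⟩ := mem_polyLT.mp hw
  refine mem_polyLT.mpr ⟨c • a, fun k => ?_, by rw [map_smul]⟩
  rw [add_sub_assoc]
  exact Stable.gshift h𝒜 b hc (ha k)

theorem Stable.leadFamily (h𝒜 : IsMulFamily 𝒜) (hN : Stable 𝒜 N) (n : ℕ) :
    Stable 𝒜 (leadFamily 𝒜 y g b N n) := by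
  intro i j a c ha hc
  rw [mem_leadFamily] at hc ⊢
  obtain ⟨hc, w, hw, hwc⟩ := hc
  refine ⟨Stable.gshift h𝒜 b ha hc, a • w, ?_, ?_⟩
  · rw [add_assoc]; exact hN ha hw
  · rw [map_smul, ← smul_sub, add_assoc]
    exact Stable.polyLT h𝒜 n ha hwc

/-- The ascending chain of the modules of leading coefficients is stationary, because its union
has a finite resolution and so is finitely generated. -/
theorem IsOreStep.exists_leadFamily_le [Fintype ι] (h : IsOreStep 𝒜 y g) (hs : SyzygyProp 𝒜)
    (hN : Stable (lext 𝒜 y g) N) :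
    ∃ n₀, ∀ n j, leadFamily 𝒜 y g b N n j ≤ leadFamily 𝒜 y g b N n₀ j := by
  classical
  have hmono := h.leadFamily_mono (b := b) hN
  have hst := Stable.leadFamily (y := y) (g := g) (b := b) h.isMul (IsOreStep.stable_of_lext hN)
  have hmem : ∀ {j c}, c ∈ ⨆ n, leadFamily 𝒜 y g b N n j ↔ ∃ n, c ∈ leadFamily 𝒜 y g b N n j :=
    fun {j c} => AddSubgroup.mem_iSup_of_directed (hmono j).directed_le
  obtain ⟨m, hm⟩ := hs ι b (fun j => ⨆ n, leadFamily 𝒜 y g b N n j)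
    (fun j => iSup_le fun n => inf_le_left)
    (by
      intro i j a c ha hc
      obtain ⟨n, hn⟩ := hmem.mp hc
      exact hmem.mpr ⟨n, hst n ha hn⟩)
  obtain ⟨κ, _, d, φ, h1, -⟩ := hm.succ
  beta_reduce at h1
  have hgen : ∀ t : κ, ∃ n, φ (Pi.single t 1) ∈ leadFamily 𝒜 y g b N n (d t) := by
    intro t
    rw [← hmem]
    rw [← h1]
    exact ⟨_, single_mem_gshift h.isMul d t, rfl⟩
  choose n hn using hgen
  refine ⟨Finset.univ.sup n, fun m j => ?_⟩
  refine (le_iSup (fun n => leadFamily 𝒜 y g b N n j) m).trans ?_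
  rw [← h1 j]
  rintro _ ⟨v, hv, rfl⟩
  have := (hst (Finset.univ.sup n)).sum_smul_mem (w := fun t => φ (Pi.single t 1)) (b := d)
    (fun t => hmono (d t) (Finset.le_sup (Finset.mem_univ t)) (hn t)) hv
  rwa [← map_eq_linearCombination] at this

/-- The map `θ(a)_i = a_i y - a_{i-1}` on the coefficients of polynomials: it describes the
relations between the generators `y^i` of the Ore extension as a left module. -/
def polyRel (y : R) : (ℕ → ι → R) →ₗ[R] (ℕ → ι → R) where
  toFun a i := rmul y (a i) - i.casesOn 0 a
  map_add' a a' := by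
    ext (_ | i) : 1
    · simp
    · simp; abel
  map_smul' c a := by
    ext (_ | i) : 1
    · simp
    · simp [smul_sub]

theorem polyRel_zero (a : ℕ → ι → R) : polyRel y a 0 = rmul y (a 0) := sub_zero _

theorem polyRel_succ (a : ℕ → ι → R) (i : ℕ) :
    polyRel y a (i + 1) = rmul y (a (i + 1)) - a i := rfl

theorem polyEval_polyRel (n : ℕ) (a : ℕ → ι → R) :
    polyEval y (n + 1) (polyRel y a) = rmul (y ^ (n + 1)) (a n) := by
  induction n with
  | zero => simp [polyEval_succ, polyEval_apply, polyRel_zero, rmul_one]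
  | succ n ih =>
    rw [polyEval_succ, ih, polyRel_succ, map_sub, rmul_rmul, ← pow_succ', add_sub_cancel]

theorem eq_zero_of_polyRel_eq_zero {n : ℕ} {a : ℕ → ι → R} (ha : ∀ i, n ≤ i → a i = 0)
    (h0 : polyRel y a = 0) : a = 0 := by
  induction n with
  | zero => exact funext fun i => ha i i.zero_le
  | succ n ih =>
    refine ih fun i hi => ?_
    rcases hi.eq_or_lt with rfl | hi
    · have := congrFun h0 (n + 1)
      rw [polyRel_succ, ha (n + 1) le_rfl, map_zero, zero_sub] at this
      exact neg_eq_zero.mp this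
    · exact ha i hi

/-- `θ(a) = y a - c` with `c` in the family of coefficients of elements of `N`. -/
theorem IsOreStep.smul_sub_polyRel_mem (h : IsOreStep 𝒜 y g) (hN : Stable (lext 𝒜 y g) N)
    {n : ℕ} {j : ℤ × ℤ} {a : ℕ → ι → R} (ha : a ∈ liftFamily 𝒜 y g b N n j) :
    y • a - polyRel y a ∈ liftFamily 𝒜 y g b N (n + 1) (j + g) := by
  rw [mem_liftFamily] at ha ⊢
  obtain ⟨ha1, ha2, ha3⟩ := ha
  have e0 : ∀ i, y • a i - rmul y (a i) ∈ gshift 𝒜 b (j + g - i • g) := by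
    intro i
    rw [show j + g - i • g = j - i • g + g by abel]
    exact h.comm_mem_gshift (ha1 i)
  refine ⟨fun i => ?_, fun i hi => ?_, ?_⟩
  · cases i with
    | zero =>
      rw [Pi.sub_apply, polyRel_zero]
      exact e0 0
    | succ i =>
      rw [Pi.sub_apply, polyRel_succ, Pi.smul_apply, ← sub_add]
      refine add_mem (e0 (i + 1)) ?_
      rw [show j + g - (i + 1) • g = j - i • g by rw [succ_nsmul]; abel]
      exact ha1 i
  · obtain ⟨i, rfl⟩ : ∃ k, i = k + 1 := ⟨i - 1, by omega⟩
    rw [Pi.sub_apply, polyRel_succ, Pi.smul_apply, ha2 (i + 1) (by omega), ha2 i (by omega)]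
    simp
  · rw [map_sub, polyEval_polyRel, ha2 n le_rfl, map_zero, sub_zero, map_smul,
      polyEval_of_le y n.le_succ ha2, add_comm j]
    exact hN h.mem_lext_self ha3

theorem IsOreStep.polyRel_mem_rext (h : IsOreStep 𝒜 y g) (hN : Stable (lext 𝒜 y g) N)
    {n : ℕ} {j : ℤ × ℤ} {a : ℕ → ι → R} (ha : a ∈ rext (liftFamily 𝒜 y g b N n) y g (j - g)) :
    polyRel y a ∈ rext (liftFamily 𝒜 y g b N (n + 1)) y g j := by
  obtain ⟨K, v, hv, rfl⟩ := mem_rext.mp ha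
  rw [map_sum]
  refine sum_mem fun k _ => ?_
  have e : polyRel y (y ^ k • v k) = y ^ (k + 1) • v k - y ^ k • (y • v k - polyRel y (v k)) := by
    rw [map_smul, smul_sub, smul_smul, ← pow_succ, sub_sub_cancel]
  rw [e]
  refine sub_mem (pow_smul_mem_rext ?_) (pow_smul_mem_rext ?_)
  · rw [show j - (k + 1) • g = j - g - k • g by rw [succ_nsmul]; abel]
    exact liftFamily_mono n.le_succ _ (hv k)
  · have := h.smul_sub_polyRel_mem hN (hv k)
    rwa [show j - g - k • g + g = j - k • g by abel] at this

/-- Exactness of `0 → B ⊗ N_{<n} → B ⊗ N_{<n+1} → B^ι`, where `B` is the Ore extension. -/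
theorem IsOreStep.exists_polyRel_eq (h : IsOreStep 𝒜 y g) (hN : Stable (lext 𝒜 y g) N)
    {n : ℕ} {j : ℤ × ℤ} {a : ℕ → ι → R}
    (ha : a ∈ rext (liftFamily 𝒜 y g b N (n + 1)) y g j) (h0 : polyEval y (n + 1) a = 0) :
    ∃ a' ∈ rext (liftFamily 𝒜 y g b N n) y g (j - g), polyRel y a' = a := by
  obtain ⟨K, v, hv, rfl⟩ := mem_rext.mp ha
  clear ha
  induction K generalizing v with
  | zero => exact ⟨0, zero_mem _, by simp⟩
  | succ K ih =>
    rcases K with _ | K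
    · have hv0 := mem_liftFamily.mp (hv 0)
      simp only [zero_add, Finset.range_one, Finset.sum_singleton, pow_zero, one_smul] at h0 ⊢
      have : v 0 = 0 := by
        ext i : 1
        by_cases hi : i < n + 1
        · exact h.polyEval_eq_zero hv0.1 h0 i hi
        · exact hv0.2.1 i (by omega)
      exact ⟨0, zero_mem _, by rw [this, map_zero]⟩
    · -- the coefficient of `y^(n+K+1)` in `polyEval` comes only from `v (K + 1)`
      have hlead : ∀ k, y ^ k • polyEval y (n + 1) (v k) - rmul (y ^ (n + k)) (v k n) ∈
          polyLT 𝒜 y g b (n + k) j := by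
        intro k
        have hvk := mem_liftFamily.mp (hv k)
        have := h.pow_smul_sub_mem (hvk.1 n) (sub_top_mem_polyLT hvk.1) k
        rwa [sub_add_cancel] at this
      have hdeg : ∀ k, v k n ∈ gshift 𝒜 b (j - (n + k) • g) := by
        intro k
        have := (mem_liftFamily.mp (hv k)).1 n
        rwa [show j - k • g - n • g = j - (n + k) • g by rw [add_nsmul]; abel] at this
      have hlow : ∀ k < K + 1, y ^ k • polyEval y (n + 1) (v k) ∈
          polyLT 𝒜 y g b (n + (K + 1)) j := by
        intro k hk
        have := add_mem (polyLT_mono (show n + k ≤ n + (K + 1) by omega) j (hlead k))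
          (rmul_pow_mem_polyLT (y := y) (show n + k < n + (K + 1) by omega) (hdeg k))
        rwa [sub_add_cancel] at this
      have htop : v (K + 1) n = 0 := by
        refine h.eq_zero_of_rmul_mem (hdeg (K + 1)) ?_
        rw [map_sum, Finset.sum_range_succ] at h0
        simp only [map_smul] at h0
        have h2 := neg_mem (add_mem (hlead (K + 1))
          (sum_mem (t := Finset.range (K + 1)) fun k hk => hlow k (Finset.mem_range.mp hk)))
        rw [eq_neg_of_add_eq_zero_right h0] at h2
        simpa using h2
      have hv' : v (K + 1) ∈ liftFamily 𝒜 y g b N n (j - (K + 1) • g) := by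
        have hvk := mem_liftFamily.mp (hv (K + 1))
        have h2 : ∀ i, n ≤ i → v (K + 1) i = 0 := by
          intro i hi
          rcases hi.eq_or_lt with rfl | hi
          · exact htop
          · exact hvk.2.1 i hi
        refine mem_liftFamily.mpr ⟨hvk.1, h2, ?_⟩
        rw [← polyEval_of_le y n.le_succ h2]
        exact hvk.2.2
      set c := y • v (K + 1) - polyRel y (v (K + 1)) with hc
      have hcm : c ∈ liftFamily 𝒜 y g b N (n + 1) (j - K • g) := by
        have := h.smul_sub_polyRel_mem hN hv'
        rwa [show j - (K + 1) • g + g = j - K • g by rw [succ_nsmul]; abel] at this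
      -- subtract `θ(y^K v_{K+1})` to lower the length of the sum
      have e : ∑ k ∈ Finset.range (K + 1 + 1), y ^ k • v k =
          ∑ k ∈ Finset.range (K + 1), y ^ k • (if k = K then v k + c else v k) +
            polyRel y (y ^ K • v (K + 1)) := by
        rw [Finset.sum_range_succ, Finset.sum_range_succ, Finset.sum_range_succ, if_pos rfl,
          map_smul]
        have e1 : ∑ k ∈ Finset.range K, y ^ k • (if k = K then v k + c else v k) =
            ∑ k ∈ Finset.range K, y ^ k • v k :=
          Finset.sum_congr rfl fun k hk => by rw [if_neg (Finset.mem_range.mp hk).ne]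
        rw [e1, hc, pow_succ, mul_smul, smul_add, smul_sub]
        abel
      have hrel : polyEval y (n + 1) (polyRel y (y ^ K • v (K + 1))) = 0 := by
        rw [polyEval_polyRel, Pi.smul_apply, htop, smul_zero, map_zero]
      obtain ⟨a', ha', e'⟩ := ih (fun k => if k = K then v k + c else v k) (fun k => by
          by_cases hk : k = K
          · subst hk; simpa using add_mem (hv k) hcm
          · simpa [hk] using hv k)
        (by rw [e, map_add, hrel, add_zero] at h0; exact h0)
      refine ⟨a' + y ^ K • v (K + 1), add_mem ha' (pow_smul_mem_rext ?_), ?_⟩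
      · rwa [show j - g - K • g = j - (K + 1) • g by rw [succ_nsmul]; abel]
      · rw [map_add, e', e]

theorem IsOreStep.polyEval_mem (h : IsOreStep 𝒜 y g) (hN : Stable (lext 𝒜 y g) N)
    {n : ℕ} {j : ℤ × ℤ} {a : ℕ → ι → R} (ha : a ∈ rext (liftFamily 𝒜 y g b N n) y g j) :
    polyEval y n a ∈ N j := by
  obtain ⟨K, v, hv, rfl⟩ := mem_rext.mp ha
  rw [map_sum]
  refine sum_mem fun k _ => ?_
  rw [map_smul]
  have hy : y ^ k ∈ lext 𝒜 y g (k • g) := by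
    simpa using mul_pow_mem_lext (y := y) (g := g) (k := k) (j := k • g) (a := 1) (𝒜 := 𝒜)
      (by simpa using h.isMul.one_mem)
  have := hN hy (mem_liftFamily.mp (hv k)).2.2
  rwa [add_sub_cancel] at this

/-- `N` is generated by its elements of degree at most `n₀` in `y` as soon as the leading
coefficients are stationary from `n₀` on. -/
theorem IsOreStep.exists_polyEval_eq [Fintype ι] (h : IsOreStep 𝒜 y g)
    (hNb : ∀ j, N j ≤ gshift (lext 𝒜 y g) b j) (hN : Stable (lext 𝒜 y g) N) {n₀ : ℕ}
    (hn₀ : ∀ n j, leadFamily 𝒜 y g b N n j ≤ leadFamily 𝒜 y g b N n₀ j) {j : ℤ × ℤ}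
    {w : ι → R} (hw : w ∈ N j) :
    ∃ a ∈ rext (liftFamily 𝒜 y g b N (n₀ + 1)) y g j, polyEval y (n₀ + 1) a = w := by
  obtain ⟨m, hm⟩ := exists_mem_polyLT (hNb j hw)
  induction m generalizing w with
  | zero =>
    obtain ⟨a, -, rfl⟩ := mem_polyLT.mp hm
    exact ⟨0, zero_mem _, by simp [polyEval_apply]⟩
  | succ m ih =>
    by_cases hmn : m + 1 ≤ n₀ + 1
    · obtain ⟨a, ha, ha0, rfl⟩ := exists_coeff (polyLT_mono hmn _ hm)
      exact ⟨a, mem_rext_of_mem (mem_liftFamily.mpr ⟨ha, ha0, hw⟩), rfl⟩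
    · obtain ⟨a, ha, -, rfl⟩ := exists_coeff hm
      have hlead : a m ∈ leadFamily 𝒜 y g b N m (j - m • g) :=
        mem_leadFamily.mpr ⟨ha m, _, by rwa [sub_add_cancel], by
          rw [sub_add_cancel]; exact sub_top_mem_polyLT ha⟩
      obtain ⟨hc, w', hw', hw'c⟩ := mem_leadFamily.mp (hn₀ _ _ hlead)
      -- `y^(m - n₀) w'` has the same leading term as the given element
      obtain ⟨k, rfl⟩ : ∃ k, m = n₀ + k := ⟨m - n₀, by omega⟩
      have hlow := h.pow_smul_sub_mem (by rwa [add_sub_cancel_right]) hw'c k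
      have ej : j - (n₀ + k) • g + n₀ • g + k • g = j := by rw [add_nsmul]; abel
      have ej' : j - (n₀ + k) • g + n₀ • g = j - k • g := by rw [add_nsmul]; abel
      rw [ej] at hlow
      rw [ej'] at hw' hw'c
      have hw'lt : w' ∈ polyLT 𝒜 y g b (n₀ + 1) (j - k • g) := by
        have := add_mem (polyLT_mono n₀.le_succ _ hw'c)
          (rmul_pow_mem_polyLT (y := y) n₀.lt_succ_self (j := j - k • g) (by
            rw [show j - k • g - n₀ • g = j - (n₀ + k) • g by rw [add_nsmul]; abel]
            exact hc))
        rwa [sub_add_cancel] at this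
      obtain ⟨a', ha', ha'0, rfl⟩ := exists_coeff hw'lt
      have hmem : y ^ k • a' ∈ rext (liftFamily 𝒜 y g b N (n₀ + 1)) y g j :=
        pow_smul_mem_rext (mem_liftFamily.mpr ⟨ha', ha'0, hw'⟩)
      have hN' := h.polyEval_mem hN hmem
      have hlt := sub_mem (sub_top_mem_polyLT (y := y) (n := n₀ + k) ha) hlow
      rw [sub_sub_sub_cancel_right, ← map_smul] at hlt
      obtain ⟨a'', ha'', e⟩ := ih (sub_mem hw hN') hlt
      exact ⟨a'' + y ^ k • a', add_mem ha'' hmem, by rw [map_add, e, sub_add_cancel]⟩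

theorem IsOreStep.rDirect_liftFamily (h : IsOreStep 𝒜 y g) (n : ℕ) :
    RDirect y g (liftFamily 𝒜 y g b N n) := by
  intro j K v hv h0 k hk
  ext i : 1
  refine h.rDirect_gshift b (j := j - i • g) (K := K) (v := fun k => v k i) (fun k => ?_) ?_ k hk
  · have := (mem_liftFamily.mp (hv k)).1 i
    rwa [sub_right_comm] at this
  · have := congrFun h0 i
    rwa [Finset.sum_apply] at this

/-- The syzygy theorem passes to Ore extensions. -/
theorem SyzygyProp.lext (h : IsOreStep 𝒜 y g) (hs : SyzygyProp 𝒜) : SyzygyProp (lext 𝒜 y g) := by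
  intro ι _ b N hNb hN
  have hN' := IsOreStep.stable_of_lext hN
  obtain ⟨n₀, hn₀⟩ := h.exists_leadFamily_le (b := b) hs hN
  obtain ⟨m₁, h1⟩ := hs.liftFamily (y := y) (g := g) (b := b) h.isMul hN' n₀
  obtain ⟨m₂, h2⟩ := hs.liftFamily (y := y) (g := g) (b := b) h.isMul hN' (n₀ + 1)
  have h1 := ((h1.rext h (h.rDirect_liftFamily n₀)).shift g).mono (le_max_left m₁ m₂)
  have h2 := (h2.rext h (h.rDirect_liftFamily (n₀ + 1))).mono (le_max_right m₁ m₂)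
  refine ⟨max m₁ m₂ + 1, (HasRes.cone h.isMulFamily_lext (polyEval y (n₀ + 1))
    ((h1.map (polyRel y) ?_).congr fun j => ?_) h2).congr fun j => ?_⟩
  · intro j a ha h0
    obtain ⟨K, v, hv, rfl⟩ := mem_rext.mp ha
    refine eq_zero_of_polyRel_eq_zero (n := n₀) (fun i hi => ?_) h0
    rw [Finset.sum_apply]
    refine Finset.sum_eq_zero fun k _ => ?_
    rw [Pi.smul_apply, (mem_liftFamily.mp (hv k)).2.1 i hi, smul_zero]
  · ext a
    constructor
    · rintro ⟨a', ha', rfl⟩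
      refine ⟨h.polyRel_mem_rext hN ha', ?_⟩
      change polyEval y (n₀ + 1) (polyRel y a') = 0
      obtain ⟨K, v, hv, rfl⟩ := mem_rext.mp ha'
      rw [polyEval_polyRel, Finset.sum_apply, Finset.sum_eq_zero, map_zero]
      intro k _
      rw [Pi.smul_apply, (mem_liftFamily.mp (hv k)).2.1 n₀ le_rfl, smul_zero]
    · rintro ⟨ha, h0⟩
      exact h.exists_polyRel_eq hN ha h0
  · ext w
    constructor
    · rintro ⟨a, ha, rfl⟩
      exact h.polyEval_mem hN ha
    · intro hw
      exact h.exists_polyEval_eq hNb hN hn₀ hw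

end OreSyzygy

/-! ### The syzygy theorem over `ℂ`, and the basis of the Weyl algebra -/

section Base

variable {R : Type} [Ring R] [Algebra ℂ R]

/-- The field `ℂ`, placed in degree `0`, as a family of subgroups of a `ℂ`-algebra. -/
def scalarFamily (R : Type) [Ring R] [Algebra ℂ R] (j : ℤ × ℤ) : AddSubgroup R :=
  ⨆ _ : j = 0, (algebraMap ℂ R).range.toAddSubgroup

theorem mem_scalarFamily {j : ℤ × ℤ} {r : R} :
    r ∈ scalarFamily R j ↔ ∃ c : ℂ, algebraMap ℂ R c = r ∧ (j ≠ 0 → c = 0) := by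
  unfold scalarFamily
  by_cases hj : j = 0
  · subst hj
    simp
  · simp only [hj, iSup_false, AddSubgroup.mem_bot, ne_eq, not_false_eq_true, forall_const]
    constructor
    · rintro rfl
      exact ⟨0, by simp, rfl⟩
    · rintro ⟨c, rfl, rfl⟩
      simp

theorem isMulFamily_scalarFamily : IsMulFamily (scalarFamily R) where
  one_mem := mem_scalarFamily.mpr ⟨1, by simp, by simp⟩
  mul_mem := by
    intro i j a b ha hb
    obtain ⟨c, rfl, hc⟩ := mem_scalarFamily.mp ha
    obtain ⟨d, rfl, hd⟩ := mem_scalarFamily.mp hb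
    refine mem_scalarFamily.mpr ⟨c * d, by simp, fun h => ?_⟩
    by_cases hi : i = 0
    · rw [hd (by rintro rfl; exact h (by simp [hi])), mul_zero]
    · rw [hc hi, zero_mul]

/-- Graded vector spaces of finite dimension are graded free modules. -/
theorem syzygyProp_scalarFamily [Nontrivial R] : SyzygyProp (scalarFamily R) := by
  classical
  intro ι _ b 𝒦 h𝒦b h𝒦
  let m : (ι → ℂ) →ₗ[ℂ] (ι → R) := LinearMap.pi fun l => (Algebra.linearMap ℂ R) ∘ₗ LinearMap.proj l
  have hm : ∀ z l, m z l = algebraMap ℂ R (z l) := fun z l => rfl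
  have hminj : ∀ z, m z = 0 → z = 0 := by
    intro z hz
    ext l
    have := congrFun hz l
    rw [hm, Pi.zero_apply] at this
    exact (map_eq_zero_iff _ (algebraMap ℂ R).injective).mp this
  have hsm : ∀ (c : ℂ) (v : ι → R), c • v = algebraMap ℂ R c • v := fun c v => by
    ext l; simp [Algebra.smul_def]
  -- the pieces of `𝒦` as subspaces of `ℂ^ι`
  let V : ℤ × ℤ → Submodule ℂ (ι → ℂ) := fun j =>
    { carrier := {z | m z ∈ 𝒦 j}
      add_mem' := fun {z z'} h h' => by
        change m (z + z') ∈ 𝒦 j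
        rw [map_add]; exact add_mem h h'
      zero_mem' := by
        change m 0 ∈ 𝒦 j
        rw [map_zero]; exact zero_mem _
      smul_mem' := fun c z h => by
        change m (c • z) ∈ 𝒦 j
        rw [map_smul, hsm]
        have := h𝒦 (i := 0) (mem_scalarFamily.mpr ⟨c, rfl, by simp⟩) h
        rwa [zero_add] at this }
  let κ := Σ j : (Finset.univ.image b : Finset (ℤ × ℤ)), Fin (Module.finrank ℂ (V j))
  let B : ∀ j, Module.Basis (Fin (Module.finrank ℂ (V j))) ℂ (V j) := fun j =>
    Module.finBasis ℂ (V j)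
  let w : κ → ι → R := fun t => m (B t.1 t.2)
  let d : κ → ℤ × ℤ := fun t => t.1
  have hw : ∀ t, w t ∈ 𝒦 (d t) := fun t => (B t.1 t.2).2
  have hzero : ∀ j, j ∉ Finset.univ.image b → ∀ x ∈ 𝒦 j, x = 0 := by
    intro j hj x hx
    ext l
    obtain ⟨c, hc, hc0⟩ := mem_scalarFamily.mp (mem_gshift.mp (h𝒦b j hx) l)
    rw [← hc, hc0, map_zero, Pi.zero_apply]
    intro h
    exact hj (Finset.mem_image.mpr ⟨l, Finset.mem_univ _, (sub_eq_zero.mp h).symm⟩)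
  refine ⟨1, κ, inferInstance, d, Fintype.linearCombination R w, fun j => le_antisymm ?_ ?_, ?_⟩
  · rintro _ ⟨v, hv, rfl⟩
    exact h𝒦.sum_smul_mem hw hv
  · intro x hx
    by_cases hj : j ∈ Finset.univ.image b
    · obtain ⟨z, rfl⟩ : ∃ z, m z = x := by
        choose c hc _ using fun l => mem_scalarFamily.mp (mem_gshift.mp (h𝒦b j hx) l)
        exact ⟨c, funext hc⟩
      have hz : z = ∑ s, (B j).repr ⟨z, hx⟩ s • (B j s : ι → ℂ) := by
        have := congrArg (V j).subtype ((B j).sum_repr ⟨z, hx⟩)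
        rw [map_sum] at this
        exact this.symm
      rw [hz, map_sum]
      refine sum_mem fun s _ => ?_
      refine ⟨Pi.single ⟨⟨j, hj⟩, s⟩ (algebraMap ℂ R ((B j).repr ⟨z, hx⟩ s)),
        mem_gshift.mpr fun t => ?_, ?_⟩
      · by_cases ht : t = ⟨⟨j, hj⟩, s⟩
        · subst ht
          simp only [Pi.single_eq_same]
          exact mem_scalarFamily.mpr ⟨_, rfl, fun h => (h (sub_self j)).elim⟩
        · simp [ht, zero_mem]
      · change Fintype.linearCombination R w _ = _
        rw [Fintype.linearCombination_apply_single, map_smul, hsm]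
    · rw [hzero j hj x hx]; exact zero_mem _
  · intro j
    rw [eq_bot_iff]
    rintro v ⟨hv, hv0⟩
    replace hv := mem_gshift.mp hv
    replace hv0 : Fintype.linearCombination R w v = 0 := hv0
    choose c hc hc0 using fun t => mem_scalarFamily.mp (hv t)
    rw [AddSubgroup.mem_bot]
    ext ⟨⟨j', hj'⟩, s⟩
    by_cases h : j' = j
    · subst h
      have hsum : m (∑ s, c ⟨⟨j', hj'⟩, s⟩ • (B j' s : ι → ℂ)) = 0 := by
        rw [← hv0, Fintype.linearCombination_apply, Fintype.sum_sigma,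
          Finset.sum_eq_single (⟨j', hj'⟩ : (Finset.univ.image b : Finset (ℤ × ℤ)))]
        · rw [map_sum]
          refine Finset.sum_congr rfl fun s _ => ?_
          rw [map_smul, hsm, hc]
        · intro j'' _ hne
          refine Finset.sum_eq_zero fun s _ => ?_
          rw [← hc, hc0, map_zero, zero_smul]
          intro h
          exact hne (Subtype.ext (sub_eq_zero.mp h).symm)
        · simp
      have hli := (B j').linearIndependent.map' (V j').subtype (Submodule.ker_subtype _)
      have := Fintype.linearIndependent_iff.mp hli (fun s => c ⟨⟨j', hj'⟩, s⟩) (hminj _ hsum) s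
      rw [← hc, this, map_zero, Pi.zero_apply]
    · rw [← hc, hc0, map_zero, Pi.zero_apply]
      intro h'
      exact h (sub_eq_zero.mp h').symm

end Base

section PBW

variable {σ : Type} [Fintype σ]

namespace Weyl

/-- The normally ordered monomial `x^α ∂^β` with exponent `γ = (α, β)`. -/
noncomputable def mon (γ : (σ → ℕ) × (σ → ℕ)) : Weyl σ := xPow γ.1 * delPow γ.2

theorem exponent_induction [DecidableEq σ] {P : (σ → ℕ) → Prop} (h0 : P 0)
    (hs : ∀ β i, P β → P (β + Pi.single i 1)) (β : σ → ℕ) : P β := by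
  induction h : ∑ i, β i generalizing β with
  | zero =>
    rw [Finset.sum_eq_zero_iff] at h
    rwa [show β = 0 from funext fun i => h i (Finset.mem_univ i)]
  | succ n ih =>
    obtain ⟨i, -, hi⟩ : ∃ i ∈ Finset.univ, β i ≠ 0 := by
      by_contra! hc
      rw [Finset.sum_eq_zero hc] at h
      omega
    have e : β = (β - Pi.single i 1) + Pi.single i 1 := by
      ext j
      by_cases hj : j = i
      · subst hj; simp; omega
      · simp [hj]
    rw [e]
    refine hs _ _ (ih _ ?_)
    rw [e] at h
    simpa [Finset.sum_add_distrib] using h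

theorem delPow_monomial (β : σ → ℕ) (m : σ →₀ ℕ) :
    toEnd σ (delPow β) (MvPolynomial.monomial m 1) =
      MvPolynomial.monomial (m - Finsupp.equivFunOnFinite.symm β)
        (∏ i, ((m i).descFactorial (β i) : ℂ)) := by
  classical
  induction β using exponent_induction with
  | h0 =>
    rw [delPow_zero, map_one]
    have e : Finsupp.equivFunOnFinite.symm (0 : σ → ℕ) = 0 := by ext; simp
    simp [e]
  | hs β i ih =>
    rw [← del_mul_delPow, map_mul, Module.End.mul_apply, ih, del_apply, MvPolynomial.pderiv_monomial]
    congr 1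
    · congr 1
      ext j
      by_cases hj : j = i
      · subst hj; simp [Nat.sub_sub]
      · simp [hj]
    · rw [← Finset.mul_prod_erase _ _ (Finset.mem_univ i),
        ← Finset.mul_prod_erase _ _ (Finset.mem_univ i)]
      have : ∏ j ∈ Finset.univ.erase i, ((m j).descFactorial ((β + Pi.single i 1 : σ → ℕ) j) : ℂ) =
          ∏ j ∈ Finset.univ.erase i, ((m j).descFactorial (β j) : ℂ) :=
        Finset.prod_congr rfl fun j hj => by simp [Finset.ne_of_mem_erase hj]
      rw [this]
      simp only [Pi.add_apply, Pi.single_eq_same, Nat.descFactorial_succ, Finsupp.coe_tsub,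
        Pi.sub_apply, Finsupp.equivFunOnFinite_symm_apply_apply]
      push_cast
      ring

theorem linearIndependent_mon : LinearIndependent ℂ (mon : (σ → ℕ) × (σ → ℕ) → Weyl σ) := by
  classical
  rw [linearIndependent_iff]
  intro c hc
  by_contra hne
  obtain ⟨γ₀, hγ₀, hmin⟩ := Finset.exists_min_image c.support (fun γ => ∑ i, γ.2 i)
    (Finsupp.support_nonempty_iff.mpr hne)
  -- apply the operator to the monomial `x^β₀`, where `∂^β₀` has minimal order
  have h1 := congrArg (fun P => (toEnd σ P (MvPolynomial.monomial
    (Finsupp.equivFunOnFinite.symm γ₀.2) 1)).coeff (Finsupp.equivFunOnFinite.symm γ₀.1)) hc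
  simp only [Finsupp.linearCombination_apply, Finsupp.sum, map_sum, map_smul, map_zero,
    LinearMap.sum_apply, LinearMap.smul_apply, LinearMap.zero_apply, MvPolynomial.coeff_sum,
    MvPolynomial.coeff_smul, MvPolynomial.coeff_zero] at h1
  rw [Finset.sum_eq_single_of_mem γ₀ hγ₀] at h1
  · rw [mon, map_mul, Module.End.mul_apply, delPow_monomial, xPow_apply,
      MvPolynomial.monomial_mul, MvPolynomial.coeff_monomial, if_pos (by simp)] at h1
    rw [one_mul, smul_eq_mul, mul_eq_zero, Finset.prod_eq_zero_iff] at h1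
    rcases h1 with h1 | ⟨i, -, h1⟩
    · exact (Finsupp.mem_support_iff.mp hγ₀) h1
    · rw [Nat.cast_eq_zero, Nat.descFactorial_eq_zero_iff_lt] at h1
      simp at h1
  · intro γ hγ hne
    rw [mon, map_mul, Module.End.mul_apply, delPow_monomial, xPow_apply,
      MvPolynomial.monomial_mul, MvPolynomial.coeff_monomial]
    split_ifs with h
    · have h2 : γ.2 ≠ γ₀.2 := by
        intro h2
        apply hne
        refine Prod.ext ?_ h2
        rw [h2, tsub_self, add_zero] at h
        exact Finsupp.equivFunOnFinite.symm.injective h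
      obtain ⟨i, hi⟩ : ∃ i, γ₀.2 i < γ.2 i := by
        by_contra! hle
        have hlt : ∑ i, γ.2 i < ∑ i, γ₀.2 i := by
          refine Finset.sum_lt_sum (fun i _ => hle i) ?_
          by_contra! hge
          exact h2 (funext fun i => le_antisymm (hle i) (hge i (Finset.mem_univ i)))
        exact absurd (hmin γ hγ) (not_le.mpr hlt)
      have : (∏ i, ((Finsupp.equivFunOnFinite.symm γ₀.2 i).descFactorial (γ.2 i) : ℂ)) = 0 :=
        Finset.prod_eq_zero (Finset.mem_univ i) (by
          rw [Nat.cast_eq_zero, Nat.descFactorial_eq_zero_iff_lt]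
          simpa using hi)
      rw [this, mul_zero, smul_zero]
    · rw [smul_zero]

theorem xPow_single [DecidableEq σ] (i : σ) : xPow (Pi.single i 1) = x i := by
  have := x_mul_xPow i (0 : σ → ℕ)
  rwa [xPow_zero, mul_one, zero_add, eq_comm] at this

theorem delPow_single [DecidableEq σ] (i : σ) : delPow (Pi.single i 1) = del i := by
  have := del_mul_delPow i (0 : σ → ℕ)
  rwa [delPow_zero, mul_one, zero_add, eq_comm] at this

theorem span_mon : Submodule.span ℂ (Set.range (mon : (σ → ℕ) × (σ → ℕ) → Weyl σ)) = ⊤ := by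
  classical
  have e : Submodule.span ℂ (Set.range (mon : (σ → ℕ) × (σ → ℕ) → Weyl σ)) = ordFil 0 0 0 := by
    unfold ordFil
    congr 1
    ext P
    simp [weight, mon, eq_comm]
  rw [e, eq_top_iff]
  let T : Subalgebra ℂ (Weyl σ) :=
    { carrier := {P | P ∈ ordFil (σ := σ) 0 0 0}
      mul_mem' := fun {P Q} (hP : P ∈ ordFil 0 0 0) (hQ : Q ∈ ordFil 0 0 0) => by
        have := mul_mem_ordFil (σ := σ) 0 0 (by simp) hP hQ
        rwa [add_zero] at this
      add_mem' := fun {P Q} hP hQ => Submodule.add_mem (ordFil 0 0 0) hP hQ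
      algebraMap_mem' := fun c => by
        rw [Algebra.algebraMap_eq_smul_one]
        exact Submodule.smul_mem _ c (one_mem_ordFil (σ := σ) 0 0) }
  have hT : weylSubalgebra σ ≤ T.map (toEnd σ) := by
    refine Algebra.adjoin_le ?_
    rintro _ (⟨i, rfl⟩ | ⟨i, rfl⟩)
    · refine ⟨x i, ?_, rfl⟩
      change x i ∈ ordFil 0 0 0
      rw [← e]
      exact Submodule.subset_span ⟨(Pi.single i 1, 0), by
        rw [mon, delPow_zero, mul_one, xPow_single]⟩
    · refine ⟨del i, ?_, rfl⟩
      change del i ∈ ordFil 0 0 0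
      rw [← e]
      exact Submodule.subset_span ⟨(0, Pi.single i 1), by
        rw [mon, xPow_zero, one_mul, delPow_single]⟩
  intro P _
  obtain ⟨P', hP', h⟩ := hT (Subtype.property (p := fun f => f ∈ weylSubalgebra σ) P)
  rwa [← toEnd_injective σ h]

/-- The Poincaré–Birkhoff–Witt basis of the Weyl algebra. -/
noncomputable def basis (σ : Type) [Fintype σ] :
    Module.Basis ((σ → ℕ) × (σ → ℕ)) ℂ (Weyl σ) :=
  Module.Basis.mk linearIndependent_mon span_mon.ge

theorem basis_apply (γ : (σ → ℕ) × (σ → ℕ)) : basis σ γ = mon γ := by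
  simp [basis]

theorem mem_ordFil {u v : σ → ℤ} {d : ℤ} {P : Weyl σ} :
    P ∈ ordFil u v d ↔ ∀ γ, (basis σ).repr P γ ≠ 0 → weight u v γ.1 γ.2 ≤ d := by
  have e : ordFil u v d = Submodule.span ℂ (basis σ '' {γ | weight u v γ.1 γ.2 ≤ d}) := by
    unfold ordFil
    congr 1
    ext P
    simp [basis_apply, mon, eq_comm]
  rw [e, Module.Basis.mem_span_image]
  simp [Set.subset_def]

/-- The operators all of whose monomials have an exponent satisfying `Q · j`. -/
noncomputable def monFamily (Q : (σ → ℕ) × (σ → ℕ) → ℤ × ℤ → Prop) (j : ℤ × ℤ) :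
    AddSubgroup (Weyl σ) :=
  (Submodule.span ℂ (basis σ '' {γ | Q γ j})).toAddSubgroup

variable {Q Q' : (σ → ℕ) × (σ → ℕ) → ℤ × ℤ → Prop}

theorem mem_monFamily {j : ℤ × ℤ} {P : Weyl σ} :
    P ∈ monFamily Q j ↔ ∀ γ, (basis σ).repr P γ ≠ 0 → Q γ j := by
  rw [monFamily, Submodule.mem_toAddSubgroup, Module.Basis.mem_span_image]
  simp [Set.subset_def]

theorem mon_mem_monFamily {j : ℤ × ℤ} {γ : (σ → ℕ) × (σ → ℕ)} (h : Q γ j) :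
    mon γ ∈ monFamily Q j :=
  Submodule.subset_span ⟨γ, h, basis_apply γ⟩

theorem monFamily_le {j : ℤ × ℤ} {S : Submodule ℂ (Weyl σ)} (h : ∀ γ, Q γ j → mon γ ∈ S) :
    monFamily Q j ≤ S.toAddSubgroup := by
  refine Submodule.toAddSubgroup_mono (Submodule.span_le.mpr ?_)
  rintro _ ⟨γ, hγ, rfl⟩
  rw [basis_apply]
  exact h γ hγ

theorem smul_mem_monFamily {j : ℤ × ℤ} (c : ℂ) {P : Weyl σ} (hP : P ∈ monFamily Q j) :
    c • P ∈ monFamily Q j :=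
  Submodule.smul_mem _ c hP

/-- Adjoining a variable `y` of degree `g` to a ring spanned by monomials. -/
theorem isOreStep_monFamily {y : Weyl σ} {g : ℤ × ℤ} {e : (σ → ℕ) × (σ → ℕ)}
    (hQ : IsMulFamily (monFamily Q))
    (hmul : ∀ γ j, Q γ j → ∀ k : ℕ, mon γ * y ^ k = mon (γ + k • e))
    (hcomm : ∀ γ j, Q γ j → y * mon γ - mon γ * y ∈ monFamily Q (j + g))
    (hinj : ∀ γ γ' j (k k' : ℕ), Q γ (j - k • g) → Q γ' (j - k' • g) →
      γ + k • e = γ' + k' • e → k = k') :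
    IsOreStep (monFamily Q) y g where
  isMul := hQ
  comm_mem := by
    intro j P hP
    let S : Submodule ℂ (Weyl σ) := (Submodule.span ℂ (basis σ '' {γ | Q γ (j + g)})).comap
      (LinearMap.mulLeft ℂ y - LinearMap.mulRight ℂ y)
    exact (monFamily_le (S := S) fun γ hγ => hcomm γ j hγ) hP
  direct := by
    intro j a n ha h0 i hi
    -- multiplication by `y^k` translates the exponents by `k • e`
    have hrepr : ∀ k, (basis σ).repr (a k * y ^ k) =
        ((basis σ).repr (a k)).mapDomain (· + k • e) := by
      intro k
      let S : Submodule ℂ (Weyl σ) := LinearMap.ker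
        ((basis σ).repr.toLinearMap ∘ₗ LinearMap.mulRight ℂ (y ^ k) -
          Finsupp.lmapDomain ℂ ℂ (· + k • e) ∘ₗ (basis σ).repr.toLinearMap)
      have := (monFamily_le (S := S) (j := j - k • g) fun γ hγ => by
        simp only [S, LinearMap.mem_ker, LinearMap.sub_apply, LinearMap.comp_apply,
          LinearMap.mulRight_apply, LinearEquiv.coe_coe, Finsupp.lmapDomain_apply]
        rw [hmul γ _ hγ, ← basis_apply, ← basis_apply, Module.Basis.repr_self,
          Module.Basis.repr_self, Finsupp.mapDomain_single, sub_self]) (ha k)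
      exact sub_eq_zero.mp this
    apply (basis σ).repr.injective
    rw [map_zero]
    ext γ
    by_contra hne
    have hγ := mem_monFamily.mp (ha i) γ hne
    have h1 := congrArg (fun P => (basis σ).repr P (γ + i • e)) h0
    simp only [map_sum, map_zero, Finsupp.coe_finsetSum, Finset.sum_apply, hrepr,
      Finsupp.coe_zero, Pi.zero_apply] at h1
    rw [Finset.sum_eq_single_of_mem i (Finset.mem_range.mpr hi)] at h1
    · rw [Finsupp.mapDomain_apply (add_left_injective _)] at h1
      exact hne h1
    · intro k _ hk
      by_contra hne'
      obtain ⟨γ', hγ', e'⟩ := Finset.mem_image.mp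
        (Finsupp.mapDomain_support (Finsupp.mem_support_iff.mpr hne'))
      exact hk (hinj γ' γ j k i (mem_monFamily.mp (ha k) γ' (Finsupp.mem_support_iff.mp hγ')) hγ e')

theorem lext_monFamily {y : Weyl σ} {g : ℤ × ℤ} {e : (σ → ℕ) × (σ → ℕ)}
    (hmul : ∀ γ j, Q γ j → ∀ k : ℕ, mon γ * y ^ k = mon (γ + k • e))
    (hQ' : ∀ γ' j, Q' γ' j ↔ ∃ (k : ℕ) (γ : _), γ' = γ + k • e ∧ Q γ (j - k • g)) :
    lext (monFamily Q) y g = monFamily Q' := by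
  ext1 j
  apply le_antisymm
  · refine iSup_le fun k => ?_
    rintro _ ⟨P, hP, rfl⟩
    let S : Submodule ℂ (Weyl σ) := (Submodule.span ℂ (basis σ '' {γ | Q' γ j})).comap
      (LinearMap.mulRight ℂ (y ^ k))
    refine (monFamily_le (S := S) fun γ hγ => ?_) hP
    change mon γ * y ^ k ∈ monFamily Q' j
    rw [hmul γ _ hγ]
    exact mon_mem_monFamily ((hQ' _ _).mpr ⟨k, γ, rfl, hγ⟩)
  · intro P hP
    rw [← (basis σ).linearCombination_repr P, Finsupp.linearCombination_apply]
    refine sum_mem fun γ' hγ' => ?_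
    obtain ⟨k, γ, rfl, hγ⟩ := (hQ' _ _).mp (mem_monFamily.mp hP γ' (Finsupp.mem_support_iff.mp hγ'))
    beta_reduce
    rw [basis_apply, ← hmul γ _ hγ, ← smul_mul_assoc]
    exact mul_pow_mem_lext (smul_mem_monFamily _ (mon_mem_monFamily hγ))

end Weyl

end PBW

/-! ### The syzygy theorem for the bifiltered Weyl algebra -/

namespace Weyl

section Chain

variable {σ : Type} [Fintype σ]

instance : Nontrivial (Weyl σ) := (toEnd σ).toRingHom.domain_nontrivial

theorem mon_zero : mon (0 : (σ → ℕ) × (σ → ℕ)) = 1 := by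
  rw [mon, Prod.fst_zero, Prod.snd_zero, xPow_zero, delPow_zero, one_mul]

theorem mon_mul_x [DecidableEq σ] {γ : (σ → ℕ) × (σ → ℕ)} (hγ : γ.2 = 0) (i : σ) :
    mon γ * x i = mon (γ + (Pi.single i 1, 0)) := by
  have hc : Commute (x i) (xPow γ.1) :=
    Finset.noncommProd_commute _ _ _ _ fun j _ => (commute_x i j).pow_right _
  simp only [mon, hγ, Prod.fst_add, Prod.snd_add, add_zero, delPow_zero, mul_one]
  rw [← hc.eq, x_mul_xPow]

theorem mon_mul_del [DecidableEq σ] (γ : (σ → ℕ) × (σ → ℕ)) (i : σ) :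
    mon γ * del i = mon (γ + (0, Pi.single i 1)) := by
  have hc : Commute (del i) (delPow γ.2) :=
    Finset.noncommProd_commute _ _ _ _ fun j _ => (commute_del i j).pow_right _
  simp only [mon, Prod.fst_add, Prod.snd_add, add_zero]
  rw [mul_assoc, ← hc.eq, del_mul_delPow]

theorem mon_mul_pow {C : (σ → ℕ) × (σ → ℕ) → Prop} {y : Weyl σ} {e : (σ → ℕ) × (σ → ℕ)}
    (hC : ∀ γ, C γ → C (γ + e)) (h : ∀ γ, C γ → mon γ * y = mon (γ + e))
    {γ : (σ → ℕ) × (σ → ℕ)} (hγ : C γ) (k : ℕ) : mon γ * y ^ k = mon (γ + k • e) := by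
  induction k generalizing γ with
  | zero => simp
  | succ k ih => rw [pow_succ', ← mul_assoc, h γ hγ, ih (hC γ hγ), succ_nsmul', add_assoc]

/-- The bidegree of a monomial, for bidegrees `u i` of `x_i` and `v i` of `∂_i`. -/
def wt (u v : σ → ℤ × ℤ) : (σ → ℕ) × (σ → ℕ) →+ ℤ × ℤ where
  toFun γ := ∑ i, γ.1 i • u i + ∑ i, γ.2 i • v i
  map_zero' := by simp
  map_add' γ γ' := by
    simp only [Prod.fst_add, Prod.snd_add, Pi.add_apply, add_nsmul, Finset.sum_add_distrib]
    abel

variable {u v : σ → ℤ × ℤ}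

theorem wt_x [DecidableEq σ] (i : σ) : wt u v (Pi.single i 1, 0) = u i := by
  simp [wt, Pi.single_apply]

theorem wt_del [DecidableEq σ] (i : σ) : wt u v (0, Pi.single i 1) = v i := by
  simp [wt, Pi.single_apply]

/-- The exponents in `T` of bidegree at most `j`. -/
def WtLE (u v : σ → ℤ × ℤ) (T : Set ((σ → ℕ) × (σ → ℕ))) (γ : (σ → ℕ) × (σ → ℕ))
    (j : ℤ × ℤ) : Prop := γ ∈ T ∧ wt u v γ ≤ j

theorem monFamily_scalar :
    monFamily (σ := σ) (fun γ j => γ = 0 ∧ j = 0) = scalarFamily (Weyl σ) := by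
  ext1 j
  apply le_antisymm
  · intro P hP
    refine mem_scalarFamily.mpr ⟨(basis σ).repr P 0, ?_, fun hj => ?_⟩
    · conv_rhs => rw [← (basis σ).linearCombination_repr P, Finsupp.linearCombination_apply]
      rw [Finsupp.sum_of_support_subset _ (s := {0}), Finset.sum_singleton, basis_apply, mon_zero,
        Algebra.algebraMap_eq_smul_one]
      · intro γ hγ
        exact Finset.mem_singleton.mpr (mem_monFamily.mp hP γ (Finsupp.mem_support_iff.mp hγ)).1
      · simp
    · by_contra hne
      exact hj (mem_monFamily.mp hP 0 hne).2
  · intro P hP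
    obtain ⟨c, rfl, hc⟩ := mem_scalarFamily.mp hP
    by_cases hj : j = 0
    · rw [Algebra.algebraMap_eq_smul_one, ← mon_zero]
      exact smul_mem_monFamily c (mon_mem_monFamily ⟨rfl, hj⟩)
    · rw [hc hj, map_zero]
      exact zero_mem _

variable {Q Q' : (σ → ℕ) × (σ → ℕ) → ℤ × ℤ → Prop}

theorem syzygyProp_step {y : Weyl σ} {g : ℤ × ℤ} {e : (σ → ℕ) × (σ → ℕ)}
    (hQ : IsMulFamily (monFamily Q) ∧ SyzygyProp (monFamily Q))
    (hmul : ∀ γ j, Q γ j → ∀ k : ℕ, mon γ * y ^ k = mon (γ + k • e))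
    (hcomm : ∀ γ j, Q γ j → y * mon γ - mon γ * y ∈ monFamily Q (j + g))
    (hinj : ∀ γ γ' j (k k' : ℕ), Q γ (j - k • g) → Q γ' (j - k' • g) →
      γ + k • e = γ' + k' • e → k = k')
    (hQ' : ∀ γ' j, Q' γ' j ↔ ∃ (k : ℕ) (γ : _), γ' = γ + k • e ∧ Q γ (j - k • g)) :
    IsMulFamily (monFamily Q') ∧ SyzygyProp (monFamily Q') := by
  have h := isOreStep_monFamily hQ.1 hmul hcomm hinj
  rw [← lext_monFamily hmul hQ']
  exact ⟨h.isMulFamily_lext, hQ.2.lext h⟩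

/-- The syzygy theorem for `ℂ[h₁, h₂]`, where the homogenizing variables `h₁` and `h₂` of degrees
`(1, 0)` and `(0, 1)` act as `1`. -/
theorem syzygyProp_zero (u v : σ → ℤ × ℤ) : IsMulFamily (monFamily (WtLE u v {0})) ∧
    SyzygyProp (monFamily (WtLE u v {0})) := by
  have h0 : IsMulFamily (monFamily (σ := σ) fun γ j => γ = 0 ∧ j = 0) ∧
      SyzygyProp (monFamily (σ := σ) fun γ j => γ = 0 ∧ j = 0) := by
    rw [monFamily_scalar]
    exact ⟨isMulFamily_scalarFamily, syzygyProp_scalarFamily⟩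
  have h1 := syzygyProp_step (Q' := fun γ j => γ = 0 ∧ ∃ k : ℕ, j = k • (1, 0)) (y := 1)
    (g := (1, 0)) (e := 0) h0 (fun γ j _ k => by simp) (fun γ j _ => by simp [zero_mem])
    (fun γ γ' j k k' hk hk' _ => by
      have := hk.2.trans hk'.2.symm
      simpa using congrArg Prod.fst this)
    (fun γ' j => by
      constructor
      · rintro ⟨rfl, k, rfl⟩
        exact ⟨k, 0, by simp, rfl, sub_self _⟩
      · rintro ⟨k, γ, rfl, rfl, h⟩
        exact ⟨by simp, k, sub_eq_zero.mp h⟩)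
  refine syzygyProp_step (y := 1) (g := (0, 1)) (e := 0) h1 (fun γ j _ k => by simp)
    (fun γ j _ => by simp [zero_mem]) (fun γ γ' j k k' hk hk' _ => ?_) fun γ' j => ?_
  · obtain ⟨-, m, hm⟩ := hk
    obtain ⟨-, m', hm'⟩ := hk'
    have h2 := congrArg Prod.snd hm
    have h2' := congrArg Prod.snd hm'
    simp at h2 h2'
    omega
  · constructor
    · rintro ⟨hγ, hj⟩
      rw [Set.mem_singleton_iff] at hγ
      subst hγ
      rw [map_zero] at hj
      refine ⟨j.2.toNat, 0, by simp, rfl, j.1.toNat, ?_⟩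
      have h1 := hj.1
      have h2 := hj.2
      simp at h1 h2
      ext <;> simp [h1, h2]
    · rintro ⟨k, γ, rfl, rfl, m, h⟩
      refine ⟨by simp, ?_⟩
      have h1 := congrArg Prod.fst h
      have h2 := congrArg Prod.snd h
      simp at h1 h2
      constructor <;> simp <;> omega

theorem syzygyProp_wtLE_step {T T' : Set ((σ → ℕ) × (σ → ℕ))} {y : Weyl σ}
    {e : (σ → ℕ) × (σ → ℕ)}
    (hT : IsMulFamily (monFamily (WtLE u v T)) ∧ SyzygyProp (monFamily (WtLE u v T)))
    (hmul : ∀ γ ∈ T, ∀ k : ℕ, mon γ * y ^ k = mon (γ + k • e))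
    (hcomm : ∀ γ ∈ T, y * mon γ - mon γ * y ∈ monFamily (WtLE u v T) (wt u v γ + wt u v e))
    (hinj : ∀ γ ∈ T, ∀ γ' ∈ T, ∀ k k' : ℕ, γ + k • e = γ' + k' • e → k = k')
    (hT' : ∀ γ', γ' ∈ T' ↔ ∃ (k : ℕ), ∃ γ ∈ T, γ' = γ + k • e) :
    IsMulFamily (monFamily (WtLE u v T')) ∧ SyzygyProp (monFamily (WtLE u v T')) := by
  refine syzygyProp_step (y := y) (e := e) (g := wt u v e) hT (fun γ j h => hmul γ h.1)
    (fun γ j h => ?_) (fun γ γ' j k k' h h' => hinj γ h.1 γ' h'.1 k k') fun γ' j => ?_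
  · rw [mem_monFamily]
    intro δ hδ
    have := mem_monFamily.mp (hcomm γ h.1) δ hδ
    exact ⟨this.1, this.2.trans (add_le_add_left h.2 _)⟩
  · constructor
    · rintro ⟨h, hj⟩
      obtain ⟨k, γ, hγ, rfl⟩ := (hT' γ').mp h
      refine ⟨k, γ, rfl, hγ, ?_⟩
      rwa [map_add, map_nsmul, ← le_sub_iff_add_le] at hj
    · rintro ⟨k, γ, rfl, hγ, hj⟩
      refine ⟨(hT' _).mpr ⟨k, γ, hγ, rfl⟩, ?_⟩
      rwa [map_add, map_nsmul, ← le_sub_iff_add_le]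

/-- The syzygy theorem for the Weyl algebra with a bifiltration by two weight vectors (more
precisely, for its Rees ring). The ring is built from `ℂ[h₁, h₂]` by adjoining the variables
one after the other, and then the derivations. -/
theorem syzygyProp_weyl (huv : ∀ i, 0 ≤ u i + v i) :
    IsMulFamily (monFamily (WtLE u v Set.univ)) ∧
      SyzygyProp (monFamily (WtLE u v Set.univ)) := by
  classical
  have hx : ∀ A : Finset σ,
      IsMulFamily (monFamily (WtLE u v {γ | (∀ i ∉ A, γ.1 i = 0) ∧ γ.2 = 0})) ∧
      SyzygyProp (monFamily (WtLE u v {γ | (∀ i ∉ A, γ.1 i = 0) ∧ γ.2 = 0})) := by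
    intro A
    induction A using Finset.induction_on with
    | empty =>
      have e : {γ : (σ → ℕ) × (σ → ℕ) | (∀ i ∉ (∅ : Finset σ), γ.1 i = 0) ∧ γ.2 = 0} = {0} := by
        ext γ; simp [Prod.ext_iff, funext_iff]
      rw [e]
      exact syzygyProp_zero u v
    | insert i A hi ih =>
      refine syzygyProp_wtLE_step (y := x i) (e := (Pi.single i 1, 0)) ih
        (fun γ hγ => mon_mul_pow (C := fun γ => γ.2 = 0) (fun γ h => by simpa using h)
          (fun γ h => mon_mul_x h i) hγ.2)
        (fun γ hγ => ?_) (fun γ hγ γ' hγ' k k' h => ?_) fun γ' => ?_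
      · have hc : Commute (x i) (mon γ) := by
          rw [mon, hγ.2, delPow_zero, mul_one]
          exact Finset.noncommProd_commute _ _ _ _ fun j _ => (commute_x i j).pow_right _
        rw [hc.eq, sub_self]
        exact zero_mem _
      · have := congrFun (congrArg Prod.fst h) i
        simpa [hγ.1 i hi, hγ'.1 i hi] using this
      · constructor
        · rintro ⟨h1, h2⟩
          refine ⟨γ'.1 i, (Function.update γ'.1 i 0, 0), ⟨fun j hj => ?_, rfl⟩, ?_⟩
          · by_cases hji : j = i
            · subst hji; simp
            · simpa [hji] using h1 j (by simp [hji, hj])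
          · ext j
            · by_cases hji : j = i
              · subst hji; simp
              · simp [hji]
            · simp [h2]
        · rintro ⟨k, γ, ⟨h1, h2⟩, rfl⟩
          refine ⟨fun j hj => ?_, by simp [h2]⟩
          rw [Finset.mem_insert, not_or] at hj
          simp [h1 j hj.2, hj.1]
  have hd : ∀ B : Finset σ, IsMulFamily (monFamily (WtLE u v {γ | ∀ i ∉ B, γ.2 i = 0})) ∧
      SyzygyProp (monFamily (WtLE u v {γ | ∀ i ∉ B, γ.2 i = 0})) := by
    intro B
    induction B using Finset.induction_on with
    | empty =>
      have e : {γ : (σ → ℕ) × (σ → ℕ) | ∀ i ∉ (∅ : Finset σ), γ.2 i = 0} =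
          {γ | (∀ i ∉ Finset.univ, γ.1 i = 0) ∧ γ.2 = 0} := by
        ext γ; simp [funext_iff]
      rw [e]
      exact hx Finset.univ
    | insert i B hi ih =>
      refine syzygyProp_wtLE_step (y := del i) (e := (0, Pi.single i 1)) ih
        (fun γ hγ => mon_mul_pow (C := fun _ => True) (fun γ h => trivial)
          (fun γ _ => mon_mul_del γ i) trivial)
        (fun γ hγ => ?_) (fun γ hγ γ' hγ' k k' h => ?_) fun γ' => ?_
      · -- `[∂_i, x^α ∂^β] = α_i x^(α - e_i) ∂^β`
        have hc : del i * mon γ - mon γ * del i =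
            (γ.1 i : ℂ) • mon (γ.1 - Pi.single i 1, γ.2) := by
          have h1 : Commute (del i) (delPow γ.2) :=
            Finset.noncommProd_commute _ _ _ _ fun j _ => (commute_del i j).pow_right _
          rw [mon, mon, ← mul_assoc, del_mul_xPow, add_mul, smul_mul_assoc, mul_assoc, mul_assoc,
            h1.eq, add_sub_cancel_left]
        rw [hc]
        by_cases h0 : γ.1 i = 0
        · rw [h0, Nat.cast_zero, zero_smul]; exact zero_mem _
        · refine smul_mem_monFamily _ (mon_mem_monFamily ⟨hγ, ?_⟩)
          have e : γ = (γ.1 - Pi.single i 1, γ.2) + (Pi.single i 1, 0) := by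
            ext j
            · by_cases hj : j = i
              · subst hj; simp; omega
              · simp [hj]
            · simp
          conv_rhs => rw [e]
          rw [map_add, wt_x, wt_del, add_assoc]
          exact le_add_of_nonneg_right (huv i)
      · have := congrFun (congrArg Prod.snd h) i
        simpa [hγ i hi, hγ' i hi] using this
      · constructor
        · intro h2
          refine ⟨γ'.2 i, (γ'.1, Function.update γ'.2 i 0), fun j hj => ?_, ?_⟩
          · by_cases hji : j = i
            · subst hji; simp
            · simpa [hji] using h2 j (by simp [hji, hj])
          · ext j
            · simp
            · by_cases hji : j = i
              · subst hji; simp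
              · simp [hji]
        · rintro ⟨k, γ, h2, rfl⟩ j hj
          rw [Finset.mem_insert, not_or] at hj
          simp [h2 j hj.2, hj.1]
  have := hd Finset.univ
  have e : {γ : (σ → ℕ) × (σ → ℕ) | ∀ i ∉ Finset.univ, γ.2 i = 0} = Set.univ := by
    ext γ; simp
  rwa [e] at this

end Chain

end Weyl

section FV

variable {n p : ℕ}

/-- The bidegree `(|β| + |μ|, |μ| - |ν|)` of the monomial `x^α t^ν ∂_x^β ∂_t^μ`. -/
def fvWt (n p : ℕ) : ((Fin n ⊕ Fin p → ℕ) × (Fin n ⊕ Fin p → ℕ)) →+ ℤ × ℤ :=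
  Weyl.wt (Sum.elim (fun _ => (0, 0)) fun _ => (0, -1)) (Sum.elim (fun _ => (1, 0)) fun _ => (1, 1))

theorem FV_eq_monFamily : FV n p = Weyl.monFamily (Weyl.WtLE
    (Sum.elim (fun _ => (0, 0)) fun _ => (0, -1)) (Sum.elim (fun _ => (1, 0)) fun _ => (1, 1))
    Set.univ) := by
  ext j P
  change P ∈ Weyl.ordFil _ _ _ ∧ P ∈ Weyl.ordFil _ _ _ ↔ _
  rw [Weyl.mem_ordFil, Weyl.mem_ordFil, Weyl.mem_monFamily, ← forall₂_and]
  refine forall₂_congr fun γ _ => ?_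
  simp only [Weyl.WtLE, Set.mem_univ, true_and, Prod.le_def]
  refine and_congr (iff_of_eq (congrArg (· ≤ j.1) ?_)) (iff_of_eq (congrArg (· ≤ j.2) ?_))
  · simp [Weyl.weight, Weyl.wt, Prod.fst_sum]
  · simp [Weyl.weight, Weyl.wt, Prod.snd_sum]

theorem mem_FV {j : ℤ × ℤ} {P : D n p} :
    P ∈ FV n p j ↔ ∀ γ, (Weyl.basis _).repr P γ ≠ 0 → fvWt n p γ ≤ j := by
  rw [FV_eq_monFamily, Weyl.mem_monFamily]
  simp only [Weyl.WtLE, Set.mem_univ, true_and]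
  rfl

theorem isMulFamily_FV : IsMulFamily (FV n p) := by
  rw [FV_eq_monFamily]
  exact (Weyl.syzygyProp_weyl (by rintro (i | i) <;> simp [Prod.le_def])).1

theorem syzygyProp_FV : SyzygyProp (FV n p) := by
  rw [FV_eq_monFamily]
  exact (Weyl.syzygyProp_weyl (by rintro (i | i) <;> simp [Prod.le_def])).2

end FV

/-! ### Existence of bifiltered free resolutions -/

section Assembly

variable {R : Type} [Ring R]

/-- A finite free resolution of the graded module with pieces `𝒦 j`: the data of a
`FreeResolution`, where exactness is only asked on the pieces. -/
structure PieceResolution (𝒜 : ℤ × ℤ → AddSubgroup R) {X : Type*} [AddCommGroup X] [Module R X]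
    (𝒦 : ℤ × ℤ → AddSubgroup X) where
  /-- the length -/
  length : ℕ
  /-- the ranks -/
  rank : ℕ → ℕ
  rank_eq_zero : ∀ i, length < i → rank i = 0
  /-- the shifts -/
  shift : ∀ i, Fin (rank i) → ℤ × ℤ
  /-- the augmentation -/
  aug : (Fin (rank 0) → R) →ₗ[R] X
  /-- the differentials -/
  diff : ∀ i, (Fin (rank (i + 1)) → R) →ₗ[R] (Fin (rank i) → R)
  aug_piece : ∀ j, (shifted 𝒜 (shift 0) j).map aug.toAddMonoidHom = 𝒦 j
  exact_zero_piece : ∀ j, (shifted 𝒜 (shift 1) j).map (diff 0).toAddMonoidHom =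
    shifted 𝒜 (shift 0) j ⊓ aug.toAddMonoidHom.ker
  exact_succ_piece : ∀ i j, (shifted 𝒜 (shift (i + 2)) j).map (diff (i + 1)).toAddMonoidHom =
    shifted 𝒜 (shift (i + 1)) j ⊓ (diff i).toAddMonoidHom.ker

variable {𝒜 : ℤ × ℤ → AddSubgroup R}

/-- A resolution of the kernel of a free cover extends to a resolution of the covered module. -/
def PieceResolution.cons {X : Type*} [AddCommGroup X] [Module R X] {𝒦 : ℤ × ℤ → AddSubgroup X}
    {r : ℕ} {b : Fin r → ℤ × ℤ} {φ : (Fin r → R) →ₗ[R] X}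
    (hφ : ∀ j, (shifted 𝒜 b j).map φ.toAddMonoidHom = 𝒦 j)
    (S : PieceResolution 𝒜 (kerFamily 𝒜 b φ)) : PieceResolution 𝒜 𝒦 where
  length := S.length + 1
  rank
    | 0 => r
    | i + 1 => S.rank i
  rank_eq_zero
    | 0, h => by omega
    | i + 1, h => S.rank_eq_zero i (by omega)
  shift
    | 0 => b
    | i + 1 => S.shift i
  aug := φ
  diff
    | 0 => S.aug
    | i + 1 => S.diff i
  aug_piece := hφ
  exact_zero_piece j := S.aug_piece j
  exact_succ_piece
    | 0, j => S.exact_zero_piece j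
    | i + 1, j => S.exact_succ_piece i j

theorem HasRes.nonempty_pieceResolution {n : ℕ} {X : Type} [AddCommGroup X] [Module R X]
    {𝒦 : ℤ × ℤ → AddSubgroup X} (h : HasRes 𝒜 n 𝒦) : Nonempty (PieceResolution 𝒜 𝒦) := by
  induction n generalizing X with
  | zero =>
    refine ⟨⟨0, fun _ => 0, fun _ _ => rfl, fun _ => Fin.elim0, 0, fun _ => 0, fun j => ?_,
      fun j => ?_, fun i j => ?_⟩⟩
    · rw [h j, eq_bot_iff]
      rintro _ ⟨v, -, rfl⟩
      simp
    · ext v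
      simp [Subsingleton.elim v 0]
    · ext v
      simp [Subsingleton.elim v 0]
  | succ n ih =>
    obtain ⟨ι, _, b, φ, h1, h2⟩ := h
    -- number the basis
    let f := Fintype.equivFin ι
    let e : (ι → R) →ₗ[R] (Fin (Fintype.card ι) → R) := LinearMap.funLeft R R f.symm
    let e' : (Fin (Fintype.card ι) → R) →ₗ[R] (ι → R) := LinearMap.funLeft R R f
    have hee' : ∀ v, e (e' v) = v := fun v => by ext i; simp [e, e', LinearMap.funLeft_apply]
    have he'e : ∀ v, e' (e v) = v := fun v => by ext i; simp [e, e', LinearMap.funLeft_apply]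
    have he' : ∀ j v, v ∈ shifted 𝒜 (b ∘ f.symm) j ↔ e' v ∈ gshift 𝒜 b j := by
      intro j v
      change v ∈ gshift 𝒜 (b ∘ f.symm) j ↔ _
      rw [mem_gshift, mem_gshift, ← f.forall_congr_right]
      refine forall_congr' fun l => ?_
      simp [e', LinearMap.funLeft_apply]
    have h2' := (h2.map e fun j v _ hv => by rw [← he'e v, hv, map_zero]).congr
      (𝒦' := kerFamily 𝒜 (b ∘ f.symm) (φ ∘ₗ e')) fun j => by
        ext v
        constructor
        · rintro ⟨u, ⟨hu, hu0⟩, rfl⟩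
          refine ⟨(he' j _).mpr ?_, ?_⟩
          · change e' (e u) ∈ _
            rw [he'e]; exact hu
          · change φ (e' (e u)) = 0
            rw [he'e]; exact hu0
        · rintro ⟨hv, hv0⟩
          exact ⟨e' v, ⟨(he' j v).mp hv, hv0⟩, hee' v⟩
    obtain ⟨S⟩ := ih h2'
    refine ⟨PieceResolution.cons (b := b ∘ f.symm) (φ := φ ∘ₗ e') (fun j => ?_) S⟩
    rw [← h1]
    ext x
    constructor
    · rintro ⟨v, hv, rfl⟩
      exact ⟨e' v, (he' j v).mp hv, rfl⟩
    · rintro ⟨v, hv, rfl⟩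
      refine ⟨e v, (he' j _).mpr (by rw [he'e]; exact hv), ?_⟩
      change φ (e' (e v)) = φ v
      rw [he'e]

/-- Exactness on the pieces of an exhaustive bifiltration implies exactness. -/
theorem exact_of_exhaustive {r q : ℕ} {X : Type*} [AddCommGroup X] [Module R X]
    {b : Fin r → ℤ × ℤ} {c : Fin q → ℤ × ℤ} {φ : (Fin r → R) →ₗ[R] X}
    {ψ : (Fin q → R) →ₗ[R] (Fin r → R)} (hb : ∀ v, ∃ j, v ∈ shifted 𝒜 b j)
    (hc : ∀ v, ∃ j, v ∈ shifted 𝒜 c j)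
    (h : ∀ j, (shifted 𝒜 c j).map ψ.toAddMonoidHom =
      shifted 𝒜 b j ⊓ φ.toAddMonoidHom.ker) : Function.Exact ψ φ := by
  intro v
  constructor
  · intro hv
    obtain ⟨j, hj⟩ := hb v
    have : v ∈ (shifted 𝒜 c j).map ψ.toAddMonoidHom := by
      rw [h]; exact ⟨hj, hv⟩
    obtain ⟨w, -, rfl⟩ := this
    exact ⟨w, rfl⟩
  · rintro ⟨w, rfl⟩
    obtain ⟨j, hj⟩ := hc w
    have : ψ w ∈ shifted 𝒜 b j ⊓ φ.toAddMonoidHom.ker := by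
      rw [← h]; exact ⟨w, hj, rfl⟩
    exact this.2

/-- For exhaustive bifiltrations, exactness on the pieces is enough. -/
def PieceResolution.toFreeResolution {X : Type*} [AddCommGroup X] [Module R X]
    {𝒦 : ℤ × ℤ → AddSubgroup X} (S : PieceResolution 𝒜 𝒦) (h𝒦 : ∀ x, ∃ j, x ∈ 𝒦 j)
    (h𝒜 : ∀ {r : ℕ} (b : Fin r → ℤ × ℤ) (v : Fin r → R), ∃ j, v ∈ shifted 𝒜 b j) :
    FreeResolution 𝒜 𝒦 where
  length := S.length
  rank := S.rank
  rank_eq_zero := S.rank_eq_zero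
  shift := S.shift
  aug := S.aug
  diff := S.diff
  aug_surjective x := by
    obtain ⟨j, hj⟩ := h𝒦 x
    rw [← S.aug_piece] at hj
    obtain ⟨v, -, hv⟩ := hj
    exact ⟨v, hv⟩
  exact_zero := exact_of_exhaustive (h𝒜 _) (h𝒜 _) S.exact_zero_piece
  exact_succ i := exact_of_exhaustive (h𝒜 _) (h𝒜 _) (S.exact_succ_piece i)
  aug_piece := S.aug_piece
  exact_zero_piece := S.exact_zero_piece
  exact_succ_piece := S.exact_succ_piece

end Assembly

section Existence

variable {n p : ℕ}

theorem exists_mem_shifted_FV {r : ℕ} (b : Fin r → ℤ × ℤ) (v : Fin r → D n p) :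
    ∃ j, v ∈ shifted (FV n p) b j := by
  obtain ⟨j, hj⟩ := Finset.exists_le (Finset.univ.biUnion fun l =>
    ((Weyl.basis _).repr (v l)).support.image fun γ => fvWt n p γ + b l)
  refine ⟨j, mem_gshift.mpr fun l => mem_FV.mpr fun γ hγ => ?_⟩
  rw [le_sub_iff_add_le]
  exact hj _ (Finset.mem_biUnion.mpr ⟨l, Finset.mem_univ _, Finset.mem_image_of_mem _
    (Finsupp.mem_support_iff.mpr hγ)⟩)

/-- A module with a good bifiltration has a finite bifiltered free resolution. -/
theorem IsGood.nonempty_freeResolution {M : Type*} [AddCommGroup M] [Module (D n p) M]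
    {F : ℤ × ℤ → AddSubgroup M} (h : IsGood (n := n) (p := p) F) :
    Nonempty (FreeResolution (FV n p) F) := by
  obtain ⟨r, b, N, e, hF⟩ := h
  let φ : (Fin r → D n p) →ₗ[D n p] M := e.toLinearMap ∘ₗ N.mkQ
  have hφ : ∀ j, (shifted (FV n p) b j).map φ.toAddMonoidHom = F j := by
    intro j
    rw [hF, AddSubgroup.map_map]
    rfl
  obtain ⟨m, hm⟩ := syzygyProp_FV (n := n) (p := p) (Fin r) b (kerFamily (FV n p) b φ)
    (fun j => inf_le_left) (Stable.kerFamily isMulFamily_FV b φ)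
  obtain ⟨S⟩ := hm.nonempty_pieceResolution
  refine ⟨(PieceResolution.cons hφ S).toFreeResolution (fun x => ?_) exists_mem_shifted_FV⟩
  obtain ⟨v, rfl⟩ := (e.surjective.comp N.mkQ_surjective) x
  obtain ⟨j, hj⟩ := exists_mem_shifted_FV b v
  refine ⟨j, ?_⟩
  rw [← hφ]
  exact ⟨v, hj, rfl⟩

end Existence

/-! ### Symbols, and the associated graded resolution -/

section Decomposition

variable {Y : Type*} [AddCommGroup Y]

/-- `π j` is the projection of `Y` to the component `𝒴 j` of a grading of `Y`. -/
structure IsDecomposition (𝒴 : ℤ × ℤ → AddSubgroup Y) (π : ℤ × ℤ → Y →+ Y) : Prop where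
  mem : ∀ j y, π j y ∈ 𝒴 j
  apply_self : ∀ {j y}, y ∈ 𝒴 j → π j y = y
  apply_ne : ∀ {i j y}, y ∈ 𝒴 i → i ≠ j → π j y = 0
  sum_eq : ∀ y, ∃ J : Finset (ℤ × ℤ), ∀ J', J ⊆ J' → ∑ j ∈ J', π j y = y

theorem exists_isDecomposition {𝒴 : ℤ × ℤ → AddSubgroup Y} (h : DirectSum.IsInternal 𝒴) :
    ∃ π, IsDecomposition 𝒴 π := by
  classical
  let e : (DirectSum (ℤ × ℤ) fun j => 𝒴 j) ≃+ Y :=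
    AddEquiv.ofBijective (DirectSum.coeAddMonoidHom 𝒴) h
  have he : ∀ {j y} (hy : y ∈ 𝒴 j), e.symm y = DirectSum.of (fun j => 𝒴 j) j ⟨y, hy⟩ := by
    intro j y hy
    rw [AddEquiv.symm_apply_eq]
    exact (DirectSum.coeAddMonoidHom_of 𝒴 j ⟨y, hy⟩).symm
  refine ⟨fun j => (𝒴 j).subtype.comp
    ((DFinsupp.evalAddMonoidHom j).comp e.symm.toAddMonoidHom), ?_, ?_, ?_, ?_⟩
  · intro j y
    exact (e.symm y j).2
  · intro j y hy
    change ((e.symm y j : 𝒴 j) : Y) = y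
    rw [he hy, DirectSum.of_eq_same]
  · intro i j y hy hij
    change ((e.symm y j : 𝒴 j) : Y) = 0
    rw [he hy, DirectSum.of_eq_of_ne _ _ _ (Ne.symm hij), ZeroMemClass.coe_zero]
  · intro y
    refine ⟨(e.symm y).support, fun J' hJ' => ?_⟩
    conv_rhs => rw [← e.apply_symm_apply y]
    change _ = DirectSum.coeAddMonoidHom 𝒴 (e.symm y)
    rw [DirectSum.coeAddMonoidHom_eq_dfinsuppSum, DFinsupp.sum]
    refine (Finset.sum_subset hJ' fun j _ hj => ?_).symm
    rw [DFinsupp.notMem_support_iff] at hj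
    change ((e.symm y j : 𝒴 j) : Y) = 0
    rw [hj, ZeroMemClass.coe_zero]

/-- A homomorphism which respects the components commutes with the projections. -/
theorem IsDecomposition.map_apply {Y' : Type*} [AddCommGroup Y'] {𝒴 : ℤ × ℤ → AddSubgroup Y}
    {π : ℤ × ℤ → Y →+ Y} (h : IsDecomposition 𝒴 π) {𝒴' : ℤ × ℤ → AddSubgroup Y'}
    {π' : ℤ × ℤ → Y' →+ Y'} (h' : IsDecomposition 𝒴' π') (f : Y →+ Y')
    (hf : ∀ j, ∀ y ∈ 𝒴 j, f y ∈ 𝒴' j) (j : ℤ × ℤ) (y : Y) : π' j (f y) = f (π j y) := by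
  classical
  obtain ⟨J, hJ⟩ := h.sum_eq y
  have e : ∀ i, π' j (f (π i y)) = if i = j then f (π j y) else 0 := by
    intro i
    split_ifs with hij
    · subst hij
      exact h'.apply_self (hf i _ (h.mem i y))
    · exact h'.apply_ne (hf i _ (h.mem i y)) hij
  conv_lhs => rw [← hJ (insert j J) (Finset.subset_insert _ _), map_sum, map_sum]
  rw [Finset.sum_congr rfl fun i _ => e i]
  simp

variable {R : Type*} [Ring R] {𝒜 : ℤ × ℤ → AddSubgroup R}

theorem mem_shifted {r : ℕ} {b : Fin r → ℤ × ℤ} {j : ℤ × ℤ} {v : Fin r → R} :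
    v ∈ shifted 𝒜 b j ↔ ∀ l, v l ∈ 𝒜 (j - b l) := by
  simp [shifted, AddSubgroup.mem_pi]

theorem exists_isDecomposition_shifted (h : DirectSum.IsInternal 𝒜) {r : ℕ}
    (b : Fin r → ℤ × ℤ) : ∃ π, IsDecomposition (shifted 𝒜 b) π := by
  classical
  obtain ⟨π, hπ⟩ := exists_isDecomposition h
  refine ⟨fun j => AddMonoidHom.mk' (fun v l => π (j - b l) (v l)) fun v w => by
    ext l; simp, ?_, ?_, ?_, ?_⟩
  · intro j v
    exact mem_shifted.mpr fun l => hπ.mem _ _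
  · intro j v hv
    ext l
    exact hπ.apply_self (mem_shifted.mp hv l)
  · intro i j v hv hij
    ext l
    exact hπ.apply_ne (mem_shifted.mp hv l) fun h => hij (sub_left_injective h)
  · intro v
    choose J hJ using fun l => hπ.sum_eq (v l)
    refine ⟨Finset.univ.biUnion fun l => (J l).image (· + b l), fun J' hJ' => ?_⟩
    ext l
    rw [Finset.sum_apply]
    conv_rhs => rw [← hJ l (J'.image (· - b l)) fun j hj => by
      refine Finset.mem_image.mpr ⟨j + b l, hJ' ?_, add_sub_cancel_right _ _⟩
      exact Finset.mem_biUnion.mpr ⟨l, Finset.mem_univ _, Finset.mem_image_of_mem _ hj⟩]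
    rw [Finset.sum_image (sub_left_injective.injOn)]
    rfl

/-- Exactness on the components of gradings implies exactness. -/
theorem exact_of_graded (h𝒜 : DirectSum.IsInternal 𝒜) {r q : ℕ} {X : Type*} [AddCommGroup X]
    [Module R X] {b : Fin r → ℤ × ℤ} {c : Fin q → ℤ × ℤ} {φ : (Fin r → R) →ₗ[R] X}
    {ψ : (Fin q → R) →ₗ[R] (Fin r → R)} {𝒳 : ℤ × ℤ → AddSubgroup X} {π : ℤ × ℤ → X →+ X}
    (hX : IsDecomposition 𝒳 π) (hφ : ∀ j, ∀ v ∈ shifted 𝒜 b j, φ v ∈ 𝒳 j)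
    (h : ∀ j, (shifted 𝒜 c j).map ψ.toAddMonoidHom =
      shifted 𝒜 b j ⊓ φ.toAddMonoidHom.ker) : Function.Exact ψ φ := by
  obtain ⟨πb, hb⟩ := exists_isDecomposition_shifted h𝒜 b
  obtain ⟨πc, hc⟩ := exists_isDecomposition_shifted h𝒜 c
  intro v
  constructor
  · intro hv
    obtain ⟨J, hJ⟩ := hb.sum_eq v
    rw [← hJ J subset_rfl]
    change _ ∈ LinearMap.range ψ
    refine Submodule.sum_mem _ fun j _ => ?_
    have : πb j v ∈ (shifted 𝒜 c j).map ψ.toAddMonoidHom := by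
      rw [h]
      refine ⟨hb.mem j v, ?_⟩
      have := hb.map_apply hX φ.toAddMonoidHom hφ j v
      rw [LinearMap.toAddMonoidHom_coe, hv, map_zero] at this
      exact this.symm
    obtain ⟨w, -, hw⟩ := this
    exact ⟨w, hw⟩
  · rintro ⟨w, rfl⟩
    obtain ⟨J, hJ⟩ := hc.sum_eq w
    rw [← hJ J subset_rfl, map_sum, map_sum]
    refine Finset.sum_eq_zero fun j _ => ?_
    have : ψ (πc j w) ∈ shifted 𝒜 b j ⊓ φ.toAddMonoidHom.ker := by
      rw [← h]; exact ⟨_, hc.mem j w, rfl⟩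
    exact this.2

end Decomposition

section Symbol

/-- The maps `s j` identify the quotients `𝒳 j / (𝒳 (j - (1, 0)) + 𝒳 (j - (0, 1)))` with the
subgroups `𝒴 j`. Each `s j` is only meaningful on `𝒳 j`. -/
structure IsSymbol {X Y : Type*} [AddCommGroup X] [AddCommGroup Y] (𝒳 : ℤ × ℤ → AddSubgroup X)
    (𝒴 : ℤ × ℤ → AddSubgroup Y) (s : ℤ × ℤ → X → Y) : Prop where
  map_add : ∀ {j x x'}, x ∈ 𝒳 j → x' ∈ 𝒳 j → s j (x + x') = s j x + s j x'
  eq_zero_iff : ∀ {j x}, x ∈ 𝒳 j → (s j x = 0 ↔ x ∈ biLt 𝒳 j)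
  mem_iff : ∀ {j y}, y ∈ 𝒴 j ↔ ∃ x ∈ 𝒳 j, s j x = y

/-- The symbol maps are compatible with the module structures. -/
def SymbolSMul {R R' X Y : Type*} [Ring R] [Ring R'] [AddCommGroup X] [AddCommGroup Y] [Module R X]
    [Module R' Y] (𝒜 : ℤ × ℤ → AddSubgroup R) (𝒳 : ℤ × ℤ → AddSubgroup X)
    (s : ℤ × ℤ → R → R') (t : ℤ × ℤ → X → Y) : Prop :=
  ∀ ⦃i j a x⦄, a ∈ 𝒜 i → x ∈ 𝒳 j → t (i + j) (a • x) = s i a • t j x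

/-- `𝒳 (d - 1, k) ∩ 𝒳 (d, k - 1) = 𝒳 (d - 1, k - 1)`: the homogenizing variables form a regular
sequence on the Rees module. -/
def NiceFamily {X : Type*} [AddCommGroup X] (𝒳 : ℤ × ℤ → AddSubgroup X) : Prop :=
  ∀ d k : ℤ, 𝒳 (d - 1, k) ⊓ 𝒳 (d, k - 1) ≤ 𝒳 (d - 1, k - 1)

variable {X Y : Type*} [AddCommGroup X] [AddCommGroup Y] {𝒳 : ℤ × ℤ → AddSubgroup X}
  {𝒴 : ℤ × ℤ → AddSubgroup Y} {t : ℤ × ℤ → X → Y}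

theorem IsSymbol.map_zero (h : IsSymbol 𝒳 𝒴 t) (j : ℤ × ℤ) : t j 0 = 0 :=
  (h.eq_zero_iff (zero_mem _)).mpr (zero_mem _)

theorem IsSymbol.map_sum (h : IsSymbol 𝒳 𝒴 t) {κ : Type*} (J : Finset κ) {j : ℤ × ℤ} {x : κ → X}
    (hx : ∀ l ∈ J, x l ∈ 𝒳 j) : t j (∑ l ∈ J, x l) = ∑ l ∈ J, t j (x l) := by
  classical
  induction J using Finset.induction_on with
  | empty => simpa using h.map_zero j
  | insert a J ha ih =>
    rw [Finset.sum_insert ha, Finset.sum_insert ha,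
      h.map_add (hx a (Finset.mem_insert_self _ _))
        (sum_mem fun l hl => hx l (Finset.mem_insert_of_mem hl)),
      ih fun l hl => hx l (Finset.mem_insert_of_mem hl)]

theorem IsSymbol.apply_mem (h : IsSymbol 𝒳 𝒴 t) {j : ℤ × ℤ} {x : X} (hx : x ∈ 𝒳 j) :
    t j x ∈ 𝒴 j := h.mem_iff.mpr ⟨x, hx, rfl⟩

variable {R : Type} {R' : Type*} [Ring R] [Ring R'] [Module R X] [Module R' Y]
  {𝒜 : ℤ × ℤ → AddSubgroup R} {𝒜' : ℤ × ℤ → AddSubgroup R'} {s : ℤ × ℤ → R → R'}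

/-- The symbol maps of the free module `R^r[b]`. -/
def freeSymbol (s : ℤ × ℤ → R → R') {r : ℕ} (b : Fin r → ℤ × ℤ) (j : ℤ × ℤ) (v : Fin r → R) :
    Fin r → R' := fun l => s (j - b l) (v l)

theorem mem_biLt_shifted {r : ℕ} {b : Fin r → ℤ × ℤ} {j : ℤ × ℤ} {v : Fin r → R} :
    v ∈ biLt (shifted 𝒜 b) j ↔ ∀ l, v l ∈ biLt 𝒜 (j - b l) := by
  have e1 : ∀ l, ((j.1 - 1, j.2) : ℤ × ℤ) - b l = ((j - b l).1 - 1, (j - b l).2) := fun l => by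
    ext <;> simp; omega
  have e2 : ∀ l, ((j.1, j.2 - 1) : ℤ × ℤ) - b l = ((j - b l).1, (j - b l).2 - 1) := fun l => by
    ext <;> simp; omega
  simp only [biLt, AddSubgroup.mem_sup]
  constructor
  · rintro ⟨x, hx, z, hz, rfl⟩ l
    have h1 := mem_shifted.mp hx l
    have h2 := mem_shifted.mp hz l
    rw [e1] at h1
    rw [e2] at h2
    exact ⟨x l, h1, z l, h2, rfl⟩
  · intro h
    choose x hx z hz e using h
    refine ⟨x, mem_shifted.mpr fun l => ?_, z, mem_shifted.mpr fun l => ?_, funext e⟩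
    · rw [e1]; exact hx l
    · rw [e2]; exact hz l

theorem IsSymbol.free (h : IsSymbol 𝒜 𝒜' s) {r : ℕ} (b : Fin r → ℤ × ℤ) :
    IsSymbol (shifted 𝒜 b) (shifted 𝒜' b) (freeSymbol s b) where
  map_add hx hx' := by
    ext l
    exact h.map_add (mem_shifted.mp hx l) (mem_shifted.mp hx' l)
  eq_zero_iff {j v} hv := by
    rw [mem_biLt_shifted, funext_iff]
    exact forall_congr' fun l => h.eq_zero_iff (mem_shifted.mp hv l)
  mem_iff {j w} := by
    rw [mem_shifted]
    constructor
    · intro hw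
      choose v hv e using fun l => h.mem_iff.mp (hw l)
      exact ⟨v, mem_shifted.mpr hv, funext e⟩
    · rintro ⟨v, hv, rfl⟩ l
      exact h.apply_mem (mem_shifted.mp hv l)

theorem SymbolSMul.free (h : SymbolSMul 𝒜 𝒜 s s) {r : ℕ} (b : Fin r → ℤ × ℤ) :
    SymbolSMul 𝒜 (shifted 𝒜 b) s (freeSymbol s b) := by
  intro i j a v ha hv
  ext l
  have := h ha (mem_shifted.mp hv l)
  rwa [← add_sub_assoc] at this

theorem NiceFamily.shifted (h : NiceFamily 𝒜) {r : ℕ} (b : Fin r → ℤ × ℤ) :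
    NiceFamily (shifted 𝒜 b) := by
  rintro d k v ⟨h1, h2⟩
  refine mem_shifted.mpr fun l => ?_
  have := h (d - (b l).1) (k - (b l).2)
  have h1 := mem_shifted.mp h1 l
  have h2 := mem_shifted.mp h2 l
  rw [show ((d - 1, k) : ℤ × ℤ) - b l = (d - (b l).1 - 1, k - (b l).2) by ext <;> simp; omega] at h1
  rw [show ((d, k - 1) : ℤ × ℤ) - b l = (d - (b l).1, k - (b l).2 - 1) by ext <;> simp; omega] at h2
  rw [show ((d - 1, k - 1) : ℤ × ℤ) - b l = (d - (b l).1 - 1, k - (b l).2 - 1) by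
    ext <;> simp <;> omega]
  exact this ⟨h1, h2⟩

theorem NiceFamily.inf_const (h : NiceFamily 𝒳) (S : AddSubgroup X) :
    NiceFamily fun j => 𝒳 j ⊓ S :=
  fun d k _ hx => ⟨h d k ⟨hx.1.1, hx.2.1⟩, hx.1.2⟩

/-- The homomorphism of associated graded modules induced by `φ : R^r[b] → X`. -/
def symbolMap (R' : Type*) [Ring R'] [Module R' Y] (t : ℤ × ℤ → X → Y) {r : ℕ} (b : Fin r → ℤ × ℤ)
    (φ : (Fin r → R) →ₗ[R] X) : (Fin r → R') →ₗ[R'] Y :=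
  Fintype.linearCombination R' fun l => t (b l) (φ (Pi.single l 1))

theorem symbolMap_apply (h𝒜 : IsMulFamily 𝒜) (ht : IsSymbol 𝒳 𝒴 t) (hst : SymbolSMul 𝒜 𝒳 s t)
    (h𝒳 : Stable 𝒜 𝒳) {r : ℕ} {b : Fin r → ℤ × ℤ} {φ : (Fin r → R) →ₗ[R] X}
    (hφ : ∀ j, ∀ v ∈ shifted 𝒜 b j, φ v ∈ 𝒳 j) {j : ℤ × ℤ} {v : Fin r → R}
    (hv : v ∈ shifted 𝒜 b j) : symbolMap R' t b φ (freeSymbol s b j v) = t j (φ v) := by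
  have hφ' : ∀ l, φ (Pi.single l 1) ∈ 𝒳 (b l) := fun l =>
    hφ _ _ (single_mem_gshift h𝒜 b l)
  have hmem : ∀ l, v l • φ (Pi.single l 1) ∈ 𝒳 j := fun l => by
    have := h𝒳 (mem_shifted.mp hv l) (hφ' l)
    rwa [sub_add_cancel] at this
  rw [map_eq_linearCombination φ v, symbolMap, Fintype.linearCombination_apply,
    Fintype.linearCombination_apply, ht.map_sum _ fun l _ => hmem l]
  refine Finset.sum_congr rfl fun l _ => ?_
  have := hst (mem_shifted.mp hv l) (hφ' l)
  rw [sub_add_cancel] at this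
  exact this.symm

/-- Passing to symbols preserves exactness at `R^r[b]`, if the next map is strict for the
subgroups `biLt`. -/
theorem symbolMap_exact (h𝒜 : IsMulFamily 𝒜) (hs : IsSymbol 𝒜 𝒜' s) (hss : SymbolSMul 𝒜 𝒜 s s)
    (ht : IsSymbol 𝒳 𝒴 t) (hst : SymbolSMul 𝒜 𝒳 s t) (h𝒳 : Stable 𝒜 𝒳) {r q : ℕ}
    {b : Fin r → ℤ × ℤ} {c : Fin q → ℤ × ℤ} {φ : (Fin r → R) →ₗ[R] X}
    {ψ : (Fin q → R) →ₗ[R] (Fin r → R)} (hφ : ∀ j, ∀ v ∈ shifted 𝒜 b j, φ v ∈ 𝒳 j)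
    (hψ : ∀ j, (shifted 𝒜 c j).map ψ.toAddMonoidHom = shifted 𝒜 b j ⊓ φ.toAddMonoidHom.ker)
    (hstrict : ∀ j, ∀ v ∈ shifted 𝒜 b j, φ v ∈ biLt 𝒳 j →
      ∃ v' ∈ biLt (shifted 𝒜 b) j, v' ∈ shifted 𝒜 b j ∧ φ v' = φ v) (j : ℤ × ℤ) :
    (shifted 𝒜' c j).map (symbolMap R' (freeSymbol s b) c ψ).toAddMonoidHom =
      shifted 𝒜' b j ⊓ (symbolMap R' t b φ).toAddMonoidHom.ker := by
  have hψ' : ∀ j, ∀ w ∈ shifted 𝒜 c j, ψ w ∈ shifted 𝒜 b j ∧ φ (ψ w) = 0 := by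
    intro j w hw
    have : ψ w ∈ shifted 𝒜 b j ⊓ φ.toAddMonoidHom.ker := by
      rw [← hψ]; exact ⟨w, hw, rfl⟩
    exact this
  have hb := hs.free b
  have hψs : ∀ {w}, w ∈ shifted 𝒜 c j → symbolMap R' (freeSymbol s b) c ψ (freeSymbol s c j w) =
      freeSymbol s b j (ψ w) := fun hw =>
    symbolMap_apply h𝒜 hb (hss.free b) (Stable.gshift h𝒜 b) (fun j w hw => (hψ' j w hw).1) hw
  have hφs : ∀ {v}, v ∈ shifted 𝒜 b j → symbolMap R' t b φ (freeSymbol s b j v) = t j (φ v) :=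
    fun hv => symbolMap_apply h𝒜 ht hst h𝒳 hφ hv
  ext u
  constructor
  · rintro ⟨w', hw', rfl⟩
    obtain ⟨w, hw, rfl⟩ := (hs.free c).mem_iff.mp hw'
    change symbolMap R' (freeSymbol s b) c ψ _ ∈ _
    rw [hψs hw]
    refine ⟨hb.apply_mem (hψ' j w hw).1, ?_⟩
    change symbolMap R' t b φ _ = 0
    rw [hφs (hψ' j w hw).1, (hψ' j w hw).2, ht.map_zero]
  · rintro ⟨hu, hu0⟩
    obtain ⟨v, hv, rfl⟩ := hb.mem_iff.mp hu
    replace hu0 : symbolMap R' t b φ (freeSymbol s b j v) = 0 := hu0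
    rw [hφs hv, ht.eq_zero_iff (hφ j v hv)] at hu0
    obtain ⟨v', hv', hv'm, e⟩ := hstrict j v hv hu0
    have hker : v - v' ∈ shifted 𝒜 b j ⊓ φ.toAddMonoidHom.ker :=
      AddSubgroup.mem_inf.mpr ⟨sub_mem hv hv'm, by
        change φ (v - v') = 0
        rw [map_sub, e, sub_self]⟩
    rw [← hψ] at hker
    obtain ⟨w, hw, e'⟩ := hker
    replace e' : ψ w = v - v' := e'
    refine ⟨freeSymbol s c j w, (hs.free c).apply_mem hw, ?_⟩
    change symbolMap R' (freeSymbol s b) c ψ _ = _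
    rw [hψs hw, e']
    conv_rhs => rw [← sub_add_cancel v v', hb.map_add (sub_mem hv hv'm) hv'm,
      (hb.eq_zero_iff hv'm).mpr hv', add_zero]

/-- Strictness of a map onto its image. -/
theorem strict_of_map_eq (h𝒜 : Monotone 𝒜) {r : ℕ} {b : Fin r → ℤ × ℤ} {φ : (Fin r → R) →ₗ[R] X}
    (hφ : ∀ j, (shifted 𝒜 b j).map φ.toAddMonoidHom = 𝒳 j) (j : ℤ × ℤ) {x : X}
    (hx : x ∈ biLt 𝒳 j) : ∃ v' ∈ biLt (shifted 𝒜 b) j, v' ∈ shifted 𝒜 b j ∧ φ v' = x := by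
  rw [biLt, ← hφ, ← hφ, ← AddSubgroup.map_sup] at hx
  obtain ⟨v, hv, e⟩ := hx
  refine ⟨v, hv, mem_shifted.mpr fun l => ?_, e⟩
  have := mem_biLt_shifted.mp hv l
  have hle : biLt 𝒜 (j - b l) ≤ 𝒜 (j - b l) :=
    sup_le (h𝒜 ⟨by simp, by simp⟩) (h𝒜 ⟨by simp, by simp⟩)
  exact hle this

/-- Strictness of `φ : R^r[b] → R^q[c]`, if the image of `φ` is the kernel of a map `χ` with nice
image. -/
theorem strict_of_nice (h𝒜 : Monotone 𝒜) {r q : ℕ} {b : Fin r → ℤ × ℤ} {c : Fin q → ℤ × ℤ}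
    {φ : (Fin r → R) →ₗ[R] (Fin q → R)} {χ : (Fin q → R) →ₗ[R] X}
    (hφ : ∀ j, (shifted 𝒜 b j).map φ.toAddMonoidHom = shifted 𝒜 c j ⊓ χ.toAddMonoidHom.ker)
    (hχ : NiceFamily fun j => (shifted 𝒜 c j).map χ.toAddMonoidHom) (j : ℤ × ℤ) {v : Fin r → R}
    (hv : v ∈ shifted 𝒜 b j) (hx : φ v ∈ biLt (shifted 𝒜 c) j) :
    ∃ v' ∈ biLt (shifted 𝒜 b) j, v' ∈ shifted 𝒜 b j ∧ φ v' = φ v := by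
  have hmono : Monotone (shifted 𝒜 c) := fun i j hij v hv =>
    mem_shifted.mpr fun l => h𝒜 (sub_le_sub_right hij _) (mem_shifted.mp hv l)
  refine strict_of_map_eq h𝒜 hφ j ?_
  have hv0 : χ (φ v) = 0 := by
    have : φ v ∈ shifted 𝒜 c j ⊓ χ.toAddMonoidHom.ker := by
      rw [← hφ]; exact ⟨v, hv, rfl⟩
    exact this.2
  rw [biLt, AddSubgroup.mem_sup] at hx ⊢
  obtain ⟨x, hx, z, hz, e⟩ := hx
  have hxz : χ x = χ (-z) := by
    rw [← e, map_add] at hv0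
    rw [map_neg]
    exact eq_neg_of_add_eq_zero_left hv0
  -- correct `x` and `z` by an element of lower degree with the same image
  obtain ⟨w, hw, ew⟩ := hχ j.1 j.2 (x := χ x)
    ⟨⟨x, hx, rfl⟩, ⟨-z, neg_mem hz, hxz.symm⟩⟩
  replace ew : χ w = χ x := ew
  have hw₁ : w ∈ shifted 𝒜 c (j.1 - 1, j.2) := hmono (Prod.mk_le_mk.mpr ⟨le_rfl, by simp⟩) hw
  have hw₂ : w ∈ shifted 𝒜 c (j.1, j.2 - 1) := hmono (Prod.mk_le_mk.mpr ⟨by simp, le_rfl⟩) hw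
  refine ⟨x - w, AddSubgroup.mem_inf.mpr ⟨sub_mem hx hw₁, ?_⟩, z + w,
    AddSubgroup.mem_inf.mpr ⟨add_mem hz hw₂, ?_⟩, by rw [← e]; abel⟩
  · change χ (x - w) = 0
    rw [map_sub, ew, sub_self]
  · change χ (z + w) = 0
    rw [map_add, ew, hxz, map_neg, add_neg_cancel]

/-- The associated graded resolution of a bifiltered free resolution of a nicely bifiltered
module. It has the same ranks and shifts. -/
def FreeResolution.symbol {𝒩 : ℤ × ℤ → AddSubgroup X} {𝒩' : ℤ × ℤ → AddSubgroup Y}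
    (S : FreeResolution 𝒜 𝒩) (h𝒜 : IsMulFamily 𝒜) (hmono : Monotone 𝒜) (hnice : NiceFamily 𝒜)
    (hs : IsSymbol 𝒜 𝒜' s) (hss : SymbolSMul 𝒜 𝒜 s s) (h𝒜' : DirectSum.IsInternal 𝒜')
    (ht : IsSymbol 𝒩 𝒩' t) (hst : SymbolSMul 𝒜 𝒩 s t) (h𝒩 : Stable 𝒜 𝒩)
    (h𝒩nice : NiceFamily 𝒩) (h𝒩' : DirectSum.IsInternal 𝒩') : FreeResolution 𝒜' 𝒩' :=
  have haug : ∀ j, ∀ v ∈ shifted 𝒜 (S.shift 0) j, S.aug v ∈ 𝒩 j := fun j v hv => by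
    rw [← S.aug_piece]; exact ⟨v, hv, rfl⟩
  have hdiff : ∀ i j, ∀ v ∈ shifted 𝒜 (S.shift (i + 1)) j,
      S.diff i v ∈ shifted 𝒜 (S.shift i) j := fun i j v hv => by
    cases i with
    | zero =>
      have : S.diff 0 v ∈ shifted 𝒜 (S.shift 0) j ⊓ S.aug.toAddMonoidHom.ker := by
        rw [← S.exact_zero_piece]; exact ⟨v, hv, rfl⟩
      exact this.1
    | succ i =>
      have : S.diff (i + 1) v ∈ shifted 𝒜 (S.shift (i + 1)) j ⊓ (S.diff i).toAddMonoidHom.ker := by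
        rw [← S.exact_succ_piece]; exact ⟨v, hv, rfl⟩
      exact this.1
  have haug' : ∀ j, (shifted 𝒜' (S.shift 0) j).map
      (symbolMap R' t (S.shift 0) S.aug).toAddMonoidHom = 𝒩' j := fun j => by
    ext y
    rw [ht.mem_iff]
    constructor
    · rintro ⟨v', hv', rfl⟩
      obtain ⟨v, hv, rfl⟩ := (hs.free _).mem_iff.mp hv'
      exact ⟨S.aug v, haug j v hv, (symbolMap_apply h𝒜 ht hst h𝒩 haug hv).symm⟩
    · rintro ⟨x, hx, rfl⟩
      rw [← S.aug_piece] at hx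
      obtain ⟨v, hv, rfl⟩ := hx
      exact ⟨freeSymbol s (S.shift 0) j v, (hs.free _).apply_mem hv,
        symbolMap_apply h𝒜 ht hst h𝒩 haug hv⟩
  have hzero : ∀ j, (shifted 𝒜' (S.shift 1) j).map
      (symbolMap R' (freeSymbol s (S.shift 0)) (S.shift 1) (S.diff 0)).toAddMonoidHom =
        shifted 𝒜' (S.shift 0) j ⊓ (symbolMap R' t (S.shift 0) S.aug).toAddMonoidHom.ker :=
    symbolMap_exact h𝒜 hs hss ht hst h𝒩 haug S.exact_zero_piece
      fun j _ _ hv => strict_of_map_eq hmono S.aug_piece j hv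
  have hsucc : ∀ i j, (shifted 𝒜' (S.shift (i + 2)) j).map
      (symbolMap R' (freeSymbol s (S.shift (i + 1))) (S.shift (i + 2))
        (S.diff (i + 1))).toAddMonoidHom =
      shifted 𝒜' (S.shift (i + 1)) j ⊓
        (symbolMap R' (freeSymbol s (S.shift i)) (S.shift (i + 1)) (S.diff i)).toAddMonoidHom.ker :=
    fun i => symbolMap_exact h𝒜 hs hss (hs.free _) (hss.free _) (Stable.gshift h𝒜 _) (hdiff i)
      (S.exact_succ_piece i) fun j v hv hx => by
        cases i with
        | zero =>
          refine strict_of_nice hmono S.exact_zero_piece ?_ j hv hx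
          rw [funext S.aug_piece]
          exact h𝒩nice
        | succ i =>
          refine strict_of_nice hmono (S.exact_succ_piece i) ?_ j hv hx
          cases i with
          | zero =>
            rw [funext S.exact_zero_piece]
            exact (hnice.shifted _).inf_const _
          | succ i =>
            rw [funext (S.exact_succ_piece i)]
            exact (hnice.shifted _).inf_const _
  { length := S.length
    rank := S.rank
    rank_eq_zero := S.rank_eq_zero
    shift := S.shift
    aug := symbolMap R' t (S.shift 0) S.aug
    diff := fun i => symbolMap R' (freeSymbol s (S.shift i)) (S.shift (i + 1)) (S.diff i)
    aug_surjective := fun y => by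
      obtain ⟨π, hπ⟩ := exists_isDecomposition h𝒩'
      obtain ⟨J, hJ⟩ := hπ.sum_eq y
      rw [← hJ J subset_rfl]
      change _ ∈ LinearMap.range _
      refine Submodule.sum_mem _ fun j _ => ?_
      have := hπ.mem j y
      rw [← haug'] at this
      obtain ⟨v, -, e⟩ := this
      exact ⟨v, e⟩
    exact_zero := by
      obtain ⟨π, hπ⟩ := exists_isDecomposition h𝒩'
      exact exact_of_graded h𝒜' hπ (fun j v hv => by rw [← haug']; exact ⟨v, hv, rfl⟩) hzero
    exact_succ := fun i => by
      obtain ⟨π, hπ⟩ := exists_isDecomposition_shifted h𝒜' (S.shift i)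
      refine exact_of_graded h𝒜' hπ (fun j v' hv' => ?_) (hsucc i)
      obtain ⟨v, hv, rfl⟩ := (hs.free _).mem_iff.mp hv'
      rw [symbolMap_apply h𝒜 (hs.free _) (hss.free _) (Stable.gshift h𝒜 _) (hdiff i) hv]
      exact (hs.free _).apply_mem (hdiff i j v hv)
    aug_piece := haug'
    exact_zero_piece := hzero
    exact_succ_piece := hsucc }

end Symbol

/-! ### Hilbert functions and the uniqueness of `K`-polynomials -/

section Rank

variable {C : Type*} [CommRing C] [IsDomain C]

/-- Rank-nullity for the restriction of a linear map to a submodule. -/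
theorem finrank_map_add_finrank_inf_ker {X Y : Type*} [AddCommGroup X] [AddCommGroup Y] [Module C X]
    [Module C Y] (f : X →ₗ[C] Y) (S : Submodule C X) [Module.Finite C S] :
    Module.finrank C S = Module.finrank C (S.map f) + Module.finrank C ↥(S ⊓ LinearMap.ker f) := by
  have h1 := Submodule.finrank_quotient_add_finrank (LinearMap.ker (f.domRestrict S))
  rw [(f.domRestrict S).quotKerEquivRange.finrank_eq, LinearMap.range_domRestrict] at h1
  rw [← h1]
  congr 1
  have e : (LinearMap.ker (f.domRestrict S)).map S.subtype = S ⊓ LinearMap.ker f := by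
    ext x
    simp only [Submodule.mem_map, LinearMap.mem_ker, Submodule.mem_inf]
    constructor
    · rintro ⟨x, hx, rfl⟩
      exact ⟨x.2, hx⟩
    · rintro ⟨hx, hx0⟩
      exact ⟨⟨x, hx⟩, hx0, rfl⟩
  rw [← e]
  exact (Submodule.equivMapOfInjective S.subtype S.injective_subtype _).finrank_eq

theorem finrank_pi_submodule {A : Type*} [AddCommGroup A] [Module C A] [IsNoetherianRing C] {r : ℕ}
    (P : Fin r → Submodule C A) [∀ l, Module.Finite C (P l)] :
    Module.Finite C (Submodule.pi Set.univ P) ∧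
      Module.finrank C (Submodule.pi Set.univ P) = ∑ l, Module.finrank C (P l) := by
  classical
  have hfin : Module.Finite C (Submodule.pi Set.univ P) := by
    let f : Submodule.pi Set.univ P →ₗ[C] (∀ l, P l) := LinearMap.pi fun l =>
      (LinearMap.proj l ∘ₗ (Submodule.pi Set.univ P).subtype).codRestrict (P l) fun v =>
        v.2 l (Set.mem_univ l)
    refine Module.Finite.of_injective f fun v w h => ?_
    ext l
    exact congrArg Subtype.val (congrFun h l)
  refine ⟨hfin, ?_⟩
  -- vectors supported on a set of indices, by induction on the set
  let S : Finset (Fin r) → Submodule C (Fin r → A) := fun T =>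
    Submodule.pi Set.univ fun l => if l ∈ T then P l else ⊥
  have hS : ∀ T, S T ≤ Submodule.pi Set.univ P := fun T v hv l _ => by
    have := hv l (Set.mem_univ l)
    beta_reduce at this
    split_ifs at this with h
    · exact this
    · rw [(Submodule.mem_bot C).mp this]; exact zero_mem _
  have key : ∀ T, Module.finrank C (S T) = ∑ l ∈ T, Module.finrank C (P l) := by
    intro T
    induction T using Finset.induction_on with
    | empty =>
      have : S ∅ = ⊥ := by
        rw [eq_bot_iff]
        intro v hv
        ext l
        simpa using hv l (Set.mem_univ l)
      rw [this, finrank_bot, Finset.sum_empty]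
    | insert a T ha ih =>
      have : Module.Finite C (S (insert a T)) :=
        Module.Finite.of_injective _ (Submodule.inclusion_injective (hS _))
      have e1 : (S (insert a T)).map (LinearMap.proj a) = P a := by
        ext x
        constructor
        · rintro ⟨v, hv, rfl⟩
          simpa using hv a (Set.mem_univ a)
        · intro hx
          refine ⟨Pi.single a x, fun l _ => ?_, by simp⟩
          by_cases hl : l = a
          · subst hl; simpa using hx
          · simp [hl, zero_mem]
      have e2 : S (insert a T) ⊓ LinearMap.ker (LinearMap.proj a) = S T := by
        ext v
        constructor
        · rintro ⟨hv, hv0⟩ l -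
          have := hv l (Set.mem_univ l)
          by_cases hl : l = a
          · subst hl
            have hv0 : v l = 0 := hv0
            rw [hv0]; exact zero_mem _
          · simpa [hl] using this
        · intro hv
          refine ⟨fun l _ => ?_, ?_⟩
          · have hvl := hv l (Set.mem_univ l)
            by_cases hl : l = a
            · subst hl
              have hl0 : v l = 0 := by simpa [ha] using hvl
              rw [hl0]; exact zero_mem _
            · simpa [hl] using hvl
          · have hl0 : v a = 0 := by simpa [ha] using hv a (Set.mem_univ a)
            exact hl0
      rw [finrank_map_add_finrank_inf_ker (LinearMap.proj a), e1, e2, Finset.sum_insert ha, ih]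
  have e : S Finset.univ = Submodule.pi Set.univ P := by simp [S]
  rw [← e]
  exact key Finset.univ

end Rank

section Uniqueness

/-- The value in degree `j` of the Hilbert function `∑ K_b H(· - b)` of a graded module with
`K`-polynomial `K`, where `H` is the Hilbert function of the ring. -/
noncomputable def hilbertValue (H : ℤ × ℤ → ℤ) (j : ℤ × ℤ) : AddMonoidAlgebra ℤ (ℤ × ℤ) →+ ℤ :=
  (Finsupp.liftAddHom fun b => AddMonoidHom.mulRight (H (j - b))).comp
    (AddMonoidAlgebra.coeffAddEquiv).toAddMonoidHom

theorem hilbertValue_single (H : ℤ × ℤ → ℤ) (j b : ℤ × ℤ) (c : ℤ) :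
    hilbertValue H j (AddMonoidAlgebra.single b c) = c * H (j - b) := by
  simp [hilbertValue]

theorem hilbertValue_eq_sum (H : ℤ × ℤ → ℤ) (j : ℤ × ℤ) (K : AddMonoidAlgebra ℤ (ℤ × ℤ)) :
    hilbertValue H j K = ∑ b ∈ K.coeff.support, K.coeff b * H (j - b) := by
  simp [hilbertValue, Finsupp.sum]

/-- A Laurent polynomial is determined by its Hilbert function, if the support of the Hilbert
function of the ring is nonnegative for the lexicographic order by `d`, then by `-k`. -/
theorem eq_zero_of_hilbertValue {H : ℤ × ℤ → ℤ} (h0 : H 0 ≠ 0)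
    (hH : ∀ j, H j ≠ 0 → 0 ≤ j.1 ∧ (j.1 = 0 → j.2 ≤ 0)) {K : AddMonoidAlgebra ℤ (ℤ × ℤ)}
    (hK : ∀ j, hilbertValue H j K = 0) : K = 0 := by
  have key : K.coeff = 0 := by
    by_contra hne
    obtain ⟨b, hb, hmin⟩ := Finset.exists_min_image K.coeff.support
      (fun b => (toLex (b.1, -b.2) : ℤ ×ₗ ℤ)) (Finsupp.support_nonempty_iff.mpr hne)
    have h := hK b
    rw [hilbertValue_eq_sum, Finset.sum_eq_single_of_mem b hb] at h
    · rw [sub_self] at h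
      exact mul_ne_zero (Finsupp.mem_support_iff.mp hb) h0 h
    · intro b' hb' hne'
      by_contra hz
      obtain ⟨h1, h2⟩ := hH _ (right_ne_zero_of_mul hz)
      have h3 := hmin b' hb'
      rw [Prod.Lex.le_iff] at h3
      simp at h1 h2 h3
      apply hne'
      ext <;> omega
  exact AddMonoidAlgebra.coeffAddEquiv.injective (key.trans (map_zero _).symm)

variable {C : Type*} [CommRing C] [IsDomain C] [IsNoetherianRing C] {A : Type*} [Ring A]
  [Module C A] [IsScalarTower C A A] {N : Type*} [AddCommGroup N] [Module A N] [Module C N]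
  [IsScalarTower C A N] {𝒜 : ℤ × ℤ → AddSubgroup A} {𝒩 : ℤ × ℤ → AddSubgroup N}

/-- The `K`-polynomial of a free resolution determines the ranks of the graded pieces of the resolved
module over a commutative ring `C` which respects the degrees, if the graded pieces of the ring are
finitely generated over `C`. -/
theorem FreeResolution.hilbertValue_kPoly (R : FreeResolution 𝒜 𝒩) (P : ℤ × ℤ → Submodule C A)
    [∀ j, Module.Finite C (P j)] (hP : ∀ j x, x ∈ P j ↔ x ∈ 𝒜 j) (j : ℤ × ℤ) :
    hilbertValue (fun i => Module.finrank C (P i)) j R.kPoly = Module.finrank C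
      ((Submodule.pi Set.univ fun l => P (j - R.shift 0 l)).map (R.aug.restrictScalars C)) := by
  let S : ∀ i, Submodule C (Fin (R.rank i) → A) := fun i =>
    Submodule.pi Set.univ fun l => P (j - R.shift i l)
  have hS : ∀ i v, v ∈ S i ↔ v ∈ shifted 𝒜 (R.shift i) j := fun i v => by
    simp [S, mem_shifted, hP]
  have hfin : ∀ i, Module.Finite C (S i) := fun i => (finrank_pi_submodule _).1
  -- the ranks of the modules of cycles
  let z : ℕ → ℤ := fun i => match i with
    | 0 => Module.finrank C ↥(S 0 ⊓ LinearMap.ker (R.aug.restrictScalars C))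
    | i + 1 => Module.finrank C ↥(S (i + 1) ⊓ LinearMap.ker ((R.diff i).restrictScalars C))
  have hz : ∀ i, (Module.finrank C (S (i + 1)) : ℤ) = z i + z (i + 1) := by
    intro i
    have e : (Module.finrank C ((S (i + 1)).map ((R.diff i).restrictScalars C)) : ℤ) = z i := by
      cases i with
      | zero =>
        have : (S 1).map ((R.diff 0).restrictScalars C) =
            S 0 ⊓ LinearMap.ker (R.aug.restrictScalars C) := by
          ext v
          have := SetLike.ext_iff.mp (R.exact_zero_piece j) v
          simpa [hS] using this
        change (Module.finrank C ((S 1).map ((R.diff 0).restrictScalars C)) : ℤ) = _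
        rw [this]
      | succ i =>
        have : (S (i + 2)).map ((R.diff (i + 1)).restrictScalars C) =
            S (i + 1) ⊓ LinearMap.ker ((R.diff i).restrictScalars C) := by
          ext v
          have := SetLike.ext_iff.mp (R.exact_succ_piece i j) v
          simpa [hS] using this
        change (Module.finrank C ((S (i + 2)).map ((R.diff (i + 1)).restrictScalars C)) : ℤ) = _
        rw [this]
    rw [finrank_map_add_finrank_inf_ker ((R.diff i).restrictScalars C) (S (i + 1)), ← e]
    push_cast
    rfl
  have hz0 : (Module.finrank C (S 0) : ℤ) =
      Module.finrank C ((S 0).map (R.aug.restrictScalars C)) + z 0 := by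
    rw [finrank_map_add_finrank_inf_ker (R.aug.restrictScalars C) (S 0)]
    push_cast
    rfl
  have hsum : ∀ m, ∑ i ∈ Finset.range (m + 1), (-1) ^ i * (Module.finrank C (S i) : ℤ) =
      Module.finrank C ((S 0).map (R.aug.restrictScalars C)) + (-1) ^ m * z m := by
    intro m
    induction m with
    | zero => simp [hz0]
    | succ m ih => rw [Finset.sum_range_succ, ih, hz]; ring
  have hzl : z (R.length + 1) = 0 := by
    have : IsEmpty (Fin (R.rank (R.length + 1))) := by
      rw [R.rank_eq_zero _ (Nat.lt_succ_self _)]; infer_instance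
    change (Module.finrank C ↥(S (R.length + 1) ⊓ _) : ℤ) = 0
    rw [Nat.cast_eq_zero]
    exact Module.finrank_zero_of_subsingleton
  have hrl : Module.finrank C (S (R.length + 1)) = 0 := by
    have : IsEmpty (Fin (R.rank (R.length + 1))) := by
      rw [R.rank_eq_zero _ (Nat.lt_succ_self _)]; infer_instance
    exact Module.finrank_zero_of_subsingleton
  have hl := hsum (R.length + 1)
  rw [hzl, mul_zero, add_zero, Finset.sum_range_succ, hrl, Nat.cast_zero, mul_zero, add_zero] at hl
  refine Eq.trans ?_ hl
  rw [FreeResolution.kPoly, map_sum]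
  refine Finset.sum_congr rfl fun i _ => ?_
  have e : ∀ x : AddMonoidAlgebra ℤ (ℤ × ℤ), (-1) ^ i * x = ((-1 : ℤ) ^ i) • x := fun x => by
    rw [zsmul_eq_mul]; push_cast; rfl
  rw [e, map_zsmul, smul_eq_mul, map_sum, (finrank_pi_submodule _).2, Nat.cast_sum]
  simp [hilbertValue_single]

/-- The `K`-polynomial does not depend on the resolution. -/
theorem FreeResolution.kPoly_unique (P : ℤ × ℤ → Submodule C A)
    [∀ j, Module.Finite C (P j)] (hP : ∀ j x, x ∈ P j ↔ x ∈ 𝒜 j)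
    (h0 : Module.finrank C (P 0) ≠ 0)
    (hH : ∀ j, P j ≠ ⊥ → 0 ≤ j.1 ∧ (j.1 = 0 → j.2 ≤ 0))
    (R R' : FreeResolution 𝒜 𝒩) : R.kPoly = R'.kPoly := by
  rw [← sub_eq_zero]
  refine eq_zero_of_hilbertValue (H := fun i => Module.finrank C (P i)) (by exact_mod_cast h0)
    (fun j hj => hH j fun h => hj ?_) fun j => ?_
  · rw [h, finrank_bot, Nat.cast_zero]
  · have e : ∀ R : FreeResolution 𝒜 𝒩, ∀ x, x ∈ (Submodule.pi Set.univ fun l =>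
        P (j - R.shift 0 l)).map (R.aug.restrictScalars C) ↔ x ∈ 𝒩 j := by
      intro R x
      rw [← R.aug_piece j]
      simp [mem_shifted, hP]
    rw [map_sub, R.hilbertValue_kPoly P hP, R'.hilbertValue_kPoly P hP, sub_eq_zero]
    rw [SetLike.ext fun x => (e R x).trans (e R' x).symm]

end Uniqueness
/-! ### Ranks over the polynomials in `x_1, …, x_n` -/

section Coefficients

variable {n p : ℕ}

theorem fvWt_apply (γ : (Fin n ⊕ Fin p → ℕ) × (Fin n ⊕ Fin p → ℕ)) : fvWt n p γ =
    (((∑ i, γ.2 i : ℕ) : ℤ),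
      ((∑ i, γ.2 (Sum.inr i) : ℕ) : ℤ) - ((∑ i, γ.1 (Sum.inr i) : ℕ) : ℤ)) := by
  ext
  · simp [fvWt, Weyl.wt, Prod.fst_sum]
  · simp [fvWt, Weyl.wt, Prod.snd_sum]
    ring

theorem mon_mem_FV {γ : (Fin n ⊕ Fin p → ℕ) × (Fin n ⊕ Fin p → ℕ)} {j : ℤ × ℤ}
    (h : fvWt n p γ ≤ j) : Weyl.mon γ ∈ FV n p j := by
  refine mem_FV.mpr fun δ hδ => ?_
  rw [← Weyl.basis_apply, Module.Basis.repr_self] at hδ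
  rwa [← (Finsupp.single_apply_ne_zero.mp hδ).1] at h

theorem smul_mem_FV {j : ℤ × ℤ} (c : ℂ) {P : D n p} (hP : P ∈ FV n p j) : c • P ∈ FV n p j :=
  Submodule.smul_mem (FFil n p j.1 ⊓ VFil n p j.2) c hP

theorem smul_mem_biLt_FV {j : ℤ × ℤ} (c : ℂ) {P : D n p} (hP : P ∈ biLt (FV n p) j) :
    c • P ∈ biLt (FV n p) j := by
  obtain ⟨x, hx, y, hy, rfl⟩ := AddSubgroup.mem_sup.mp hP
  rw [smul_add]
  exact AddSubgroup.add_mem_sup (smul_mem_FV c hx) (smul_mem_FV c hy)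

theorem mem_biLt_FV {j : ℤ × ℤ} {P : D n p} :
    P ∈ biLt (FV n p) j ↔ ∀ γ, (Weyl.basis _).repr P γ ≠ 0 → fvWt n p γ < j := by
  constructor
  · intro hP γ hγ
    obtain ⟨x, hx, y, hy, rfl⟩ := AddSubgroup.mem_sup.mp hP
    rw [map_add, Finsupp.add_apply] at hγ
    by_cases h : (Weyl.basis _).repr x γ = 0
    · rw [h, zero_add] at hγ
      exact (mem_FV.mp hy γ hγ).trans_lt (Prod.mk_lt_mk.mpr (Or.inr ⟨le_rfl, by simp⟩))
    · exact (mem_FV.mp hx γ h).trans_lt (Prod.mk_lt_mk.mpr (Or.inl ⟨by simp, le_rfl⟩))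
  · intro h
    rw [← (Weyl.basis _).linearCombination_repr P, Finsupp.linearCombination_apply]
    refine sum_mem fun γ hγ => smul_mem_biLt_FV _ ?_
    rw [Weyl.basis_apply]
    rcases Prod.lt_iff.mp (h γ (Finsupp.mem_support_iff.mp hγ)) with h | h
    · exact AddSubgroup.mem_sup_left (mon_mem_FV ⟨by have := h.1; simp; omega, h.2⟩)
    · exact AddSubgroup.mem_sup_right (mon_mem_FV ⟨h.1, by have := h.2; simp; omega⟩)

/-- The operators of multiplication by the polynomials in `x_1, …, x_n`. -/
noncomputable def embX (n p : ℕ) : MvPolynomial (Fin n) ℂ →ₐ[ℂ] D n p :=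
  AlgHom.codRestrict ((Algebra.lmul ℂ (MvPolynomial (Fin n ⊕ Fin p) ℂ)).comp
    (MvPolynomial.rename Sum.inl)) (weylSubalgebra _) fun f => by
      induction f using MvPolynomial.induction_on with
      | C a => rw [← MvPolynomial.algebraMap_eq, AlgHom.commutes]; exact algebraMap_mem _ _
      | add f g hf hg => rw [map_add]; exact add_mem hf hg
      | mul_X f i hf =>
        rw [map_mul]
        refine mul_mem hf ?_
        rw [AlgHom.comp_apply, MvPolynomial.rename_X]
        exact Algebra.subset_adjoin (Or.inl ⟨_, rfl⟩)

theorem toEnd_embX (f : MvPolynomial (Fin n) ℂ) (g : MvPolynomial (Fin n ⊕ Fin p) ℂ) :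
    Weyl.toEnd _ (embX n p f) g = MvPolynomial.rename Sum.inl f * g := rfl

theorem embX_monomial_mul_mon (m : Fin n →₀ ℕ)
    (γ : (Fin n ⊕ Fin p → ℕ) × (Fin n ⊕ Fin p → ℕ)) :
    embX n p (MvPolynomial.monomial m 1) * Weyl.mon γ =
      Weyl.mon (γ + (Sum.elim m 0, 0)) := by
  have e : embX n p (MvPolynomial.monomial m 1) * Weyl.xPow γ.1 =
      Weyl.xPow (γ.1 + Sum.elim m 0) := by
    apply Weyl.toEnd_injective
    refine LinearMap.ext fun g => ?_
    rw [map_mul, Module.End.mul_apply, toEnd_embX, Weyl.xPow_apply, Weyl.xPow_apply,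
      MvPolynomial.rename_monomial, ← mul_assoc, MvPolynomial.monomial_mul, one_mul]
    congr 3
    ext (i | i)
    · simp [Finsupp.mapDomain_apply Sum.inl_injective, add_comm]
    · simp [Finsupp.mapDomain_of_notMem_range]
  rw [Weyl.mon, Weyl.mon, ← mul_assoc, Prod.fst_add, Prod.snd_add, e, add_zero]

theorem embX_mem (f : MvPolynomial (Fin n) ℂ) : embX n p f ∈ FV n p 0 := by
  induction f using MvPolynomial.induction_on' with
  | monomial m a =>
    rw [← mul_one a, ← smul_eq_mul, ← MvPolynomial.smul_monomial, map_smul]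
    refine smul_mem_FV a ?_
    have := embX_monomial_mul_mon m (0 : (Fin n ⊕ Fin p → ℕ) × (Fin n ⊕ Fin p → ℕ))
    rw [Weyl.mon_zero, mul_one, zero_add] at this
    rw [this]
    refine mon_mem_FV ?_
    rw [fvWt_apply]
    simp [Prod.le_def]
  | add f g hf hg => rw [map_add]; exact add_mem hf hg

theorem repr_embX (f : MvPolynomial (Fin n) ℂ) (m : Fin n →₀ ℕ) :
    (Weyl.basis _).repr (embX n p f) (Sum.elim m 0, 0) = f.coeff m := by
  classical
  induction f using MvPolynomial.induction_on' with
  | monomial k a =>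
    have := embX_monomial_mul_mon k (0 : (Fin n ⊕ Fin p → ℕ) × (Fin n ⊕ Fin p → ℕ))
    rw [Weyl.mon_zero, mul_one, zero_add, ← Weyl.basis_apply] at this
    rw [← mul_one a, ← smul_eq_mul, ← MvPolynomial.smul_monomial, map_smul, this, map_smul,
      Module.Basis.repr_self, Finsupp.smul_apply, MvPolynomial.coeff_smul,
      MvPolynomial.coeff_monomial, Finsupp.single_apply]
    congr 2
    rw [eq_iff_iff]
    refine ⟨fun h => ?_, fun h => by rw [h]⟩
    ext i
    exact congrFun (congrArg Prod.fst h) (Sum.inl i)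
  | add f g hf hg => rw [map_add, map_add, Finsupp.add_apply, hf, hg, MvPolynomial.coeff_add]

theorem embX_mem_biLt {f : MvPolynomial (Fin n) ℂ} (h : embX n p f ∈ biLt (FV n p) 0) : f = 0 := by
  ext m
  rw [← repr_embX (p := p), MvPolynomial.coeff_zero]
  by_contra hne
  refine (mem_biLt_FV.mp h _ hne).ne ?_
  rw [fvWt_apply]
  simp

/-- The exponents of bidegree `j` without the variables `x_1, …, x_n`. -/
def genExponents (n p : ℕ) (j : ℤ × ℤ) : Set ((Fin n ⊕ Fin p → ℕ) × (Fin n ⊕ Fin p → ℕ)) :=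
  {γ | (∀ i, γ.1 (Sum.inl i) = 0) ∧ fvWt n p γ = j}

theorem finite_genExponents (j : ℤ × ℤ) : (genExponents n p j).Finite := by
  classical
  refine (Set.finite_Icc 0 ((fun _ => (j.1 - j.2).toNat, fun _ => j.1.toNat) :
    (Fin n ⊕ Fin p → ℕ) × (Fin n ⊕ Fin p → ℕ))).subset ?_
  rintro γ ⟨h0, hγ⟩
  rw [fvWt_apply] at hγ
  have h1 := congrArg Prod.fst hγ
  have h2 := congrArg Prod.snd hγ
  simp only [] at h1 h2
  have h3 : ∑ i, γ.2 (Sum.inr i) ≤ ∑ i, γ.2 i := by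
    rw [Fintype.sum_sum_type]; exact Nat.le_add_left _ _
  refine ⟨⟨fun i => Nat.zero_le _, fun i => Nat.zero_le _⟩, ?_, fun i => ?_⟩
  · rintro (i | i)
    · change γ.1 _ ≤ _
      rw [h0]; exact Nat.zero_le _
    · have := Finset.single_le_sum (f := fun i => γ.1 (Sum.inr i)) (fun _ _ => Nat.zero_le _)
        (Finset.mem_univ i)
      change γ.1 _ ≤ (j.1 - j.2).toNat
      beta_reduce at this
      omega
  · have := Finset.single_le_sum (f := γ.2) (fun _ _ => Nat.zero_le _) (Finset.mem_univ i)
    change γ.2 _ ≤ j.1.toNat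
    omega

theorem exists_eq_embX_mul (γ : (Fin n ⊕ Fin p → ℕ) × (Fin n ⊕ Fin p → ℕ)) :
    ∃ m, ∃ δ ∈ genExponents n p (fvWt n p γ),
      Weyl.mon γ = embX n p (MvPolynomial.monomial m 1) * Weyl.mon δ := by
  refine ⟨Finsupp.equivFunOnFinite.symm fun i => γ.1 (Sum.inl i),
    (Sum.elim 0 fun i => γ.1 (Sum.inr i), γ.2), ⟨fun i => rfl, ?_⟩, ?_⟩
  · rw [fvWt_apply, fvWt_apply]
    simp
  · rw [embX_monomial_mul_mon]
    congr 1
    ext (i | i) <;> simp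

end Coefficients

section SymbolUnique

variable {n p : ℕ} {A : Type*} [Ring A] {N : Type*} [AddCommGroup N] [Module A N]
  {𝒜 : ℤ × ℤ → AddSubgroup A} {𝒩 : ℤ × ℤ → AddSubgroup N} {s : ℤ × ℤ → D n p → A}

/-- The polynomials in `x_1, …, x_n`, as elements of degree zero of the associated graded ring. -/
noncomputable def symbolX (hs : IsSymbol (FV n p) 𝒜 s)
    (hss : SymbolSMul (FV n p) (FV n p) s s) (h1 : s 0 1 = 1) : MvPolynomial (Fin n) ℂ →+* A where
  toFun f := s 0 (embX n p f)
  map_one' := by rw [map_one, h1]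
  map_mul' f g := by
    have := hss (embX_mem (p := p) f) (embX_mem (p := p) g)
    rwa [add_zero, smul_eq_mul, smul_eq_mul, ← map_mul] at this
  map_zero' := by rw [map_zero, hs.map_zero]
  map_add' f g := by rw [map_add, hs.map_add (embX_mem f) (embX_mem g)]

/-- Free resolutions over the associated graded ring of `D` have the same `K`-polynomial if they
resolve the same module: the graded pieces of the ring are finitely generated over
`ℂ[x_1, …, x_n]`, so that ranks over this polynomial ring can be compared. -/
theorem kPoly_unique_of_isSymbol (hs : IsSymbol (FV n p) 𝒜 s)
    (hss : SymbolSMul (FV n p) (FV n p) s s) (h1 : s 0 1 = 1) (R R' : FreeResolution 𝒜 𝒩) :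
    R.kPoly = R'.kPoly := by
  let ρ := symbolX hs hss h1
  let _ : Module (MvPolynomial (Fin n) ℂ) A := Module.compHom A ρ
  let _ : Module (MvPolynomial (Fin n) ℂ) N := Module.compHom N ρ
  have : IsScalarTower (MvPolynomial (Fin n) ℂ) A A := ⟨fun c a b => mul_assoc (ρ c) a b⟩
  have : IsScalarTower (MvPolynomial (Fin n) ℂ) A N := ⟨fun c a b => mul_smul (ρ c) a b⟩
  have hsmul : ∀ (f : MvPolynomial (Fin n) ℂ) {j : ℤ × ℤ} {P : D n p}, P ∈ FV n p j →
      f • s j P = s j (embX n p f * P) := fun f j P hP => by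
    have := hss (embX_mem (p := p) f) hP
    rw [zero_add] at this
    exact this.symm
  let P : ℤ × ℤ → Submodule (MvPolynomial (Fin n) ℂ) A := fun j =>
    { 𝒜 j with
      smul_mem' := fun f y hy => by
        obtain ⟨x, hx, rfl⟩ := hs.mem_iff.mp hy
        rw [hsmul f hx]
        refine hs.apply_mem ?_
        have := isMulFamily_FV.mul_mem (embX_mem (p := p) f) hx
        rwa [zero_add] at this }
  have hP : ∀ j x, x ∈ P j ↔ x ∈ 𝒜 j := fun j x => Iff.rfl
  have hfin : ∀ j, Module.Finite (MvPolynomial (Fin n) ℂ) (P j) := by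
    intro j
    rw [Module.Finite.iff_fg]
    refine Submodule.fg_def.mpr ⟨(fun γ => s j (Weyl.mon γ)) '' genExponents n p j,
      (finite_genExponents j).image _, le_antisymm (Submodule.span_le.mpr ?_) fun y hy => ?_⟩
    · rintro _ ⟨γ, hγ, rfl⟩
      exact hs.apply_mem (mon_mem_FV hγ.2.le)
    · obtain ⟨x, hx, rfl⟩ := hs.mem_iff.mp hy
      have hmem : ∀ γ ∈ ((Weyl.basis _).repr x).support,
          (Weyl.basis _).repr x γ • Weyl.mon γ ∈ FV n p j := fun γ hγ =>
        smul_mem_FV _ (mon_mem_FV (mem_FV.mp hx γ (Finsupp.mem_support_iff.mp hγ)))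
      rw [← (Weyl.basis _).linearCombination_repr x, Finsupp.linearCombination_apply,
        Finsupp.sum]
      simp only [Weyl.basis_apply]
      rw [hs.map_sum _ hmem]
      refine sum_mem fun γ hγ => ?_
      have hle := mem_FV.mp hx γ (Finsupp.mem_support_iff.mp hγ)
      rcases hle.eq_or_lt with h | h
      · obtain ⟨m, δ, hδ, e⟩ := exists_eq_embX_mul γ
        rw [h] at hδ
        rw [e, ← smul_mul_assoc, ← map_smul, ← hsmul _ (mon_mem_FV hδ.2.le)]
        exact Submodule.smul_mem _ _ (Submodule.subset_span ⟨δ, hδ, rfl⟩)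
      · have h0 : (Weyl.basis _).repr x γ • Weyl.mon γ ∈ biLt (FV n p) j := by
          refine smul_mem_biLt_FV _ (mem_biLt_FV.mpr fun δ hδ => ?_)
          rw [← Weyl.basis_apply, Module.Basis.repr_self] at hδ
          rwa [(Finsupp.single_apply_ne_zero.mp hδ).1]
        rw [(hs.eq_zero_iff (hmem γ hγ)).mpr h0]
        exact zero_mem _
  refine FreeResolution.kPoly_unique P hP ?_ (fun j hj => ?_) R R'
  · -- the polynomials themselves span a free submodule of rank one in degree zero
    let f : MvPolynomial (Fin n) ℂ →ₗ[MvPolynomial (Fin n) ℂ] P 0 :=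
      { toFun := fun f => ⟨ρ f, hs.apply_mem (embX_mem f)⟩
        map_add' := fun f g => Subtype.ext (map_add ρ f g)
        map_smul' := fun f g => Subtype.ext (map_mul ρ f g) }
    have hf : Function.Injective f := by
      refine (injective_iff_map_eq_zero f).mpr fun g hg => ?_
      have h0 : s 0 (embX n p g) = 0 := congrArg Subtype.val hg
      exact embX_mem_biLt ((hs.eq_zero_iff (embX_mem g)).mp h0)
    have := LinearMap.finrank_le_finrank_of_injective hf
    rw [Module.finrank_self] at this
    omega
  · obtain ⟨y, hy, hy0⟩ := Submodule.exists_mem_ne_zero_of_ne_bot hj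
    obtain ⟨x, hx, rfl⟩ := hs.mem_iff.mp hy
    have hx0 : x ∉ biLt (FV n p) j := fun h => hy0 ((hs.eq_zero_iff hx).mpr h)
    rw [mem_biLt_FV] at hx0
    push Not at hx0
    obtain ⟨γ, hγ, hlt⟩ := hx0
    have e : fvWt n p γ = j := by
      by_contra hne
      exact hlt (lt_of_le_of_ne (mem_FV.mp hx γ hγ) hne)
    have h3 : ∑ i, γ.2 (Sum.inr i) ≤ ∑ i, γ.2 i := by
      rw [Fintype.sum_sum_type]; exact Nat.le_add_left _ _
    rw [← e, fvWt_apply]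
    simp only
    omega

end SymbolUnique

/-! ### The associated graded modules `bigr` and `gr^L` -/

open DirectSum

section Refinement

variable {ι : Type*} [AddCommGroup ι] [PartialOrder ι] [IsOrderedAddMonoid ι] [DecidableEq ι]

open Classical in
/-- The class of `a` in the component `Φ i / Φ_{<i}` of the associated graded group; zero if
`a` is not in `Φ i`. -/
noncomputable def grSymbol {A : Type*} [AddCommGroup A] (Φ Φlt : ι → AddSubgroup A) (i : ι)
    (a : A) : Gr Φ Φlt :=
  if h : a ∈ Φ i then DirectSum.of (GrPiece Φ Φlt) i (GrPiece.mk Φ Φlt i ⟨a, h⟩) else 0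

theorem grSymbol_of_mem {A : Type*} [AddCommGroup A] {Φ Φlt : ι → AddSubgroup A} {i : ι}
    {a : A} (h : a ∈ Φ i) : grSymbol Φ Φlt i a =
      DirectSum.of (GrPiece Φ Φlt) i (GrPiece.mk Φ Φlt i ⟨a, h⟩) := dif_pos h

theorem GrPiece.mk_eq_zero {A : Type*} [AddCommGroup A] {Φ Φlt : ι → AddSubgroup A} {i : ι}
    {a : Φ i} : GrPiece.mk Φ Φlt i a = 0 ↔ (a : A) ∈ Φlt i :=
  QuotientAddGroup.eq_zero_iff _

theorem grSymbol_smul {A M : Type*} [Ring A] [AddCommGroup M] [Module A M]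
    {Φ Φlt : ι → AddSubgroup A} [IsRingFiltration Φ Φlt] {Γ Γlt : ι → AddSubgroup M}
    [IsModuleFiltration Φ Φlt Γ Γlt] {i j k : ι} (hk : k = i + j) {a : A} {m : M} (ha : a ∈ Φ i)
    (hm : m ∈ Γ j) : grSymbol Γ Γlt k (a • m) = grSymbol Φ Φlt i a • grSymbol Γ Γlt j m := by
  subst hk
  have h : a • m ∈ Γ (i + j) := SetLike.GradedSMul.smul_mem (A := Φ) (B := Γ) ha hm
  rw [grSymbol_of_mem ha, grSymbol_of_mem hm, grSymbol_of_mem h, DirectSum.Gmodule.of_smul_of]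
  rfl

theorem grSymbol_mul {A : Type*} [Ring A] {Φ Φlt : ι → AddSubgroup A} [IsRingFiltration Φ Φlt]
    {i j k : ι} (hk : k = i + j) {a b : A} (ha : a ∈ Φ i) (hb : b ∈ Φ j) :
    grSymbol Φ Φlt k (a * b) = grSymbol Φ Φlt i a * grSymbol Φ Φlt j b := by
  subst hk
  rw [grSymbol_of_mem ha, grSymbol_of_mem hb, DirectSum.of_mul_of,
    grSymbol_of_mem (SetLike.GradedMul.mul_mem ha hb)]
  rfl

/-- The images of the subgroups `F j` in the associated graded group of `Φ` identify it with the
bigraded group associated to `F`; the image of `F j` lies in the component of index `deg j`. -/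
structure IsRefinement {A : Type*} [AddCommGroup A] (F : ℤ × ℤ → AddSubgroup A)
    (Φ Φlt : ι → AddSubgroup A) (deg : ℤ × ℤ →+ ι) : Prop where
  le : ∀ j, F j ≤ Φ (deg j)
  biLt_le : ∀ j, biLt F j ≤ Φlt (deg j)
  le_sup : ∀ i, Φ i ≤ Φlt i ⊔ ⨆ (j : ℤ × ℤ) (_ : deg j = i), F j
  indep : ∀ (i : ι) (J : Finset (ℤ × ℤ)) (x : ℤ × ℤ → A), (∀ j ∈ J, deg j = i ∧ x j ∈ F j) →
    ∑ j ∈ J, x j ∈ Φlt i → ∀ j ∈ J, x j ∈ biLt F j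

variable {A : Type*} [AddCommGroup A] {F : ℤ × ℤ → AddSubgroup A} {Φ Φlt : ι → AddSubgroup A}
  {deg : ℤ × ℤ →+ ι}

theorem IsRefinement.isSymbol (h : IsRefinement F Φ Φlt deg) :
    IsSymbol F (fun j => symbols Φ Φlt (deg j) (F j)) fun j => grSymbol Φ Φlt (deg j) where
  map_add {j x x'} hx hx' := by
    rw [grSymbol_of_mem (h.le j hx), grSymbol_of_mem (h.le j hx'),
      grSymbol_of_mem (h.le j (add_mem hx hx')), ← map_add, ← map_add]
    rfl
  eq_zero_iff {j x} hx := by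
    rw [grSymbol_of_mem (h.le j hx), map_eq_zero_iff _ (DirectSum.of_injective _),
      GrPiece.mk_eq_zero]
    exact ⟨fun hx0 => h.indep (deg j) {j} (fun _ => x) (by simp [hx]) (by simpa using hx0) j
      (Finset.mem_singleton_self j), fun hx0 => h.biLt_le j hx0⟩
  mem_iff {j y} := by
    constructor
    · rintro ⟨_, ⟨x, hx, rfl⟩, rfl⟩
      exact ⟨x, hx, grSymbol_of_mem x.2⟩
    · rintro ⟨x, hx, rfl⟩
      exact ⟨_, ⟨⟨x, h.le j hx⟩, hx, rfl⟩, (grSymbol_of_mem _).symm⟩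

theorem IsRefinement.isInternal (h : IsRefinement F Φ Φlt deg) (hΦ : ∀ i, Φlt i ≤ Φ i) :
    DirectSum.IsInternal fun j => symbols Φ Φlt (deg j) (F j) := by
  classical
  have hs := h.isSymbol
  constructor
  · refine (injective_iff_map_eq_zero _).mpr fun f hf => ?_
    choose x hx e using fun j => hs.mem_iff.mp (f j).2
    rw [DirectSum.coeAddMonoidHom_eq_dfinsuppSum, DFinsupp.sum] at hf
    refine DFinsupp.ext fun j => Subtype.ext ?_
    by_cases hj : j ∈ f.support
    · rw [← e j]
      refine (hs.eq_zero_iff (hx j)).mpr ?_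
      refine h.indep (deg j) (f.support.filter fun i => deg i = deg j) x (fun i hi =>
        ⟨(Finset.mem_filter.mp hi).2, hx i⟩) ?_ j (Finset.mem_filter.mpr ⟨hj, rfl⟩)
      -- the component of index `deg j` of the sum
      have hc := congrArg (DFinsupp.evalAddMonoidHom (β := GrPiece Φ Φlt) (deg j)) hf
      rw [map_sum, map_zero] at hc
      have hmem : ∀ i ∈ f.support.filter (fun i => deg i = deg j), x i ∈ Φ (deg j) :=
        fun i hi => (Finset.mem_filter.mp hi).2 ▸ h.le i (hx i)
      have hval : ∀ i ∈ f.support,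
          DFinsupp.evalAddMonoidHom (β := GrPiece Φ Φlt) (deg j) (f i : Gr Φ Φlt) =
            if hi : deg i = deg j then
          GrPiece.mk Φ Φlt (deg j) ⟨x i, hi ▸ h.le i (hx i)⟩ else 0 := by
        intro i _
        rw [← e i, grSymbol_of_mem (h.le i (hx i))]
        change DirectSum.of (GrPiece Φ Φlt) (deg i) _ (deg j) = _
        split_ifs with hi
        · have : DirectSum.of (GrPiece Φ Φlt) (deg i) (GrPiece.mk Φ Φlt (deg i) ⟨x i, h.le i (hx i)⟩)
              = DirectSum.of (GrPiece Φ Φlt) (deg j) (GrPiece.mk Φ Φlt (deg j)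
                ⟨x i, hi ▸ h.le i (hx i)⟩) :=
            DirectSum.of_eq_of_gradedMonoid_eq (GrPiece.sigma_ext hi rfl)
          rw [this, DirectSum.of_eq_same]
        · exact DirectSum.of_eq_of_ne _ _ _ (Ne.symm hi)
      have hsum : (⟨∑ i ∈ f.support.filter fun i => deg i = deg j, x i, sum_mem hmem⟩ : Φ (deg j)) =
          ∑ i ∈ (f.support.filter fun i => deg i = deg j).attach, ⟨x i, hmem i i.2⟩ := by
        ext
        rw [AddSubgroup.val_finsetSum]
        exact (Finset.sum_attach _ x).symm
      rw [← GrPiece.mk_eq_zero (a := ⟨_, sum_mem hmem⟩), hsum, map_sum, ← hc,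
        Finset.sum_congr rfl hval, ← Finset.sum_filter_add_sum_filter_not f.support
          (fun i => deg i = deg j), Finset.sum_eq_zero (s := f.support.filter fun i => ¬ deg i = deg j)
          (fun i hi => dif_neg (Finset.mem_filter.mp hi).2), add_zero,
        ← Finset.sum_attach (f.support.filter fun i => deg i = deg j)]
      refine Finset.sum_congr rfl fun i _ => ?_
      rw [dif_pos (Finset.mem_filter.mp i.2).2]
    · rw [DFinsupp.notMem_support_iff.mp hj]
      rfl
  · let T := (DirectSum.coeAddMonoidHom fun j => symbols Φ Φlt (deg j) (F j)).range
    have hT : ∀ {j y}, y ∈ symbols Φ Φlt (deg j) (F j) → y ∈ T := fun {j y} hy =>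
      ⟨DirectSum.of (fun j => symbols Φ Φlt (deg j) (F j)) j ⟨y, hy⟩,
        DirectSum.coeAddMonoidHom_of _ j ⟨y, hy⟩⟩
    have key : ∀ i, ∀ a ∈ Φ i, ∃ ha : a ∈ Φ i,
        DirectSum.of (GrPiece Φ Φlt) i (GrPiece.mk Φ Φlt i ⟨a, ha⟩) ∈ T := by
      intro i
      have hB : Φ i ≤ (T.comap ((DirectSum.of (GrPiece Φ Φlt) i).comp
          (GrPiece.mk Φ Φlt i))).map (Φ i).subtype := by
        refine (h.le_sup i).trans (sup_le (fun a ha => ?_) (iSup₂_le fun j hj a ha => ?_))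
        · refine ⟨⟨a, hΦ i ha⟩, ?_, rfl⟩
          change DirectSum.of _ i (GrPiece.mk Φ Φlt i _) ∈ T
          rw [GrPiece.mk_eq_zero.mpr ha, map_zero]
          exact zero_mem _
        · subst hj
          exact ⟨⟨a, h.le j ha⟩, hT ⟨_, ⟨⟨a, h.le j ha⟩, ha, rfl⟩, rfl⟩, rfl⟩
      intro a ha
      obtain ⟨a', ha', rfl⟩ := hB ha
      exact ⟨a'.2, ha'⟩
    intro y
    change y ∈ T
    induction y using DirectSum.induction_on with
    | zero => exact zero_mem _
    | of i y =>
      obtain ⟨a, rfl⟩ := GrPiece.mk_surjective Φ Φlt i y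
      exact (key i a a.2).2
    | add y z hy hz => exact add_mem hy hz

theorem isRefinement_biLt (F : ℤ × ℤ → AddSubgroup A) :
    IsRefinement F F (biLt F) (AddMonoidHom.id _) where
  le _ := le_rfl
  biLt_le _ := le_rfl
  le_sup i := le_sup_of_le_right (le_iSup₂_of_le i rfl le_rfl)
  indep i J x hx hsum j hj := by
    have hJ : J = {j} := Finset.eq_singleton_iff_unique_mem.mpr
      ⟨hj, fun k hk => (hx k hk).1.trans (hx j hj).1.symm⟩
    rw [hJ, Finset.sum_singleton] at hsum
    have hji : j = i := (hx j hj).1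
    rwa [← hji] at hsum

end Refinement

section Weight

variable {A : Type*} [AddCommGroup A] {F : ℤ × ℤ → AddSubgroup A}

/-- The degree `a d + b k` with respect to `L = a F + b V`. -/
def degL (a b : ℝ) : ℤ × ℤ →+ ℝ where
  toFun j := a * j.1 + b * j.2
  map_zero' := by simp
  map_add' i j := by simp; ring

theorem degL_apply (a b : ℝ) (j : ℤ × ℤ) : degL a b j = a * j.1 + b * j.2 := rfl

/-- The distributivity which makes the two filtrations of a nicely bifiltered module compatible: an
element of `F (d, k)` which is the sum of an element of `⋃ F (d - 1, ·)` and an element of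
`⋃ F (·, k - 1)` is the sum of an element of `F (d - 1, k)` and an element of `F (d, k - 1)`. -/
theorem IsNice.mem_biLt (hF : Monotone F) (hnice : IsNice F) {j : ℤ × ℤ} {x : A} (hx : x ∈ F j)
    (h : x ∈ (⨆ k, F (j.1 - 1, k)) ⊔ ⨆ d, F (d, j.2 - 1)) : x ∈ biLt F j := by
  have hd₁ : Directed (· ≤ ·) fun k => F (j.1 - 1, k) :=
    Monotone.directed_le fun k l hkl => hF ⟨le_rfl, hkl⟩
  have hd₂ : Directed (· ≤ ·) fun d => F (d, j.2 - 1) :=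
    Monotone.directed_le fun k l hkl => hF ⟨hkl, le_rfl⟩
  obtain ⟨y, hy, z, hz, e⟩ := AddSubgroup.mem_sup.mp h
  obtain ⟨k, hk⟩ := (AddSubgroup.mem_iSup_of_directed hd₁).mp hy
  obtain ⟨d, hd⟩ := (AddSubgroup.mem_iSup_of_directed hd₂).mp hz
  refine AddSubgroup.mem_sup.mpr ⟨y, ?_, z, ?_, e⟩
  · refine (Set.ext_iff.mp (hnice (j.1 - 1) j.2) y).mp
      ⟨Set.mem_iUnion.mpr ⟨max d j.1, ?_⟩, Set.mem_iUnion.mpr ⟨k, hk⟩⟩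
    rw [← add_sub_cancel_right y z, e]
    exact sub_mem (hF (Prod.mk_le_mk.mpr ⟨le_max_right _ _, le_rfl⟩ : j ≤ _) hx)
      (hF (Prod.mk_le_mk.mpr ⟨le_max_left _ _, by simp⟩) hd)
  · refine (Set.ext_iff.mp (hnice j.1 (j.2 - 1)) z).mp
      ⟨Set.mem_iUnion.mpr ⟨d, hd⟩, Set.mem_iUnion.mpr ⟨max k j.2, ?_⟩⟩
    rw [← add_sub_cancel_left y z, e]
    exact sub_mem (hF (Prod.mk_le_mk.mpr ⟨le_rfl, le_max_right _ _⟩ : j ≤ _) hx)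
      (hF (Prod.mk_le_mk.mpr ⟨by simp, le_max_left _ _⟩) hk)

/-- Of two different bidegrees, the one with the smaller `L`-degree has a smaller first or second
entry. -/
theorem le_sup_of_degL_le {a b : ℝ} (ha : 0 < a) (hb : 0 < b) (hF : Monotone F) {i j : ℤ × ℤ}
    (hij : i ≠ j) (h : degL a b i ≤ degL a b j) :
    F i ≤ (⨆ k, F (j.1 - 1, k)) ⊔ ⨆ d, F (d, j.2 - 1) := by
  rw [degL_apply, degL_apply] at h
  by_cases h1 : i.1 < j.1
  · exact le_sup_of_le_left (le_iSup_of_le i.2 (hF (Prod.mk_le_mk.mpr ⟨by omega, le_rfl⟩ : i ≤ _)))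
  · have h2 : i.2 < j.2 := by
      by_contra h2
      push Not at h1 h2
      have h1' : (j.1 : ℝ) ≤ i.1 := by exact_mod_cast h1
      have h2' : (j.2 : ℝ) ≤ i.2 := by exact_mod_cast h2
      apply hij
      have e1 : (i.1 : ℝ) = j.1 := by nlinarith
      have e2 : (i.2 : ℝ) = j.2 := by nlinarith
      ext
      · exact_mod_cast e1
      · exact_mod_cast e2
    exact le_sup_of_le_right
      (le_iSup_of_le i.1 (hF (Prod.mk_le_mk.mpr ⟨le_rfl, by omega⟩ : i ≤ _)))

theorem isRefinement_L {a b : ℝ} (ha : 0 < a) (hb : 0 < b) (hF : Monotone F) (hnice : IsNice F) :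
    IsRefinement F (LFil a b F) (LLt a b F) (degL a b) where
  le _ := le_LFil le_rfl
  biLt_le j := sup_le (le_LLt (by rw [degL_apply]; push_cast; linarith))
    (le_LLt (by rw [degL_apply]; push_cast; linarith))
  le_sup i := iSup₂_le fun j hj => by
    rcases hj.lt_or_eq with h | h
    · exact le_sup_of_le_left (le_LLt h)
    · exact le_sup_of_le_right (le_iSup₂_of_le j h le_rfl)
  indep i J x hx hsum j hj := by
    refine hnice.mem_biLt hF (hx j hj).2 ?_
    rw [← Finset.add_sum_erase J x hj] at hsum
    rw [← add_sub_cancel_right (x j) (∑ l ∈ J.erase j, x l)]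
    refine sub_mem ?_ (sum_mem fun l hl => ?_)
    · have hle : LLt a b F i ≤ (⨆ k, F (j.1 - 1, k)) ⊔ ⨆ d, F (d, j.2 - 1) :=
        iSup₂_le fun l hl => by
          have hlt : degL a b l < degL a b j := by rw [(hx j hj).1]; exact hl
          exact le_sup_of_degL_le ha hb hF (fun e => hlt.ne (by rw [e])) hlt.le
      exact hle hsum
    · have hl' := hx l (Finset.mem_of_mem_erase hl)
      exact le_sup_of_degL_le ha hb hF (Finset.ne_of_mem_erase hl)
        (hl'.1.trans (hx j hj).1.symm).le hl'.2

theorem IsNice.niceFamily (hnice : IsNice F) : NiceFamily F := by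
  rintro d k x ⟨h1, h2⟩
  refine (Set.ext_iff.mp (hnice (d - 1) (k - 1)) x).mp
    ⟨Set.mem_iUnion.mpr ⟨d, h2⟩, Set.mem_iUnion.mpr ⟨k, h1⟩⟩

theorem isNice_FV (n p : ℕ) : IsNice (FV n p) := by
  intro d k
  ext P
  simp only [Set.mem_inter_iff, Set.mem_iUnion]
  constructor
  · rintro ⟨⟨d', h1⟩, ⟨k', h2⟩⟩
    exact ⟨h2.1, h1.2⟩
  · intro h
    exact ⟨⟨d, h⟩, ⟨k, h⟩⟩

end Weight

section Comparison

variable {ι : Type*} [AddCommGroup ι] [PartialOrder ι] [IsOrderedAddMonoid ι] [DecidableEq ι]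
  {n p : ℕ} {M : Type*} [AddCommGroup M] [Module (D n p) M] {F : ℤ × ℤ → AddSubgroup M}
  [IsModuleFiltration (FV n p) (biLt (FV n p)) F (biLt F)]
  {Φ Φlt : ι → AddSubgroup (D n p)} [IsRingFiltration Φ Φlt] {Γ Γlt : ι → AddSubgroup M}
  [IsModuleFiltration Φ Φlt Γ Γlt] {deg : ℤ × ℤ →+ ι}

theorem IsRefinement.isBigraded (hΦ : IsRefinement (FV n p) Φ Φlt deg)
    (hΓ : IsRefinement F Γ Γlt deg) :
    IsBigraded (fun j => symbols Φ Φlt (deg j) (FV n p j)) fun j => symbols Γ Γlt (deg j) (F j) where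
  ring_mul :=
    { one_mem := hΦ.isSymbol.mem_iff.mpr ⟨1, SetLike.GradedOne.one_mem, by
        have h0 := hΦ.le 0 (SetLike.GradedOne.one_mem (A := FV n p))
        rw [grSymbol_of_mem h0]
        exact DirectSum.of_eq_of_gradedMonoid_eq (GrPiece.sigma_ext (map_zero deg) rfl)⟩
      mul_mem := fun i j x y hx hy => by
        obtain ⟨a, ha, rfl⟩ := hΦ.isSymbol.mem_iff.mp hx
        obtain ⟨b, hb, rfl⟩ := hΦ.isSymbol.mem_iff.mp hy
        exact hΦ.isSymbol.mem_iff.mpr ⟨a * b, SetLike.GradedMul.mul_mem ha hb,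
          grSymbol_mul (map_add deg i j) (hΦ.le i ha) (hΦ.le j hb)⟩ }
  ring_internal := hΦ.isInternal fun i => IsFiltration.F_lt_le_F Φ Φlt i
  module_smul :=
    { smul_mem := fun i j x y hx hy => by
        obtain ⟨a, ha, rfl⟩ := hΦ.isSymbol.mem_iff.mp hx
        obtain ⟨b, hb, rfl⟩ := hΓ.isSymbol.mem_iff.mp hy
        exact hΓ.isSymbol.mem_iff.mpr ⟨a • b,
          SetLike.GradedSMul.smul_mem (A := FV n p) (B := F) ha hb,
          grSymbol_smul (map_add deg i j) (hΦ.le i ha) (hΓ.le j hb)⟩ }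
  module_internal := hΓ.isInternal fun i => IsFiltration.F_lt_le_F Γ Γlt i

/-- A bifiltered free resolution induces a bigraded one of the associated graded module, with the
same shifts, and all bigraded resolutions have the same `K`-polynomial. -/
theorem IsRefinement.isKPoly (hΦ : IsRefinement (FV n p) Φ Φlt deg)
    (hΓ : IsRefinement F Γ Γlt deg) (hnice : IsNice F) (S : FreeResolution (FV n p) F) :
    IsKPoly (fun j => symbols Φ Φlt (deg j) (FV n p j)) (fun j => symbols Γ Γlt (deg j) (F j))
      S.kPoly := by
  have hb := hΦ.isBigraded hΓ
  have hss : SymbolSMul (FV n p) (FV n p) (fun j => grSymbol Φ Φlt (deg j))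
      fun j => grSymbol Φ Φlt (deg j) := fun i j a x ha hx =>
    grSymbol_mul (map_add deg i j) (hΦ.le i ha) (hΦ.le j hx)
  have hst : SymbolSMul (FV n p) F (fun j => grSymbol Φ Φlt (deg j))
      fun j => grSymbol Γ Γlt (deg j) := fun i j a x ha hx =>
    grSymbol_smul (map_add deg i j) (hΦ.le i ha) (hΓ.le j hx)
  have h1 : grSymbol Φ Φlt (deg 0) (1 : D n p) = 1 := by
    rw [grSymbol_of_mem (hΦ.le 0 (SetLike.GradedOne.one_mem (A := FV n p)))]
    exact DirectSum.of_eq_of_gradedMonoid_eq (GrPiece.sigma_ext (map_zero deg) rfl)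
  let S' := S.symbol isMulFamily_FV (IsFiltration.mono (F := FV n p)) (isNice_FV n p).niceFamily
    hΦ.isSymbol hss hb.ring_internal hΓ.isSymbol hst
    (fun _ _ _ _ ha hx => SetLike.GradedSMul.smul_mem (A := FV n p) (B := F) ha hx)
    hnice.niceFamily hb.module_internal
  exact ⟨⟨S'⟩, fun R => kPoly_unique_of_isSymbol hΦ.isSymbol hss h1 R S'⟩

end Comparison

end BifilteredD

theorem proposition14 (n p : ℕ) {M : Type*} [AddCommGroup M] [Module (D n p) M]
    (F : ℤ × ℤ → AddSubgroup M) [IsModuleFiltration (FV n p) (biLt (FV n p)) F (biLt F)]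
    (hgood : IsGood (n := n) (p := p) F) (hnice : IsNice F) :
    ∃ K : AddMonoidAlgebra ℤ (ℤ × ℤ),
      IsKPoly (FV n p) F K ∧
      (IsBigraded (bigrPiece (FV n p)) (bigrPiece F) ∧
        IsKPoly (bigrPiece (FV n p)) (bigrPiece F) K) ∧
      ∃ ε₀ : ℝ, 0 < ε₀ ∧ ∀ ε : ℝ, 0 < ε → ε < ε₀ →
        (IsBigraded (grLPiece ε 1 (FV n p)) (grLPiece ε 1 F) ∧
          IsKPoly (grLPiece ε 1 (FV n p)) (grLPiece ε 1 F) K) ∧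
        (IsBigraded (grLPiece 1 ε (FV n p)) (grLPiece 1 ε F) ∧
          IsKPoly (grLPiece 1 ε (FV n p)) (grLPiece 1 ε F) K) := by
  have hF : Monotone F := IsFiltration.mono
  have hFV : Monotone (FV n p) := IsFiltration.mono
  have hbD := isRefinement_biLt (FV n p)
  have hbF := isRefinement_biLt F
  have hLD := fun {a b : ℝ} (ha : 0 < a) (hb : 0 < b) =>
    isRefinement_L ha hb hFV (isNice_FV n p)
  have hLF := fun {a b : ℝ} (ha : 0 < a) (hb : 0 < b) => isRefinement_L ha hb hF hnice
  obtain ⟨S⟩ := hgood.nonempty_freeResolution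
  refine ⟨S.kPoly, ⟨⟨S⟩, fun R => ?_⟩, ⟨hbD.isBigraded hbF, hbD.isKPoly hbF hnice S⟩,
    1, one_pos, fun ε hε _ => ⟨⟨?_, ?_⟩, ?_, ?_⟩⟩
  · -- both resolutions induce resolutions of `bigr(M)`, where `K`-polynomials are unique
    obtain ⟨⟨S'⟩, h⟩ := hbD.isKPoly hbF hnice S
    obtain ⟨-, h'⟩ := hbD.isKPoly hbF hnice R
    exact (h' S').symm.trans (h S')
  · exact (hLD hε one_pos).isBigraded (hLF hε one_pos)
  · exact (hLD hε one_pos).isKPoly (hLF hε one_pos) hnice S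
  · exact (hLD one_pos hε).isBigraded (hLF one_pos hε)
  · exact (hLD one_pos hε).isKPoly (hLF one_pos hε) hnice S
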